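/- Let $\mathcal X$ be the Ginibre point process in the plane $\mathbb C\cong\mathbb R^2$, i.e. a random locally finite set of points which is determinantal with kernel $$K(x,y)=e^{-\frac{\pi}{2}\left(|x|^2+|y|^2-2x\overline y\right)},\qquad x,y\in\mathbb C,$$ meaning that for every $k\ge 1$ and every nonnegative Borel function $F$ on $\mathbb C^k$, $$\mathbb E\sum F(x_{1},\dots,x_{k})=\int_{\mathbb C^k}F(x_1,\dots,x_k)\,\det\big(K(x_i,x_j)\big)_{1\le i,j\le k}\,dx_1\cdots dx_k,$$ where the sum runs over all $k$-tuples of pairwise distinct points of $\mathcal X$ and $dx_j$ is Lebesgue measure on $\mathbb C$. For $N>0$ let $$\mathcal W_N=\frac{1}{2\pi N^2}\sum_{\substack{a\ne b\\ a,b\in \mathcal X\cap[0,N]^2}}E_N(a-b)+\log\frac{N}{2\pi\,\eta(i)^2},$$ the sum being over ordered pairs, where $$E_N(x)=\sum_{(m,n)\in\mathbb Z^2\setminus\{0\}}e^{2i\pi\left(m\,\mathrm{Re}(x/N)+n\,\mathrm{Im}(x/N)\right)}\frac{1}{|mi+n|^2}$$ is the Eisenstein series $E_{\mathrm{Re}(x/N),\mathrm{Im}(x/N)}(\tau)$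 at $\tau=i$ (for $x\notin N\mathbb Z^2$ a conditionally convergent series, summed as the limit of its partial sums over the squares $|m|,|n|\le R$, $R\to\infty$; almost surely no difference $a-b$ with $a\neq b$ lies in $N\mathbb Z^2$), and $\eta(\tau)=q^{1/24}\prod_{k\ge1}(1-q^k)$, $q=e^{2i\pi\tau}$, is the Dedekind eta function. Then $\mathcal W_N$ is a square integrable random variable for every $N>0$, and $$\lim_{N\to\infty}\mathrm{Var}(\mathcal W_N)=0 .$$ -/

import Mathlib

open MeasureTheory ProbabilityTheory Filter Topology
open scoped ENNReal

noncomputable section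

namespace Ginibre

/-- A (multiplicity-free) random point process in the plane `ℂ`, realised on the measurable space
`Ω`: a random locally finite set of points, all of whose counting variables are measurable. -/
structure IsPointProcess {Ω : Type*} [MeasurableSpace Ω] (X : Ω → Set ℂ) : Prop where
  locallyFinite : ∀ (ω : Ω) (C : Set ℂ), IsCompact C → (X ω ∩ C).Finite
  measurable_count : ∀ B : Set ℂ, MeasurableSet B → Measurable fun ω => (X ω ∩ B).encard

/-- The `k`-tuples of pairwise distinct points of the configuration `S`. -/
def distinctTuples (k : ℕ) (S : Set ℂ) : Set (Fin k → ℂ) :=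
  {x | Function.Injective x ∧ ∀ i, x i ∈ S}

/-- `ρ` is the `k`-point correlation function of the point process `X` under the law `P`:
`𝔼 ∑ F(x_{i₁}, …, x_{i_k}) = ∫ F ρ` for all nonnegative Borel test functions `F`, where the sum
runs over the `k`-tuples of pairwise distinct points of the process. -/
def HasCorrelation {Ω : Type*} [MeasurableSpace Ω] (P : Measure Ω) (X : Ω → Set ℂ) (k : ℕ)
    (ρ : (Fin k → ℂ) → ℝ) : Prop :=
  (∀ x, 0 ≤ ρ x) ∧
  ∀ F : (Fin k → ℂ) → ℝ≥0∞, Measurable F →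
    ∫⁻ ω, ∑' x : distinctTuples k (X ω), F x ∂P = ∫⁻ x, F x * ENNReal.ofReal (ρ x)

/-- `X` is a determinantal point process with correlation kernel `K` under `P`: for every `k ≥ 1`
the function `det (K (x_i, x_j))` (which is required to be real) is its `k`-point correlation
function. -/
structure IsDeterminantal {Ω : Type*} [MeasurableSpace Ω] (P : Measure Ω) (X : Ω → Set ℂ)
    (K : ℂ → ℂ → ℂ) : Prop where
  isPointProcess : IsPointProcess X
  correlation : ∀ k : ℕ, 1 ≤ k → ∃ ρ : (Fin k → ℂ) → ℝ,
    (∀ x, (ρ x : ℂ) = (Matrix.of fun i j => K (x i) (x j)).det) ∧ HasCorrelation P X k ρ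

/-- The kernel `K(x, y) = exp (-(π/2) (|x|² + |y|² - 2 x ȳ))`. -/
def ginibreKernel (x y : ℂ) : ℂ :=
  Complex.exp (-(Real.pi / 2 : ℂ) *
    ((‖x‖ : ℂ) ^ 2 + (‖y‖ : ℂ) ^ 2 - 2 * x * (starRingEnd ℂ) y))

/-- The partial sum over `|m|, |n| ≤ R`, `(m, n) ≠ (0, 0)`, of the Eisenstein series
`E_{u,v}(τ) = ∑ e^{2iπ(mu+nv)} Im τ / |mτ + n|²`. -/
def eisensteinPartial (R : ℕ) (u v : ℝ) (τ : ℂ) : ℂ :=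
  ∑ p ∈ ((Finset.Icc (-(R : ℤ)) R) ×ˢ (Finset.Icc (-(R : ℤ)) R)).erase (0, 0),
    Complex.exp (2 * Complex.I * Real.pi * (p.1 * u + p.2 * v)) *
      ((τ.im / ‖(p.1 : ℂ) * τ + p.2‖ ^ 2 : ℝ) : ℂ)

/-- The Eisenstein series `E_{u,v}(τ)`. For `(u, v) ∉ ℤ²` the series converges only
conditionally; its sum is the limit of the sums over growing squares of indices. For
`(u, v) ∈ ℤ²` it diverges (the value is then meaningless). -/
def eisenstein (u v : ℝ) (τ : ℂ) : ℂ :=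
  limUnder atTop fun R : ℕ => eisensteinPartial R u v τ

/-- `E_N(x) = E_{Re(x/N), Im(x/N)}(i)`, which is a real number. -/
def eisensteinE (N : ℝ) (x : ℂ) : ℝ :=
  (eisenstein (x / N).re (x / N).im Complex.I).re

/-- The renormalized energy
`𝒲_N = 1/(2πN²) ∑_{i ≠ j, a_i, a_j ∈ [0,N]²} E_N(a_i - a_j) + log (N / (2π η(i)²))`
of the configuration of points `S`; here `η` is the Dedekind eta function and `η(i) > 0`. -/
def renormalizedEnergy (N : ℝ) (S : Set ℂ) : ℝ :=
  1 / (2 * Real.pi * N ^ 2) *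
      (∑ᶠ p ∈ (S ∩ (Set.Icc 0 N ×ℂ Set.Icc 0 N)).offDiag, eisensteinE N (p.1 - p.2)) +
    Real.log (N / (2 * Real.pi * (ModularForm.eta Complex.I).re ^ 2))

end Ginibre

end

/-! Write `g(a,b) = E_N(a - b)`, `k(a,b) = |K(a,b)|² = e^{-π|a-b|²}` and `S = ∑_{a≠b} g(a,b)` over
the points in the square. Up to an additive constant the renormalized energy is `S / (2πN²)`, so the
claim is `Var S = o(N⁴)`.

Two facts about `g` suffice. It is centered: no Fourier mode of the Eisenstein series is constant,
so `∫ g(a,b) db = 0` for every `a`. It is square integrable uniformly in scale: its coefficients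
`1/|p|²` are square summable, so on the unit torus it is an `L²` limit of trigonometric polynomials,
which are bounded and Lipschitz. Rescaled by `N`, it hardly varies over distances of order one, up
to an error measured by `eisTail R`.

The square of `S` splits into sums over quadruples, triples and pairs of distinct points
(`sq_tupleSum_two`), and the correlation functions are explicit determinants. Centering kills every
term of the determinant that leaves some variable seen by a single factor `g`. What remains is the
following. Let `A = ∬ g²` be `selfEnergy` and `B = ∭ g(a,c) g(b,c) k(a,b)` be `crossEnergy`. Pairs
contribute at most `2A`. Triples contribute `-4B` plus 3-cycles. Quadruples contribute `(𝔼 S)²`, at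
most `2A` from the other two products of transpositions, and 4-cycles. All cycles are localized near
`a = b`, hence controlled by `shortEnergy`. Thus `Var S ≤ 4 (A - B) + 400 · shortEnergy`
(`variance_energySum_le`).

`A` alone admits only a bound of order `N⁴`; the point is that `A - B` is smaller. Since `∫ k(a,b)
db = 1` over the whole plane, `A - B` equals a boundary term, where the Gaussian leaks out of the
square, plus half of `∭ (g(a,c) - g(b,c))² k(a,b)` (`selfEnergy_sub_crossEnergy`). The latter
compares `g` at points at distance of order one, and `shortEnergy` sees only pairs at such distance.
Replacing `g` by its `R`-th partial sum bounds both, after division by `N⁴`, by a multiple of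
`eisTail R` plus a term vanishing as `N → ∞` with `R` fixed. Letting `R` grow concludes. -/

namespace Ginibre

/-! ### Fourier characters on the square. -/

/-- The square `[0, N]²` in the complex plane. -/
def square (N : ℝ) : Set ℂ := Set.Icc 0 N ×ℂ Set.Icc 0 N

/-- The character `z ↦ e^{2iπ (m Re z + n Im z)}` of the plane. -/
noncomputable def planeChar (p : ℤ × ℤ) (z : ℂ) : ℂ :=
  Complex.exp (2 * Complex.I * Real.pi * (p.1 * z.re + p.2 * z.im))

lemma isCompact_square (N : ℝ) : IsCompact (square N) := isCompact_Icc.reProdIm isCompact_Icc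

lemma measurableSet_square (N : ℝ) : MeasurableSet (square N) :=
  (isCompact_square N).measurableSet

instance isFiniteMeasure_restrict_square (N : ℝ) :
    IsFiniteMeasure ((volume : Measure ℂ).restrict (square N)) :=
  ⟨by simpa using (isCompact_square N).measure_lt_top⟩

lemma setIntegral_square_mul (N : ℝ) (u v : ℝ → ℂ) :
    ∫ y in square N, u y.re * v y.im = (∫ s in Set.Icc 0 N, u s) * ∫ t in Set.Icc 0 N, v t := by
  rw [← setIntegral_prod_mul]
  have := (Complex.volume_preserving_equiv_real_prod.symm).setIntegral_preimage_emb
    (MeasurableEquiv.measurableEmbedding _) (fun y : ℂ => u y.re * v y.im) (square N)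
  rw [← this]
  rfl

lemma integral_exp_Icc (N : ℝ) (hN : 0 < N) (m : ℤ) (s : ℝ) :
    ∫ t in Set.Icc 0 N, Complex.exp (2 * Complex.I * Real.pi * (m * ((s - t) / N : ℝ))) =
      if m = 0 then (N : ℂ) else 0 := by
  rw [integral_Icc_eq_integral_Ioc, ← intervalIntegral.integral_of_le hN.le]
  split_ifs with h
  · simp [h]
  have hN' : (N : ℂ) ≠ 0 := by exact_mod_cast hN.ne'
  have hm : (m : ℂ) ≠ 0 := by exact_mod_cast h
  have hpi : (Real.pi : ℂ) ≠ 0 := by exact_mod_cast Real.pi_ne_zero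
  have hc : -(2 * Complex.I * Real.pi * m / N) ≠ 0 := by
    simp [hN', hm, hpi, Complex.I_ne_zero]
  have h1 : ∀ t : ℝ, Complex.exp (2 * Complex.I * Real.pi * (m * ((s - t) / N : ℝ))) =
      Complex.exp (2 * Complex.I * Real.pi * m * s / N) *
        Complex.exp (-(2 * Complex.I * Real.pi * m / N) * t) := fun t => by
    rw [← Complex.exp_add]
    congr 1
    push_cast
    ring
  simp_rw [h1]
  rw [intervalIntegral.integral_const_mul, integral_exp_mul_complex hc]
  have h2 : -(2 * Complex.I * Real.pi * m / N) * (N : ℂ) = ((-m : ℤ) : ℂ) * (2 * Real.pi * Complex.I) := by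
    push_cast
    field_simp
  rw [h2, Complex.exp_int_mul_two_pi_mul_I]
  simp

/-- The square is one full period of the character, so the shift `α` is harmless: the integral
splits into two one-dimensional integrals over a period. -/
lemma integral_planeChar (N : ℝ) (hN : 0 < N) (α : ℂ) (p : ℤ × ℤ) :
    ∫ y in square N, planeChar p ((α - y) / N) = if p = 0 then (N : ℂ) ^ 2 else 0 := by
  have h1 : ∀ y : ℂ, planeChar p ((α - y) / N) =
      Complex.exp (2 * Complex.I * Real.pi * (p.1 * ((α.re - y.re) / N : ℝ))) *
      Complex.exp (2 * Complex.I * Real.pi * (p.2 * ((α.im - y.im) / N : ℝ))) := fun y => by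
    rw [planeChar, ← Complex.exp_add, Complex.div_ofReal_re, Complex.div_ofReal_im]
    congr 1
    push_cast [Complex.sub_re, Complex.sub_im]
    ring
  simp_rw [h1]
  rw [setIntegral_square_mul N
    (fun s => Complex.exp (2 * Complex.I * Real.pi * (p.1 * ((α.re - s) / N : ℝ))))
    (fun s => Complex.exp (2 * Complex.I * Real.pi * (p.2 * ((α.im - s) / N : ℝ)))),
    integral_exp_Icc N hN, integral_exp_Icc N hN]
  obtain ⟨m, n⟩ := p
  by_cases hm : m = 0 <;> by_cases hn : n = 0 <;> simp [hm, hn, sq]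

lemma planeChar_eq (p : ℤ × ℤ) (z : ℂ) :
    planeChar p z = Complex.exp ((2 * Real.pi * (p.1 * z.re + p.2 * z.im) : ℝ) * Complex.I) := by
  rw [planeChar]
  congr 1
  push_cast
  ring

lemma norm_planeChar (p : ℤ × ℤ) (z : ℂ) : ‖planeChar p z‖ = 1 := by
  rw [planeChar_eq, Complex.norm_exp_ofReal_mul_I]

lemma planeChar_mul_conj (p q : ℤ × ℤ) (z : ℂ) :
    planeChar p z * (starRingEnd ℂ) (planeChar q z) = planeChar (p - q) z := by
  rw [planeChar_eq, planeChar_eq, planeChar_eq, ← Complex.exp_conj, ← Complex.exp_add]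
  congr 1
  simp only [map_mul, Complex.conj_ofReal, Complex.conj_I, Prod.fst_sub, Prod.snd_sub]
  push_cast
  ring

lemma continuous_planeChar (p : ℤ × ℤ) : Continuous (planeChar p) := by
  unfold planeChar
  fun_prop

lemma norm_planeChar_sub_le (p : ℤ × ℤ) (z w : ℂ) :
    ‖planeChar p z - planeChar p w‖ ≤ 2 * Real.pi * (|(p.1 : ℝ)| + |(p.2 : ℝ)|) * ‖z - w‖ := by
  have h1 : planeChar p z = planeChar p w * planeChar p (z - w) := by
    rw [planeChar, planeChar, planeChar, ← Complex.exp_add]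
    congr 1
    push_cast [Complex.sub_re, Complex.sub_im]
    ring
  rw [h1, ← mul_sub_one, norm_mul, norm_planeChar, one_mul, planeChar_eq, mul_comm _ Complex.I]
  refine (Real.norm_exp_I_mul_ofReal_sub_one_le).trans ?_
  rw [norm_mul, mul_assoc (2 * Real.pi)]
  have : ‖(2 * Real.pi : ℝ)‖ = 2 * Real.pi := by
    rw [Real.norm_of_nonneg (by positivity)]
  rw [this]
  gcongr
  calc ‖(p.1 : ℝ) * (z - w).re + p.2 * (z - w).im‖
      ≤ |(p.1 : ℝ)| * |(z - w).re| + |(p.2 : ℝ)| * |(z - w).im| := by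
        rw [← abs_mul, ← abs_mul]; exact norm_add_le _ _
    _ ≤ |(p.1 : ℝ)| * ‖z - w‖ + |(p.2 : ℝ)| * ‖z - w‖ := by
        gcongr
        · exact Complex.abs_re_le_norm _
        · exact Complex.abs_im_le_norm _
    _ = _ := by ring

/-- Parseval for trigonometric polynomials: in the expanded square only the diagonal `p = q`
survives integration over a period. -/
lemma integral_normSq_sum_planeChar (N : ℝ) (hN : 0 < N) (α : ℂ) (s : Finset (ℤ × ℤ))
    (c : ℤ × ℤ → ℝ) :
    ∫ y in square N, ‖∑ p ∈ s, planeChar p ((α - y) / N) * (c p : ℂ)‖ ^ 2 =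
      N ^ 2 * ∑ p ∈ s, c p ^ 2 := by
  have h1 : ∀ z : ℂ, ((‖∑ p ∈ s, planeChar p z * (c p : ℂ)‖ ^ 2 : ℝ) : ℂ) =
      ∑ p ∈ s, ∑ q ∈ s, (c p * c q : ℂ) * planeChar (p - q) z := fun z => by
    rw [Complex.ofReal_pow, ← Complex.mul_conj', map_sum, Finset.sum_mul_sum]
    refine Finset.sum_congr rfl fun p _ => Finset.sum_congr rfl fun q _ => ?_
    rw [← planeChar_mul_conj, map_mul, Complex.conj_ofReal]
    ring
  have hint : ∀ p q : ℤ × ℤ, Integrable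
      (fun y : ℂ => (c p * c q : ℂ) * planeChar (p - q) ((α - y) / N))
      (volume.restrict (square N)) := fun p q =>
    (Continuous.continuousOn ((continuous_const.mul
      ((continuous_planeChar _).comp (by fun_prop))))).integrableOn_compact (isCompact_square N)
  apply Complex.ofReal_injective
  rw [← integral_complex_ofReal]
  simp_rw [h1]
  rw [integral_finsetSum _ fun p _ => integrable_finsetSum _ fun q _ => hint p q]
  push_cast
  rw [Finset.mul_sum]
  refine Finset.sum_congr rfl fun p hp => ?_
  rw [integral_finsetSum _ fun q _ => hint p q]
  simp_rw [integral_const_mul, integral_planeChar N hN, sub_eq_zero]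
  rw [Finset.sum_eq_single p]
  · simp; ring
  · intro q _ hq
    simp [hq.symm]
  · simp [hp]

/-! ### Partial Eisenstein sums and their `L²` mass. -/

/-- The index set `|m|, |n| ≤ R`, `(m, n) ≠ (0, 0)` of the partial Eisenstein sums. -/
noncomputable def punctBox (R : ℕ) : Finset (ℤ × ℤ) :=
  ((Finset.Icc (-(R : ℤ)) R) ×ˢ (Finset.Icc (-(R : ℤ)) R)).erase (0, 0)

/-- The coefficient `1 / |m i + n|²`. -/
noncomputable def eisCoeff (p : ℤ × ℤ) : ℝ :=
  Complex.I.im / ‖(p.1 : ℂ) * Complex.I + p.2‖ ^ 2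

/-- The partial Eisenstein sum at `τ = i` as a function on the plane. -/
noncomputable def eisPartial (R : ℕ) (z : ℂ) : ℂ := eisensteinPartial R z.re z.im Complex.I

lemma eisPartial_eq (R : ℕ) (z : ℂ) :
    eisPartial R z = ∑ p ∈ punctBox R, planeChar p z * (eisCoeff p : ℂ) := rfl

lemma eisCoeff_eq (p : ℤ × ℤ) : eisCoeff p = 1 / ((p.1 : ℝ) ^ 2 + (p.2 : ℝ) ^ 2) := by
  rw [eisCoeff, ← Complex.normSq_eq_norm_sq, Complex.normSq_apply]
  simp [sq, add_comm]

lemma punctBox_mono {R S : ℕ} (h : R ≤ S) : punctBox R ⊆ punctBox S := by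
  apply Finset.erase_subset_erase
  have : (R : ℤ) ≤ S := by exact_mod_cast h
  apply Finset.product_subset_product <;> apply Finset.Icc_subset_Icc <;> omega

lemma punctBox_zero : punctBox 0 = ∅ := by simp [punctBox]

lemma card_punctBox (R : ℕ) : (punctBox R).card = (2 * R + 1) ^ 2 - 1 := by
  rw [punctBox, Finset.card_erase_of_mem (by simp), Finset.card_product, Int.card_Icc]
  congr 1
  have : ((R : ℤ) + 1 - -R).toNat = 2 * R + 1 := by omega
  rw [this, sq]

/-- The square shell of radius `R + 1` has `8 (R + 1)` lattice points, each with `|p|² ≥ (R + 1)²`,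
hence squared coefficient at most `(R + 1)⁻⁴`. -/
lemma sum_shell_le (R : ℕ) :
    ∑ p ∈ punctBox (R + 1) \ punctBox R, eisCoeff p ^ 2 ≤ 8 / ((R : ℝ) + 1) ^ 3 := by
  have hcard : (punctBox (R + 1) \ punctBox R).card = 8 * (R + 1) := by
    rw [Finset.card_sdiff_of_subset (punctBox_mono R.le_succ), card_punctBox, card_punctBox]
    have : (2 * R.succ + 1) ^ 2 = (2 * R + 1) ^ 2 + 8 * (R + 1) := by
      rw [Nat.succ_eq_add_one]; ring
    have h2 : 1 ≤ (2 * R + 1) ^ 2 := Nat.one_le_pow _ _ (by omega)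
    omega
  have hle : ∀ p ∈ punctBox (R + 1) \ punctBox R, eisCoeff p ^ 2 ≤ 1 / ((R : ℝ) + 1) ^ 4 := by
    intro p hp
    have h1 : ((R : ℝ) + 1) ^ 2 ≤ (p.1 : ℝ) ^ 2 + (p.2 : ℝ) ^ 2 := by
      have h3 : ((R : ℤ) + 1) ≤ |p.1| ∨ ((R : ℤ) + 1) ≤ |p.2| := by
        by_contra! hcon
        simp only [punctBox, Finset.mem_sdiff, Finset.mem_erase, Finset.mem_product,
          Finset.mem_Icc, not_and] at hp
        obtain ⟨⟨hp0, -⟩, hp2⟩ := hp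
        have h1 := abs_lt.1 hcon.1
        have h2 := abs_lt.1 hcon.2
        have := hp2 hp0
        omega
      have key : ∀ k : ℤ, (R : ℤ) + 1 ≤ |k| → ((R : ℝ) + 1) ^ 2 ≤ (k : ℝ) ^ 2 := fun k hk => by
        rw [← sq_abs (k : ℝ)]
        have : ((R : ℝ) + 1) ≤ |(k : ℝ)| := by exact_mod_cast hk
        gcongr
      rcases h3 with h | h
      · nlinarith [key _ h, sq_nonneg (p.2 : ℝ)]
      · nlinarith [key _ h, sq_nonneg (p.1 : ℝ)]
    rw [eisCoeff_eq, div_pow, one_pow]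
    apply one_div_le_one_div_of_le (by positivity)
    calc ((R : ℝ) + 1) ^ 4 = (((R : ℝ) + 1) ^ 2) ^ 2 := by ring
      _ ≤ _ := by gcongr
  calc _ ≤ (punctBox (R + 1) \ punctBox R).card • (1 / ((R : ℝ) + 1) ^ 4) :=
        Finset.sum_le_card_nsmul _ _ _ hle
    _ = 8 / ((R : ℝ) + 1) ^ 3 := by
        rw [hcard, nsmul_eq_mul]
        push_cast
        field_simp

/-- The squared `L²` norm on the unit torus of the partial Eisenstein sum. -/
noncomputable def eisMass (R : ℕ) : ℝ := ∑ p ∈ punctBox R, eisCoeff p ^ 2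

lemma eisMass_succ_sub (R : ℕ) : eisMass (R + 1) - eisMass R ≤ 8 / ((R : ℝ) + 1) ^ 3 := by
  rw [eisMass, eisMass, ← Finset.sum_sdiff (punctBox_mono R.le_succ)]
  simpa using sum_shell_le R

lemma eisMass_mono : Monotone eisMass := fun _ _ h =>
  Finset.sum_le_sum_of_subset_of_nonneg (punctBox_mono h) fun _ _ _ => sq_nonneg _

lemma bddAbove_eisMass : BddAbove (Set.range eisMass) := by
  have hs : Summable fun R : ℕ => 8 / ((R : ℝ) + 1) ^ 3 := by
    have := (summable_nat_add_iff (f := fun n : ℕ => 8 / (n : ℝ) ^ 3) 1).2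
      ((Real.summable_one_div_nat_pow.2 (by norm_num : 1 < 3)).mul_left 8 |>.congr
        fun n => by ring)
    simpa using this
  refine ⟨∑' R : ℕ, 8 / ((R : ℝ) + 1) ^ 3, ?_⟩
  rintro _ ⟨R, rfl⟩
  have h0 : eisMass 0 = 0 := by simp [eisMass, punctBox_zero]
  calc eisMass R = ∑ r ∈ Finset.range R, (eisMass (r + 1) - eisMass r) := by
        rw [Finset.sum_range_sub, h0, sub_zero]
    _ ≤ ∑ r ∈ Finset.range R, 8 / ((r : ℝ) + 1) ^ 3 :=
        Finset.sum_le_sum fun r _ => eisMass_succ_sub r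
    _ ≤ _ := hs.sum_le_tsum _ fun r _ => by positivity

/-- The squared `L²` norm of the remainder of the Eisenstein series on the unit torus. -/
noncomputable def eisTail (R : ℕ) : ℝ := (⨆ S, eisMass S) - eisMass R

lemma eisTail_nonneg (R : ℕ) : 0 ≤ eisTail R := sub_nonneg.2 (le_ciSup bddAbove_eisMass R)

lemma tendsto_eisTail : Tendsto eisTail atTop (𝓝 0) := by
  have := (tendsto_atTop_ciSup eisMass_mono bddAbove_eisMass).const_sub (⨆ S, eisMass S)
  rwa [sub_self] at this

lemma eisPartial_sub (R S : ℕ) (h : R ≤ S) (z : ℂ) :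
    eisPartial S z - eisPartial R z =
      ∑ p ∈ punctBox S \ punctBox R, planeChar p z * (eisCoeff p : ℂ) := by
  rw [eisPartial_eq, eisPartial_eq, ← Finset.sum_sdiff (punctBox_mono h), add_sub_cancel_right]

lemma integral_normSq_eisPartial_sub (N : ℝ) (hN : 0 < N) (α : ℂ) (R S : ℕ) (h : R ≤ S) :
    ∫ y in square N, ‖eisPartial S ((α - y) / N) - eisPartial R ((α - y) / N)‖ ^ 2 =
      N ^ 2 * (eisMass S - eisMass R) := by
  simp_rw [eisPartial_sub R S h]
  rw [integral_normSq_sum_planeChar N hN, eisMass, eisMass,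
    ← Finset.sum_sdiff (punctBox_mono h), add_sub_cancel_right]

lemma continuous_eisPartial (R : ℕ) : Continuous (eisPartial R) := by
  simp_rw [funext (eisPartial_eq R)]
  exact continuous_finsetSum _ fun p _ => (continuous_planeChar p).mul continuous_const

lemma norm_eisPartial_le (R : ℕ) : ∃ M : ℝ, ∀ z, ‖eisPartial R z‖ ≤ M := by
  refine ⟨∑ p ∈ punctBox R, ‖(eisCoeff p : ℂ)‖, fun z => ?_⟩
  rw [eisPartial_eq]
  refine (norm_sum_le _ _).trans (Finset.sum_le_sum fun p _ => ?_)
  rw [norm_mul, norm_planeChar, one_mul]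

lemma norm_eisPartial_sub_le (R : ℕ) :
    ∃ L : ℝ, ∀ z w, ‖eisPartial R z - eisPartial R w‖ ≤ L * ‖z - w‖ := by
  refine ⟨∑ p ∈ punctBox R, 2 * Real.pi * (|(p.1 : ℝ)| + |(p.2 : ℝ)|) * ‖(eisCoeff p : ℂ)‖,
    fun z w => ?_⟩
  rw [eisPartial_eq, eisPartial_eq, ← Finset.sum_sub_distrib, Finset.sum_mul]
  refine (norm_sum_le _ _).trans (Finset.sum_le_sum fun p _ => ?_)
  rw [← sub_mul, norm_mul, mul_right_comm]
  gcongr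
  exact norm_planeChar_sub_le p z w

/-- The punctured box and the coefficients are invariant under `p ↦ -p`. This is the source of the
symmetry of the pair interaction. -/
lemma eisPartial_neg (R : ℕ) (z : ℂ) : eisPartial R (-z) = eisPartial R z := by
  rw [eisPartial_eq, eisPartial_eq]
  refine Finset.sum_nbij' (fun p => -p) (fun p => -p) ?_ ?_ ?_ ?_ ?_
  · intro p hp
    simp only [punctBox, Finset.mem_erase, Finset.mem_product, Finset.mem_Icc, ne_eq,
      Prod.ext_iff, Prod.fst_neg, Prod.snd_neg] at hp ⊢
    omega
  · intro p hp
    simp only [punctBox, Finset.mem_erase, Finset.mem_product, Finset.mem_Icc, ne_eq,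
      Prod.ext_iff, Prod.fst_neg, Prod.snd_neg] at hp ⊢
    omega
  · simp
  · simp
  · intro p _
    rw [eisCoeff_eq, eisCoeff_eq, planeChar_eq, planeChar_eq]
    simp

lemma integral_eisPartial (N : ℝ) (hN : 0 < N) (α : ℂ) (R : ℕ) :
    ∫ y in square N, eisPartial R ((α - y) / N) = 0 := by
  simp_rw [eisPartial_eq]
  rw [integral_finsetSum]
  · refine Finset.sum_eq_zero fun p hp => ?_
    rw [integral_mul_const, integral_planeChar N hN, if_neg, zero_mul]
    exact (Finset.mem_erase.1 hp).1
  · intro p _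
    exact (Continuous.continuousOn (((continuous_planeChar p).comp (by fun_prop)).mul
      continuous_const)).integrableOn_compact (isCompact_square N)

/-- The trivial character integrates to the area. -/
lemma volume_real_square (N : ℝ) (hN : 0 < N) : volume.real (square N) = N ^ 2 := by
  have := integral_planeChar N hN 0 0
  simp only [planeChar, Prod.fst_zero, Prod.snd_zero, Int.cast_zero, zero_mul, add_zero, mul_zero,
    Complex.exp_zero, integral_const, measureReal_restrict_apply_univ, if_true] at this
  rw [Complex.real_smul, mul_one] at this
  exact_mod_cast this

/-! ### Convergence of the Eisenstein series, almost everywhere and in `L²`. -/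

/-- The Eisenstein series at `τ = i` as a function on the plane. -/
noncomputable def eisLim (z : ℂ) : ℂ := eisenstein z.re z.im Complex.I

/-- The pair interaction on the unit torus; `E_N(x)` is its value at `x / N`. -/
noncomputable def torusEnergy (z : ℂ) : ℝ := (eisLim z).re

/-- No convergence is needed here: `limUnder` of measurable functions is measurable, default values
included. -/
lemma stronglyMeasurable_eisLim : StronglyMeasurable eisLim :=
  StronglyMeasurable.limUnder fun R => (continuous_eisPartial R).stronglyMeasurable

lemma measurable_torusEnergy : Measurable torusEnergy :=
  Complex.measurable_re.comp stronglyMeasurable_eisLim.measurable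

/-- The two sequences of partial sums coincide term by term, so their `limUnder` agree even where
the series diverges. -/
lemma torusEnergy_neg (z : ℂ) : torusEnergy (-z) = torusEnergy z := by
  have h : ∀ R : ℕ, eisensteinPartial R (-z).re (-z).im Complex.I =
      eisensteinPartial R z.re z.im Complex.I := fun R => eisPartial_neg R z
  rw [torusEnergy, torusEnergy, eisLim, eisLim, eisenstein, eisenstein]
  simp_rw [h]

lemma continuous_eisPartial_comp (N : ℝ) (α : ℂ) (R : ℕ) :
    Continuous fun y : ℂ => eisPartial R ((α - y) / N) :=
  (continuous_eisPartial R).comp (by fun_prop)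

/-- By Parseval the shell has `L²` norm of order `N (R + 1)^{-3/2}`. Passing to `L¹` by
Cauchy–Schwarz keeps this decay, which is summable in `R`. -/
lemma lintegral_enorm_eisPartial_succ_sub_le (N : ℝ) (hN : 0 < N) (α : ℂ) (R : ℕ) :
    ∫⁻ y in square N, edist (eisPartial R ((α - y) / N)) (eisPartial (R + 1) ((α - y) / N)) ≤
      ENNReal.ofReal (9 / 2 * N ^ 2 * (1 / ((R : ℝ) + 1) ^ (3 / 2 : ℝ))) := by
  set t : ℝ := ((R : ℝ) + 1) ^ (3 / 2 : ℝ) with ht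
  have ht0 : 0 < t := by positivity
  have ht2 : t ^ 2 = ((R : ℝ) + 1) ^ 3 := by
    rw [ht, ← Real.rpow_natCast, ← Real.rpow_mul (by positivity), ← Real.rpow_natCast]
    norm_num
  set D : ℂ → ℂ := fun y => eisPartial (R + 1) ((α - y) / N) - eisPartial R ((α - y) / N) with hD
  have hDc : Continuous D :=
    (continuous_eisPartial_comp N α (R + 1)).sub (continuous_eisPartial_comp N α R)
  have hint : ∀ g : ℂ → ℝ, Continuous g → Integrable g (volume.restrict (square N)) :=
    fun g hg => hg.continuousOn.integrableOn_compact (isCompact_square N)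
  have h1 : ∫⁻ y in square N, edist (eisPartial R ((α - y) / N))
      (eisPartial (R + 1) ((α - y) / N)) = ENNReal.ofReal (∫ y in square N, ‖D y‖) := by
    rw [ofReal_integral_norm_eq_lintegral_enorm
      (hDc.continuousOn.integrableOn_compact (isCompact_square N))]
    refine lintegral_congr fun y => ?_
    rw [edist_comm, edist_eq_enorm_sub]
  rw [h1]
  apply ENNReal.ofReal_le_ofReal
  -- Cauchy–Schwarz in the form `x ≤ 1/(2t) + t x²/2`, with `t = (R + 1)^{3/2}` balancing the two
  -- terms. They contribute `1/2` and `8/2`, whence `9/2`.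
  calc ∫ y in square N, ‖D y‖ ≤ ∫ y in square N, (1 / 2 * t⁻¹ + t / 2 * ‖D y‖ ^ 2) := by
        refine integral_mono (hint _ hDc.norm) (hint _ (by fun_prop)) fun y => ?_
        have := sq_nonneg (t * ‖D y‖ - 1)
        have h3 : ‖D y‖ = t⁻¹ * (t * ‖D y‖) := by field_simp
        have h4 : 1 / 2 * t⁻¹ + t / 2 * ‖D y‖ ^ 2 = t⁻¹ * (1 / 2 + (t * ‖D y‖) ^ 2 / 2) := by
          field_simp
        simp only [h4]
        rw [h3, mul_inv_cancel_left₀ ht0.ne']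
        gcongr
        linarith
    _ = N ^ 2 * (1 / 2 * t⁻¹) + t / 2 * (N ^ 2 * (eisMass (R + 1) - eisMass R)) := by
        rw [integral_add (integrable_const _) (hint _ (by fun_prop)), integral_const,
          measureReal_restrict_apply_univ, volume_real_square N hN, integral_const_mul,
          integral_normSq_eisPartial_sub N hN α R (R + 1) R.le_succ, smul_eq_mul]
    _ ≤ N ^ 2 * (1 / 2 * t⁻¹) + t / 2 * (N ^ 2 * (8 / t ^ 2)) := by
        rw [ht2]
        gcongr
        exact eisMass_succ_sub R
    _ = 9 / 2 * N ^ 2 * (1 / t) := by field_simp; norm_num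

/-- The `L¹` norms of consecutive differences are summable, so for almost every `y` the differences
themselves are summable and the partial sums form a Cauchy sequence. -/
lemma ae_tendsto_eisPartial (N : ℝ) (hN : 0 < N) (α : ℂ) :
    ∀ᵐ y ∂((volume : Measure ℂ).restrict (square N)),
      Tendsto (fun R => eisPartial R ((α - y) / N)) atTop (𝓝 (eisLim ((α - y) / N))) := by
  have hmeas : ∀ R : ℕ, Measurable fun y : ℂ =>
      edist (eisPartial R ((α - y) / N)) (eisPartial (R + 1) ((α - y) / N)) := fun R =>
    (continuous_eisPartial_comp N α R).measurable.edist
      (continuous_eisPartial_comp N α (R + 1)).measurable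
  have hsum : Summable fun R : ℕ => 9 / 2 * N ^ 2 * (1 / ((R : ℝ) + 1) ^ (3 / 2 : ℝ)) := by
    have := (summable_nat_add_iff (f := fun n : ℕ => 1 / (n : ℝ) ^ (3 / 2 : ℝ)) 1).2
      (Real.summable_one_div_nat_rpow.2 (by norm_num))
    simpa using this.mul_left (9 / 2 * N ^ 2)
  have hfin : ∫⁻ y in square N, ∑' R : ℕ,
      edist (eisPartial R ((α - y) / N)) (eisPartial (R + 1) ((α - y) / N)) ≠ ∞ := by
    rw [lintegral_tsum fun R => (hmeas R).aemeasurable]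
    exact ne_top_of_le_ne_top hsum.tsum_ofReal_ne_top
      (ENNReal.tsum_le_tsum fun R => lintegral_enorm_eisPartial_succ_sub_le N hN α R)
  filter_upwards [ae_lt_top (Measurable.tsum hmeas) hfin] with y hy
  have hc := cauchySeq_of_edist_le_of_tsum_ne_top
    (f := fun R => eisPartial R ((α - y) / N)) _ (fun R => le_rfl) hy.ne
  obtain ⟨l, hl⟩ := cauchySeq_tendsto_of_complete hc
  have : eisLim ((α - y) / N) = l := hl.limUnder_eq
  rwa [this]

/-- Fatou's lemma carries the Parseval identity for differences of partial sums to the almost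
everywhere limit. -/
lemma lintegral_eisLim_sub_le (N : ℝ) (hN : 0 < N) (α : ℂ) (R : ℕ) :
    ∫⁻ y in square N, ENNReal.ofReal
      (‖eisLim ((α - y) / N) - eisPartial R ((α - y) / N)‖ ^ 2) ≤
      ENNReal.ofReal (N ^ 2 * eisTail R) := by
  set F : ℕ → ℂ → ℝ≥0∞ := fun S y => ENNReal.ofReal
    (‖eisPartial S ((α - y) / N) - eisPartial R ((α - y) / N)‖ ^ 2) with hF
  have hFm : ∀ S, Measurable (F S) := fun S => ENNReal.measurable_ofReal.comp
    (((continuous_eisPartial_comp N α S).sub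
      (continuous_eisPartial_comp N α R)).norm.pow 2).measurable
  calc _ = ∫⁻ y in square N, liminf (fun S => F S y) atTop := by
        refine lintegral_congr_ae ?_
        filter_upwards [ae_tendsto_eisPartial N hN α] with y hy
        refine (Tendsto.liminf_eq ?_).symm
        exact ENNReal.tendsto_ofReal ((hy.sub_const _).norm.pow 2)
    _ ≤ liminf (fun S => ∫⁻ y in square N, F S y) atTop := lintegral_liminf_le hFm
    _ ≤ _ := by
        refine liminf_le_of_frequently_le' (Eventually.frequently ?_)
        filter_upwards [eventually_ge_atTop R] with S hS
        rw [hF, ← ofReal_integral_eq_lintegral_ofReal, integral_normSq_eisPartial_sub N hN α R S hS]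
        · apply ENNReal.ofReal_le_ofReal
          rw [eisTail]
          gcongr
          exact le_ciSup bddAbove_eisMass S
        · exact (((continuous_eisPartial_comp N α S).sub
            (continuous_eisPartial_comp N α R)).norm.pow 2).continuousOn.integrableOn_compact
            (isCompact_square N)
        · exact Eventually.of_forall fun y => by positivity

/-- The partial sums of the pair interaction on the unit torus. -/
noncomputable def torusPartial (R : ℕ) (z : ℂ) : ℝ := (eisPartial R z).re

lemma continuous_torusPartial (R : ℕ) : Continuous (torusPartial R) :=
  Complex.continuous_re.comp (continuous_eisPartial R)

lemma measurable_torusEnergy_comp (N : ℝ) (α : ℂ) :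
    Measurable fun y : ℂ => torusEnergy ((α - y) / N) :=
  measurable_torusEnergy.comp (by fun_prop)

lemma continuous_torusPartial_comp (N : ℝ) (α : ℂ) (R : ℕ) :
    Continuous fun y : ℂ => torusPartial R ((α - y) / N) :=
  (continuous_torusPartial R).comp (by fun_prop)

lemma lintegral_torusEnergy_sub_le (N : ℝ) (hN : 0 < N) (α : ℂ) (R : ℕ) :
    ∫⁻ y in square N, ENNReal.ofReal
      ((torusEnergy ((α - y) / N) - torusPartial R ((α - y) / N)) ^ 2) ≤
      ENNReal.ofReal (N ^ 2 * eisTail R) := by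
  refine (lintegral_mono fun y => ENNReal.ofReal_le_ofReal ?_).trans
    (lintegral_eisLim_sub_le N hN α R)
  rw [torusEnergy, torusPartial, ← Complex.sub_re, ← sq_abs]
  gcongr
  exact Complex.abs_re_le_norm _

lemma integrable_torusEnergy_sub_sq (N : ℝ) (hN : 0 < N) (α : ℂ) (R : ℕ) :
    Integrable (fun y => (torusEnergy ((α - y) / N) - torusPartial R ((α - y) / N)) ^ 2)
      (volume.restrict (square N)) := by
  refine ⟨(((measurable_torusEnergy_comp N α).sub
    (continuous_torusPartial_comp N α R).measurable).pow_const 2).aestronglyMeasurable, ?_⟩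
  rw [hasFiniteIntegral_iff_ofReal (Eventually.of_forall fun y => by positivity)]
  exact (lintegral_torusEnergy_sub_le N hN α R).trans_lt ENNReal.ofReal_lt_top

lemma integral_torusEnergy_sub_sq_le (N : ℝ) (hN : 0 < N) (α : ℂ) (R : ℕ) :
    ∫ y in square N, (torusEnergy ((α - y) / N) - torusPartial R ((α - y) / N)) ^ 2 ≤
      N ^ 2 * eisTail R := by
  rw [integral_eq_lintegral_of_nonneg_ae (Eventually.of_forall fun y => by positivity)
    (integrable_torusEnergy_sub_sq N hN α R).aestronglyMeasurable]
  exact ENNReal.toReal_le_of_le_ofReal (mul_nonneg (by positivity) (eisTail_nonneg R))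
    (lintegral_torusEnergy_sub_le N hN α R)

/-- With `R = 0` the index set is empty, so the remainder estimates specialize to estimates of the
full interaction, with constant `eisTail 0`. -/
lemma torusPartial_zero (z : ℂ) : torusPartial 0 z = 0 := by
  rw [torusPartial, eisPartial_eq, punctBox_zero]
  simp

lemma integrable_torusEnergy_sq (N : ℝ) (hN : 0 < N) (α : ℂ) :
    Integrable (fun y => torusEnergy ((α - y) / N) ^ 2) (volume.restrict (square N)) := by
  simpa [torusPartial_zero] using integrable_torusEnergy_sub_sq N hN α 0

lemma integral_torusEnergy_sq_le (N : ℝ) (hN : 0 < N) (α : ℂ) :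
    ∫ y in square N, torusEnergy ((α - y) / N) ^ 2 ≤ N ^ 2 * eisTail 0 := by
  simpa [torusPartial_zero] using integral_torusEnergy_sub_sq_le N hN α 0

lemma integrable_torusEnergy (N : ℝ) (hN : 0 < N) (α : ℂ) :
    Integrable (fun y => torusEnergy ((α - y) / N)) (volume.restrict (square N)) := by
  have : MemLp (fun y => torusEnergy ((α - y) / N)) 2 (volume.restrict (square N)) :=
    (memLp_two_iff_integrable_sq (measurable_torusEnergy_comp N α).aestronglyMeasurable).2
      (integrable_torusEnergy_sq N hN α)
  exact this.integrable (by norm_num)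

lemma integral_torusPartial (N : ℝ) (hN : 0 < N) (α : ℂ) (R : ℕ) :
    ∫ y in square N, torusPartial R ((α - y) / N) = 0 := by
  have h := integral_eisPartial N hN α R
  have hi : Integrable (fun y : ℂ => eisPartial R ((α - y) / N)) (volume.restrict (square N)) :=
    (continuous_eisPartial_comp N α R).continuousOn.integrableOn_compact (isCompact_square N)
  have := integral_re hi
  rw [h] at this
  simpa [torusPartial] using this

/-- Every partial sum has mean zero and the remainder tends to zero in `L²`, hence in mean. The
statement holds for each `α`, not merely almost every one, because all previous estimates are
uniform in the shift. -/
lemma integral_torusEnergy (N : ℝ) (hN : 0 < N) (α : ℂ) :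
    ∫ y in square N, torusEnergy ((α - y) / N) = 0 := by
  have hP : ∀ R, Integrable (fun y : ℂ => torusPartial R ((α - y) / N))
      (volume.restrict (square N)) := fun R =>
    (continuous_torusPartial_comp N α R).continuousOn.integrableOn_compact (isCompact_square N)
  have key : ∀ R, (∫ y in square N, torusEnergy ((α - y) / N)) ^ 2 ≤
      N ^ 2 * (N ^ 2 * eisTail R) := fun R => by
    have h1 : ∫ y in square N, torusEnergy ((α - y) / N) =
        ∫ y in square N, (torusEnergy ((α - y) / N) - torusPartial R ((α - y) / N)) := by
      rw [integral_sub (integrable_torusEnergy N hN α) (hP R), integral_torusPartial N hN, sub_zero]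
    rw [h1]
    set D := fun y : ℂ => torusEnergy ((α - y) / N) - torusPartial R ((α - y) / N) with hD
    have hDi : Integrable D (volume.restrict (square N)) :=
      (integrable_torusEnergy N hN α).sub (hP R)
    set m := ∫ y in square N, D y with hm
    -- Cauchy–Schwarz `m² ≤ N² ∫ D²`, obtained from the nonnegativity of the variance of `D` on the
    -- square.
    have h2 : 0 ≤ ∫ y in square N, (D y - m / N ^ 2) ^ 2 := integral_nonneg fun y => sq_nonneg _
    have h3 : ∫ y in square N, (D y - m / N ^ 2) ^ 2 =
        (∫ y in square N, D y ^ 2) - 2 * (m / N ^ 2) * m + N ^ 2 * (m / N ^ 2) ^ 2 := by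
      have : ∀ y, (D y - m / N ^ 2) ^ 2 = D y ^ 2 - 2 * (m / N ^ 2) * D y + (m / N ^ 2) ^ 2 :=
        fun y => by ring
      simp_rw [this]
      have hDs : Integrable (fun y => D y ^ 2) (volume.restrict (square N)) :=
        integrable_torusEnergy_sub_sq N hN α R
      have hDc : Integrable (fun y => 2 * (m / N ^ 2) * D y) (volume.restrict (square N)) :=
        hDi.const_mul _
      rw [integral_add (f := fun y => D y ^ 2 - 2 * (m / N ^ 2) * D y) (hDs.sub hDc)
        (integrable_const _), integral_sub hDs hDc, integral_const_mul, integral_const, measureReal_restrict_apply_univ,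
        volume_real_square N hN, smul_eq_mul]
    have h4 := integral_torusEnergy_sub_sq_le N hN α R
    rw [h3] at h2
    have h5 : 2 * (m / N ^ 2) * m - N ^ 2 * (m / N ^ 2) ^ 2 = m ^ 2 / N ^ 2 := by
      field_simp
      ring
    have h6 : m ^ 2 / N ^ 2 ≤ N ^ 2 * eisTail R := by linarith
    rw [div_le_iff₀ (by positivity)] at h6
    linarith
  have hlim : Tendsto (fun R => N ^ 2 * (N ^ 2 * eisTail R)) atTop (𝓝 0) := by
    simpa using (tendsto_eisTail.const_mul (N ^ 2)).const_mul (N ^ 2)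
  have := ge_of_tendsto' hlim key
  exact pow_eq_zero_iff (two_ne_zero) |>.1 (le_antisymm this (sq_nonneg _))

lemma abs_torusPartial_le (R : ℕ) : ∃ M : ℝ, ∀ z, |torusPartial R z| ≤ M :=
  let ⟨M, hM⟩ := norm_eisPartial_le R
  ⟨M, fun z => (Complex.abs_re_le_norm _).trans (hM z)⟩

lemma abs_torusPartial_sub_le (R : ℕ) :
    ∃ L : ℝ, ∀ z w, |torusPartial R z - torusPartial R w| ≤ L * ‖z - w‖ :=
  let ⟨L, hL⟩ := norm_eisPartial_sub_le R
  ⟨L, fun z w => (by simpa [torusPartial] using Complex.abs_re_le_norm (eisPartial R z - eisPartial R w) :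
    |torusPartial R z - torusPartial R w| ≤ _).trans (hL z w)⟩

/-! ### Gaussian weights and the mass leaking out of the square. -/

/-- The Gaussian weight `e^{-c |x - y|²}`. -/
noncomputable def gaussWeight (c : ℝ) (x y : ℂ) : ℝ := Real.exp (-c * ‖x - y‖ ^ 2)

lemma gaussWeight_pos (c : ℝ) (x y : ℂ) : 0 < gaussWeight c x y := Real.exp_pos _

lemma gaussWeight_comm (c : ℝ) (x y : ℂ) : gaussWeight c x y = gaussWeight c y x := by
  rw [gaussWeight, gaussWeight, norm_sub_rev]

lemma gaussWeight_le_one {c : ℝ} (hc : 0 < c) (x y : ℂ) : gaussWeight c x y ≤ 1 := by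
  rw [gaussWeight, Real.exp_le_one_iff]
  have : 0 ≤ c * ‖x - y‖ ^ 2 := by positivity
  linarith

lemma continuous_gaussWeight (c : ℝ) : Continuous fun p : ℂ × ℂ => gaussWeight c p.1 p.2 := by
  unfold gaussWeight
  fun_prop

lemma integrable_gaussWeight {c : ℝ} (hc : 0 < c) (x : ℂ) :
    Integrable (fun y => gaussWeight c x y) := by
  have h := (GaussianFourier.integrable_cexp_neg_mul_sq_norm_add (V := ℂ)
    (b := (c : ℂ)) (by simpa using hc) 0 0).norm
  have h1 : Integrable (fun z : ℂ => Real.exp (-c * ‖z‖ ^ 2)) := by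
    refine h.congr (Eventually.of_forall fun z => ?_)
    simp only [Complex.norm_exp]
    simp [← Complex.ofReal_pow]
  exact h1.comp_sub_left x

lemma integral_gaussWeight {c : ℝ} (hc : 0 < c) (x : ℂ) :
    ∫ y, gaussWeight c x y = Real.pi / c := by
  have := integral_sub_left_eq_self (fun z : ℂ => Real.exp (-c * ‖z‖ ^ 2)) volume x
  simp only [gaussWeight]
  rw [this, GaussianFourier.integral_rexp_neg_mul_sq_norm hc]
  simp

lemma setIntegral_gaussWeight_le {c : ℝ} (hc : 0 < c) (x : ℂ) (s : Set ℂ) :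
    ∫ y in s, gaussWeight c x y ≤ Real.pi / c := by
  rw [← integral_gaussWeight hc x]
  exact setIntegral_le_integral (integrable_gaussWeight hc x)
    (Eventually.of_forall fun y => (gaussWeight_pos c x y).le)

lemma volume_real_reProdIm (s t : Set ℝ) :
    (volume : Measure ℂ).real (s ×ℂ t) = volume.real s * volume.real t := by
  have := Complex.volume_preserving_equiv_real_prod.symm.measure_preimage_equiv (s ×ℂ t)
  have h2 : (volume : Measure (ℝ × ℝ)) (s ×ˢ t) = volume s * volume t := Measure.prod_prod s t
  rw [Measure.real, ← this, Measure.real, Measure.real, ← ENNReal.toReal_mul, ← h2]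
  rfl

/-- The mass that the Gaussian `e^{-π|b - ·|²}` leaves outside the square. -/
noncomputable def leakage (N : ℝ) (b : ℂ) : ℝ := 1 - ∫ c in square N, gaussWeight Real.pi b c

lemma leakage_nonneg (N : ℝ) (b : ℂ) : 0 ≤ leakage N b := by
  have := setIntegral_gaussWeight_le Real.pi_pos b (square N)
  rw [div_self Real.pi_ne_zero] at this
  exact sub_nonneg.2 this

lemma leakage_le_one (N : ℝ) (b : ℂ) : leakage N b ≤ 1 :=
  sub_le_self _ (integral_nonneg fun y => (gaussWeight_pos _ b y).le)

lemma measurable_setIntegral_gaussWeight (c N : ℝ) :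
    Measurable fun b => ∫ y in square N, gaussWeight c b y :=
  ((continuous_gaussWeight c).stronglyMeasurable.integral_prod_right
    (ν := volume.restrict (square N))).measurable

lemma measurable_leakage (N : ℝ) : Measurable (leakage N) :=
  measurable_const.sub (measurable_setIntegral_gaussWeight _ N)

/-- A point outside the square is at distance at least `d` from `b`. Half of the Gaussian exponent
gives the exponential factor; the other half integrates to at most `π / (π/2) = 2`. -/
lemma leakage_le_of_mem (N d : ℝ) (hd : 0 < d) (b : ℂ)
    (hb : b ∈ Set.Icc d (N - d) ×ℂ Set.Icc d (N - d)) :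
    leakage N b ≤ 2 * Real.exp (-(Real.pi / 2) * d ^ 2) := by
  have h1 : leakage N b = ∫ c in (square N)ᶜ, gaussWeight Real.pi b c := by
    rw [leakage, ← div_self Real.pi_ne_zero, ← integral_gaussWeight Real.pi_pos b,
      ← integral_add_compl (measurableSet_square N) (integrable_gaussWeight Real.pi_pos b),
      add_sub_cancel_left]
  have h2 : ∀ c ∈ (square N)ᶜ, gaussWeight Real.pi b c ≤
      Real.exp (-(Real.pi / 2) * d ^ 2) * gaussWeight (Real.pi / 2) b c := by
    intro c hc
    rw [gaussWeight, gaussWeight, ← Real.exp_add, Real.exp_le_exp]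
    have hdist : d ≤ ‖b - c‖ := by
      by_contra! hlt
      apply hc
      have hre := abs_le.1 ((Complex.abs_re_le_norm (b - c)).trans hlt.le)
      have him := abs_le.1 ((Complex.abs_im_le_norm (b - c)).trans hlt.le)
      simp only [Complex.sub_re, Complex.sub_im] at hre him
      simp only [Complex.mem_reProdIm, Set.mem_Icc] at hb
      simp only [square, Complex.mem_reProdIm, Set.mem_Icc]
      refine ⟨⟨?_, ?_⟩, ?_, ?_⟩ <;> linarith [hb.1.1, hb.1.2, hb.2.1, hb.2.2]
    have : d ^ 2 ≤ ‖b - c‖ ^ 2 := by gcongr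
    nlinarith [Real.pi_pos]
  have hpi : 0 < Real.pi / 2 := by positivity
  rw [h1]
  calc _ ≤ ∫ c in (square N)ᶜ,
        Real.exp (-(Real.pi / 2) * d ^ 2) * gaussWeight (Real.pi / 2) b c :=
        setIntegral_mono_on (integrable_gaussWeight Real.pi_pos b).integrableOn
          ((integrable_gaussWeight hpi b).const_mul _).integrableOn
          (measurableSet_square N).compl h2
    _ ≤ Real.exp (-(Real.pi / 2) * d ^ 2) * (Real.pi / (Real.pi / 2)) := by
        rw [integral_const_mul]
        gcongr
        exact setIntegral_gaussWeight_le hpi b _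
    _ = _ := by
        field_simp

lemma integrable_leakage (N : ℝ) : Integrable (leakage N) (volume.restrict (square N)) :=
  Integrable.of_bound (measurable_leakage N).aestronglyMeasurable 1
    (Eventually.of_forall fun b => by
      rw [Real.norm_of_nonneg (leakage_nonneg N b)]; exact leakage_le_one N b)

/-- The leakage is exponentially small at depth `d`, and at most `1` on the remaining frame of width
`d`, whose area is at most `4 d N`. -/
lemma integral_leakage_le (N d : ℝ) (hd : 0 < d) (hdN : 2 * d ≤ N) :
    ∫ b in square N, leakage N b ≤ 2 * Real.exp (-(Real.pi / 2) * d ^ 2) * N ^ 2 + 4 * d * N := by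
  set I : Set ℂ := Set.Icc d (N - d) ×ℂ Set.Icc d (N - d) with hI
  have hIm : MeasurableSet I := (isCompact_Icc.reProdIm isCompact_Icc).measurableSet
  have hN : 0 < N := by linarith
  have hsub : I ⊆ square N := fun z hz => by
    simp only [hI, Complex.mem_reProdIm, Set.mem_Icc] at hz
    simp only [square, Complex.mem_reProdIm, Set.mem_Icc]
    refine ⟨⟨?_, ?_⟩, ?_, ?_⟩ <;> linarith [hz.1.1, hz.1.2, hz.2.1, hz.2.2]
  have hIv : volume.real I = (N - 2 * d) ^ 2 := by
    rw [hI, volume_real_reProdIm, Real.volume_real_Icc_of_le (by linarith)]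
    ring
  have hle : ∀ b, leakage N b ≤
      2 * Real.exp (-(Real.pi / 2) * d ^ 2) + (1 - I.indicator (fun _ => (1 : ℝ)) b) := fun b => by
    by_cases hb : b ∈ I
    · simpa [hb] using leakage_le_of_mem N d hd b hb
    · simp only [hb, not_false_eq_true, Set.indicator_of_notMem, sub_zero]
      have := leakage_le_one N b
      have := Real.exp_pos (-(Real.pi / 2) * d ^ 2)
      linarith
  have hind : Integrable (I.indicator fun _ => (1 : ℝ)) (volume.restrict (square N)) :=
    (integrable_const _).indicator hIm
  calc _ ≤ ∫ b in square N,
        (2 * Real.exp (-(Real.pi / 2) * d ^ 2) + (1 - I.indicator (fun _ => (1 : ℝ)) b)) :=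
        integral_mono (integrable_leakage N)
          ((integrable_const _).add ((integrable_const _).sub hind)) hle
    _ = 2 * Real.exp (-(Real.pi / 2) * d ^ 2) * N ^ 2 + (N ^ 2 - (N - 2 * d) ^ 2) := by
        rw [integral_add (g := fun b => 1 - I.indicator (fun _ => (1 : ℝ)) b)
          (integrable_const _) ((integrable_const _).sub hind),
          integral_sub (integrable_const _) hind, integral_const, integral_const,
          measureReal_restrict_apply_univ, volume_real_square N hN, integral_indicator hIm,
          Measure.restrict_restrict hIm, Set.inter_eq_left.2 hsub, integral_const,
          measureReal_restrict_apply_univ, hIv]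
        simp only [smul_eq_mul, mul_one]
        ring
    _ ≤ _ := by nlinarith

lemma tendsto_integral_leakage :
    Tendsto (fun N : ℝ => (∫ b in square N, leakage N b) / N ^ 2) atTop (𝓝 0) := by
  have hlim : Tendsto (fun N : ℝ => 2 * Real.exp (-(Real.pi / 2) * N) + 4 / √N) atTop (𝓝 0) := by
    have h1 : Tendsto (fun N : ℝ => Real.exp (-(Real.pi / 2) * N)) atTop (𝓝 0) :=
      Real.tendsto_exp_atBot.comp (tendsto_id.const_mul_atTop_of_neg (by linarith [Real.pi_pos]))
    have h2 : Tendsto (fun N : ℝ => 4 / √N) atTop (𝓝 0) :=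
      Real.tendsto_sqrt_atTop.const_div_atTop 4
    simpa using (h1.const_mul 2).add h2
  refine tendsto_of_tendsto_of_tendsto_of_le_of_le' tendsto_const_nhds hlim
    (Eventually.of_forall fun N => div_nonneg (integral_nonneg (leakage_nonneg N)) (sq_nonneg N)) ?_
  filter_upwards [eventually_ge_atTop 4] with N hN
  have hs : 0 < √N := Real.sqrt_pos.2 (by linarith)
  have hsq : √N ^ 2 = N := Real.sq_sqrt (by linarith)
  have h2 : 2 ≤ √N := Real.le_sqrt_of_sq_le (by linarith)
  -- Any depth that tends to infinity more slowly than `N` would do. For `d = √N` the condition `2 d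
  -- ≤ N` is `N ≥ 4`.
  have := integral_leakage_le N √N hs (by nlinarith)
  rw [hsq] at this
  have hN0 : 0 < N := by linarith
  rw [div_le_iff₀ (by positivity)]
  refine this.trans (le_of_eq ?_)
  have : 4 / √N * N ^ 2 = 4 * √N * N := by
    rw [div_mul_eq_mul_div, div_eq_iff hs.ne']
    nlinarith
  rw [add_mul, this]

/-! ### Centered interactions and the cancellation between self and cross energies. -/

/-- The exchange of the first two coordinates of a triple. -/
def leftComm {α : Type*} [MeasurableSpace α] : (α × α × α) ≃ᵐ (α × α × α) :=
  MeasurableEquiv.ofInvolutive (fun p => (p.2.1, p.1, p.2.2)) (fun _ => rfl) (by fun_prop)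

lemma measurePreserving_leftComm {α : Type*} [MeasurableSpace α] (μ : Measure α) [SFinite μ] :
    MeasurePreserving leftComm (μ.prod (μ.prod μ)) (μ.prod (μ.prod μ)) := by
  have h1 : MeasurePreserving (MeasurableEquiv.prodAssoc (α := α) (β := α) (γ := α))
      ((μ.prod μ).prod μ) (μ.prod (μ.prod μ)) :=
    ⟨MeasurableEquiv.measurable _, Measure.prodAssoc_prod⟩
  have h2 : MeasurePreserving (Prod.map Prod.swap id) ((μ.prod μ).prod μ) ((μ.prod μ).prod μ) :=
    Measure.measurePreserving_swap.prod (MeasurePreserving.id μ)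
  exact h1.comp (h2.comp (h1.symm _))

/-- A symmetric square integrable pair interaction whose mean in each variable vanishes. -/
structure IsCentered (μ : Measure ℂ) (g : ℂ → ℂ → ℝ) : Prop where
  measurable : Measurable fun p : ℂ × ℂ => g p.1 p.2
  symm : ∀ a b, g a b = g b a
  integrable_sq : Integrable (fun p : ℂ × ℂ => g p.1 p.2 ^ 2) (μ.prod μ)
  integral_eq_zero : ∀ a, ∫ b, g a b ∂μ = 0

lemma IsCentered.measurable_triple {μ : Measure ℂ} {g : ℂ → ℂ → ℝ}
    (hg : IsCentered μ g) :
    Measurable fun p : ℂ × ℂ × ℂ => g p.1 p.2.2 * g p.2.1 p.2.2 :=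
  (hg.measurable.comp (measurable_fst.prodMk (measurable_snd.comp measurable_snd))).mul
    (hg.measurable.comp measurable_snd)

lemma IsCentered.integrable_sq_mul {μ : Measure ℂ} {g : ℂ → ℂ → ℝ}
    (hg : IsCentered μ g) {w : ℂ × ℂ → ℝ} (hw : Measurable w)
    {C : ℝ} (hC : ∀ p, |w p| ≤ C) :
    Integrable (fun p : ℂ × ℂ => g p.1 p.2 ^ 2 * w p) (μ.prod μ) :=
  hg.integrable_sq.mul_bdd hw.aestronglyMeasurable (Eventually.of_forall hC)

section

variable {μ : Measure ℂ} [IsFiniteMeasure μ] {g : ℂ → ℂ → ℝ}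

lemma IsCentered.integrable (hg : IsCentered μ g) :
    Integrable (fun p : ℂ × ℂ => g p.1 p.2) (μ.prod μ) :=
  ((memLp_two_iff_integrable_sq hg.measurable.aestronglyMeasurable).2 hg.integrable_sq).integrable
    (by norm_num)

lemma IsCentered.integrable_snd_sq_mul (hg : IsCentered μ g) {w : ℂ × ℂ × ℂ → ℝ}
    (hw : Measurable w) {C : ℝ} (hC : ∀ p, |w p| ≤ C) :
    Integrable (fun p : ℂ × ℂ × ℂ => g p.2.1 p.2.2 ^ 2 * w p) (μ.prod (μ.prod μ)) :=
  (hg.integrable_sq.comp_snd μ).mul_bdd hw.aestronglyMeasurable (Eventually.of_forall hC)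

lemma IsCentered.integrable_fst_sq_mul (hg : IsCentered μ g) {w : ℂ × ℂ × ℂ → ℝ}
    (hw : Measurable w) {C : ℝ} (hC : ∀ p, |w p| ≤ C) :
    Integrable (fun p : ℂ × ℂ × ℂ => g p.1 p.2.2 ^ 2 * w p) (μ.prod (μ.prod μ)) :=
  ((measurePreserving_leftComm μ).integrable_comp_emb leftComm.measurableEmbedding).2
    (hg.integrable_snd_sq_mul (w := fun p => w (leftComm p)) (hw.comp leftComm.measurable)
      fun _ => hC _)

/-- Domination by `|xy| ≤ x² + y²`: each square depends on two of the three variables, and the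
measure is finite. -/
lemma IsCentered.integrable_triple_mul (hg : IsCentered μ g) {w : ℂ × ℂ × ℂ → ℝ}
    (hw : Measurable w) {C : ℝ} (hC : ∀ p, |w p| ≤ C) :
    Integrable (fun p : ℂ × ℂ × ℂ => g p.1 p.2.2 * g p.2.1 p.2.2 * w p)
      (μ.prod (μ.prod μ)) := by
  have h1 : ∀ _ : ℂ × ℂ × ℂ, |(1 : ℝ)| ≤ 1 := fun _ => by simp
  have h := ((hg.integrable_fst_sq_mul (w := fun _ => 1) measurable_const h1).add
    (hg.integrable_snd_sq_mul (w := fun _ => 1) measurable_const h1))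
  refine Integrable.mul_bdd (h.mono' hg.measurable_triple.aestronglyMeasurable
    (Eventually.of_forall fun p => ?_)) hw.aestronglyMeasurable (Eventually.of_forall hC)
  rw [Real.norm_eq_abs, abs_mul]
  simp only [Pi.add_apply, mul_one]
  nlinarith [sq_abs (g p.1 p.2.2), sq_abs (g p.2.1 p.2.2),
    sq_nonneg (|g p.1 p.2.2| - |g p.2.1 p.2.2|), sq_nonneg (g p.1 p.2.2), sq_nonneg (g p.2.1 p.2.2)]

lemma integral_fst_sq_mul_eq {w : ℂ × ℂ × ℂ → ℝ} (hsymm : ∀ p, w (leftComm p) = w p) :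
    ∫ p : ℂ × ℂ × ℂ, g p.1 p.2.2 ^ 2 * w p ∂(μ.prod (μ.prod μ)) =
      ∫ p : ℂ × ℂ × ℂ, g p.2.1 p.2.2 ^ 2 * w p ∂(μ.prod (μ.prod μ)) := by
  have := (measurePreserving_leftComm μ).integral_comp' (fun p : ℂ × ℂ × ℂ =>
    g p.2.1 p.2.2 ^ 2 * w p)
  rw [← this]
  refine integral_congr_ae (Eventually.of_forall fun p => ?_)
  simp only [hsymm]
  rfl

/-- The double integral of the squared interaction. -/
noncomputable def selfEnergy (μ : Measure ℂ) (g : ℂ → ℂ → ℝ) : ℝ :=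
  ∫ p : ℂ × ℂ, g p.1 p.2 ^ 2 ∂(μ.prod μ)

/-- The triple integral of the interaction against the squared modulus of the kernel. -/
noncomputable def crossEnergy (μ : Measure ℂ) (g : ℂ → ℂ → ℝ) : ℝ :=
  ∫ p : ℂ × ℂ × ℂ, g p.1 p.2.2 * g p.2.1 p.2.2 * gaussWeight Real.pi p.1 p.2.1
    ∂(μ.prod (μ.prod μ))

/-- The short range part of the double integral of the squared interaction. -/
noncomputable def shortEnergy (c : ℝ) (μ : Measure ℂ) (g : ℂ → ℂ → ℝ) : ℝ :=
  ∫ p : ℂ × ℂ, g p.1 p.2 ^ 2 * gaussWeight c p.1 p.2 ∂(μ.prod μ)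

lemma measurable_gaussWeight_comp {α : Type*} [MeasurableSpace α] (c : ℝ) {u v : α → ℂ}
    (hu : Measurable u) (hv : Measurable v) : Measurable fun p => gaussWeight c (u p) (v p) := by
  simp only [gaussWeight]
  exact Real.measurable_exp.comp (((hu.sub hv).norm.pow_const 2).const_mul _)

lemma abs_gaussWeight_le_one {c : ℝ} (hc : 0 < c) (x y : ℂ) : |gaussWeight c x y| ≤ 1 := by
  rw [abs_of_pos (gaussWeight_pos c x y)]
  exact gaussWeight_le_one hc x y

/-- Polarization: the product in `crossEnergy` is `(x² + y² - (x - y)²) / 2`. By the symmetry `a ↔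
b` the two squares give the same integral, in which the free variable meets only the Gaussian and
integrates to `1` minus the missing mass. -/
lemma selfEnergy_sub_crossEnergy (hg : IsCentered μ g) :
    selfEnergy μ g - crossEnergy μ g =
      ∫ p : ℂ × ℂ, g p.1 p.2 ^ 2 * (1 - ∫ b, gaussWeight Real.pi p.1 b ∂μ) ∂(μ.prod μ) +
      1 / 2 * ∫ p : ℂ × ℂ × ℂ, (g p.1 p.2.2 - g p.2.1 p.2.2) ^ 2 * gaussWeight Real.pi p.1 p.2.1
        ∂(μ.prod (μ.prod μ)) := by
  set w : ℂ × ℂ × ℂ → ℝ := fun p => gaussWeight Real.pi p.1 p.2.1 with hw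
  have hwm : Measurable w := measurable_gaussWeight_comp _ measurable_fst
    (measurable_fst.comp measurable_snd)
  have hw1 : ∀ p, |w p| ≤ 1 := fun p => abs_gaussWeight_le_one Real.pi_pos _ _
  have i1 := hg.integrable_fst_sq_mul hwm hw1
  have i2 := hg.integrable_snd_sq_mul hwm hw1
  have i3 := hg.integrable_triple_mul hwm hw1
  have hexp : ∫ p : ℂ × ℂ × ℂ, (g p.1 p.2.2 - g p.2.1 p.2.2) ^ 2 * w p ∂(μ.prod (μ.prod μ)) =
      2 * ∫ p : ℂ × ℂ × ℂ, g p.2.1 p.2.2 ^ 2 * w p ∂(μ.prod (μ.prod μ)) - 2 * crossEnergy μ g := by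
    have h : ∀ p : ℂ × ℂ × ℂ, (g p.1 p.2.2 - g p.2.1 p.2.2) ^ 2 * w p =
        g p.1 p.2.2 ^ 2 * w p + g p.2.1 p.2.2 ^ 2 * w p -
          2 * (g p.1 p.2.2 * g p.2.1 p.2.2 * w p) := fun p => by ring
    simp_rw [h]
    rw [integral_sub (f := fun p : ℂ × ℂ × ℂ => g p.1 p.2.2 ^ 2 * w p + g p.2.1 p.2.2 ^ 2 * w p)
      (i1.add i2) (i3.const_mul 2), integral_add i1 i2, integral_const_mul,
      integral_fst_sq_mul_eq (w := w) (fun p => gaussWeight_comm _ _ _), crossEnergy]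
    ring
  have hfub : ∫ p : ℂ × ℂ × ℂ, g p.2.1 p.2.2 ^ 2 * w p ∂(μ.prod (μ.prod μ)) =
      ∫ p : ℂ × ℂ, g p.1 p.2 ^ 2 * ∫ b, gaussWeight Real.pi p.1 b ∂μ ∂(μ.prod μ) := by
    rw [integral_prod_symm _ i2]
    refine integral_congr_ae (Eventually.of_forall fun p => ?_)
    simp only [hw, gaussWeight_comm Real.pi _ p.1]
    rw [integral_const_mul]
  have hκm : Measurable fun p : ℂ × ℂ => ∫ b, gaussWeight Real.pi p.1 b ∂μ :=
    ((continuous_gaussWeight Real.pi).stronglyMeasurable.integral_prod_right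
      (ν := μ)).measurable.comp measurable_fst
  have hκ : ∀ p : ℂ × ℂ, |∫ b, gaussWeight Real.pi p.1 b ∂μ| ≤ 1 * μ.real Set.univ := fun p => by
    rw [← Real.norm_eq_abs]
    exact norm_integral_le_of_norm_le_const (Eventually.of_forall fun b =>
      abs_gaussWeight_le_one Real.pi_pos _ _)
  have hlin : ∫ p : ℂ × ℂ, g p.1 p.2 ^ 2 * (1 - ∫ b, gaussWeight Real.pi p.1 b ∂μ) ∂(μ.prod μ) =
      selfEnergy μ g - ∫ p : ℂ × ℂ, g p.1 p.2 ^ 2 * ∫ b, gaussWeight Real.pi p.1 b ∂μ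
        ∂(μ.prod μ) := by
    rw [selfEnergy, ← integral_sub hg.integrable_sq (hg.integrable_sq_mul hκm hκ)]
    simp_rw [mul_sub, mul_one]
  rw [hlin, hexp, hfub]
  ring

end

/-! ### Asymptotics of the energies of the Eisenstein interaction. -/

/-- The pair interaction `E_N(a - b)`. -/
noncomputable def pairEnergy (N : ℝ) (a b : ℂ) : ℝ := torusEnergy ((a - b) / N)

/-- Lebesgue measure on the square `[0, N]²`. -/
noncomputable abbrev squareMeasure (N : ℝ) : Measure ℂ := volume.restrict (square N)

lemma pairEnergy_comm (N : ℝ) (a b : ℂ) : pairEnergy N a b = pairEnergy N b a := by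
  rw [pairEnergy, pairEnergy, ← torusEnergy_neg, ← neg_div, neg_sub]

lemma measurable_pairEnergy (N : ℝ) : Measurable fun p : ℂ × ℂ => pairEnergy N p.1 p.2 :=
  measurable_torusEnergy.comp (by fun_prop)

lemma squareMeasure_real_univ (N : ℝ) (hN : 0 < N) : (squareMeasure N).real Set.univ = N ^ 2 := by
  rw [measureReal_restrict_apply_univ, volume_real_square N hN]

lemma isCentered_pairEnergy (N : ℝ) (hN : 0 < N) :
    IsCentered (squareMeasure N) (pairEnergy N) where
  measurable := measurable_pairEnergy N
  symm := pairEnergy_comm N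
  integral_eq_zero a := integral_torusEnergy N hN a
  integrable_sq := by
    have hm : Measurable fun p : ℂ × ℂ => pairEnergy N p.1 p.2 ^ 2 :=
      (measurable_pairEnergy N).pow_const 2
    rw [integrable_prod_iff hm.aestronglyMeasurable]
    refine ⟨Eventually.of_forall fun a => integrable_torusEnergy_sq N hN a, ?_⟩
    refine Integrable.of_bound hm.aestronglyMeasurable.norm.integral_prod_right'
      (N ^ 2 * eisTail 0) (Eventually.of_forall fun a => ?_)
    rw [Real.norm_of_nonneg (integral_nonneg fun _ => norm_nonneg _)]
    simp only [norm_pow, Real.norm_eq_abs, sq_abs]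
    exact integral_torusEnergy_sq_le N hN a

/-- The difference passes through the `R`-th partial sums at `b` and `c`, using `(x + y + z)² ≤ 3
(x² + y² + z²)`. The middle term is at most `L |b - c| / N`, since arguments are rescaled by `N`;
its square over area `N²` loses all dependence on `N`. -/
lemma integral_pairEnergy_sub_sq_le (N : ℝ) (hN : 0 < N) (R : ℕ) {L : ℝ}
    (hL : ∀ z w, |torusPartial R z - torusPartial R w| ≤ L * ‖z - w‖) (b c : ℂ) :
    ∫ a, (pairEnergy N b a - pairEnergy N c a) ^ 2 ∂(squareMeasure N) ≤
      6 * (N ^ 2 * eisTail R) + 3 * L ^ 2 * ‖b - c‖ ^ 2 := by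
  have hP : ∀ a : ℂ, (torusPartial R ((b - a) / N) - torusPartial R ((c - a) / N)) ^ 2 ≤
      L ^ 2 * ‖b - c‖ ^ 2 / N ^ 2 := fun a => by
    have h := hL ((b - a) / N) ((c - a) / N)
    have h2 : (b - a) / N - (c - a) / N = (b - c) / N := by ring
    rw [h2, norm_div, Complex.norm_real, Real.norm_of_nonneg hN.le] at h
    rw [← sq_abs, ← mul_pow, ← div_pow, ← mul_div_assoc] at *
    gcongr
  have hb := integrable_torusEnergy_sub_sq N hN b R
  have hc := integrable_torusEnergy_sub_sq N hN c R
  calc _ ≤ ∫ a in square N,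
        (3 * (torusEnergy ((b - a) / N) - torusPartial R ((b - a) / N)) ^ 2 +
        3 * (torusEnergy ((c - a) / N) - torusPartial R ((c - a) / N)) ^ 2 +
        3 * (L ^ 2 * ‖b - c‖ ^ 2 / N ^ 2)) := by
        refine integral_mono_of_nonneg (Eventually.of_forall fun a => sq_nonneg _)
          (((hb.const_mul 3).add (hc.const_mul 3)).add (integrable_const _))
          (Eventually.of_forall fun a => ?_)
        have := hP a
        simp only [pairEnergy]
        set x := torusEnergy ((b - a) / N)
        set y := torusEnergy ((c - a) / N)
        set u := torusPartial R ((b - a) / N)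
        set v := torusPartial R ((c - a) / N)
        nlinarith [sq_nonneg ((x - u) - (u - v)), sq_nonneg ((u - v) - (v - y)),
          sq_nonneg ((x - u) - (v - y))]
    _ = 3 * (∫ a in square N, (torusEnergy ((b - a) / N) - torusPartial R ((b - a) / N)) ^ 2) +
        3 * (∫ a in square N, (torusEnergy ((c - a) / N) - torusPartial R ((c - a) / N)) ^ 2) +
        N ^ 2 * (3 * (L ^ 2 * ‖b - c‖ ^ 2 / N ^ 2)) := by
        rw [integral_add (f := fun a : ℂ =>
          3 * (torusEnergy ((b - a) / N) - torusPartial R ((b - a) / N)) ^ 2 +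
          3 * (torusEnergy ((c - a) / N) - torusPartial R ((c - a) / N)) ^ 2)
          ((hb.const_mul 3).add (hc.const_mul 3)) (integrable_const _),
          integral_add (hb.const_mul 3) (hc.const_mul 3), integral_const_mul, integral_const_mul,
          integral_const, squareMeasure_real_univ N hN, smul_eq_mul]
    _ ≤ 3 * (N ^ 2 * eisTail R) + 3 * (N ^ 2 * eisTail R) +
        N ^ 2 * (3 * (L ^ 2 * ‖b - c‖ ^ 2 / N ^ 2)) := by
        gcongr
        · exact integral_torusEnergy_sub_sq_le N hN b R
        · exact integral_torusEnergy_sub_sq_le N hN c R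
    _ = _ := by
        field_simp
        ring

/-- `r² ≤ e^{r²}` and `π ≥ 2`: the quadratic factor costs part of the Gaussian exponent. -/
lemma sq_norm_mul_gaussWeight_le (b c : ℂ) :
    ‖b - c‖ ^ 2 * gaussWeight Real.pi b c ≤ gaussWeight 1 b c := by
  rw [gaussWeight, gaussWeight]
  have h1 : ‖b - c‖ ^ 2 ≤ Real.exp (‖b - c‖ ^ 2) :=
    (Real.add_one_le_exp _).trans' (by linarith)
  calc _ ≤ Real.exp (‖b - c‖ ^ 2) * Real.exp (-Real.pi * ‖b - c‖ ^ 2) := by gcongr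
    _ ≤ _ := by
      rw [← Real.exp_add, Real.exp_le_exp]
      nlinarith [Real.pi_gt_three, sq_nonneg ‖b - c‖]

lemma selfEnergy_sub_crossEnergy_le (N : ℝ) (hN : 0 < N) (R : ℕ) {L : ℝ}
    (hL : ∀ z w, |torusPartial R z - torusPartial R w| ≤ L * ‖z - w‖) :
    selfEnergy (squareMeasure N) (pairEnergy N) - crossEnergy (squareMeasure N) (pairEnergy N) ≤
      N ^ 2 * eisTail 0 * (∫ b in square N, leakage N b) +
        (3 * N ^ 4 * eisTail R + 3 / 2 * Real.pi * L ^ 2 * N ^ 2) := by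
  have hg := isCentered_pairEnergy N hN
  rw [selfEnergy_sub_crossEnergy hg]
  refine add_le_add ?_ ?_
  · have hi : Integrable (fun p : ℂ × ℂ => pairEnergy N p.1 p.2 ^ 2 * leakage N p.1)
        ((squareMeasure N).prod (squareMeasure N)) :=
      hg.integrable_sq_mul ((measurable_leakage N).comp measurable_fst) (C := 1) fun p => by
        rw [abs_of_nonneg (leakage_nonneg N _)]
        exact leakage_le_one N _
    change ∫ p : ℂ × ℂ, pairEnergy N p.1 p.2 ^ 2 * leakage N p.1 ∂_ ≤ _
    rw [integral_prod _ hi, ← integral_const_mul]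
    refine integral_mono_of_nonneg (Eventually.of_forall fun b => integral_nonneg fun a =>
      mul_nonneg (sq_nonneg _) (leakage_nonneg N _)) ((integrable_leakage N).const_mul _)
      (Eventually.of_forall fun b => ?_)
    simp only [integral_mul_const]
    gcongr
    · exact leakage_nonneg N b
    · exact integral_torusEnergy_sq_le N hN b
  · set T := eisTail R with hT
    have hT0 : 0 ≤ T := eisTail_nonneg R
    have hin : ∀ b : ℂ, ∫ q : ℂ × ℂ, (pairEnergy N b q.2 - pairEnergy N q.1 q.2) ^ 2 *
        gaussWeight Real.pi b q.1 ∂((squareMeasure N).prod (squareMeasure N)) ≤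
        6 * (N ^ 2 * T) + 3 * L ^ 2 * Real.pi := fun b => by
      have hbd : ∀ c : ℂ, ∫ a, (pairEnergy N b a - pairEnergy N c a) ^ 2 *
          gaussWeight Real.pi b c ∂(squareMeasure N) ≤
          6 * (N ^ 2 * T) * gaussWeight Real.pi b c + 3 * L ^ 2 * gaussWeight 1 b c := fun c => by
        rw [integral_mul_const]
        calc _ ≤ (6 * (N ^ 2 * T) + 3 * L ^ 2 * ‖b - c‖ ^ 2) * gaussWeight Real.pi b c := by
              gcongr
              · exact (gaussWeight_pos _ _ _).le
              · exact integral_pairEnergy_sub_sq_le N hN R hL b c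
          _ = 6 * (N ^ 2 * T) * gaussWeight Real.pi b c +
              3 * L ^ 2 * (‖b - c‖ ^ 2 * gaussWeight Real.pi b c) := by ring
          _ ≤ _ := by
              gcongr
              exact sq_norm_mul_gaussWeight_le b c
      have hnn : ∀ q : ℂ × ℂ, 0 ≤ (pairEnergy N b q.2 - pairEnergy N q.1 q.2) ^ 2 *
          gaussWeight Real.pi b q.1 := fun q => mul_nonneg (sq_nonneg _) (gaussWeight_pos _ _ _).le
      have g1 := (integrable_gaussWeight Real.pi_pos b).integrableOn (s := square N)
      have g2 := (integrable_gaussWeight one_pos b).integrableOn (s := square N)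
      -- Integrability need not be proved: otherwise the integral is `0` by convention and the
      -- nonnegative bound holds trivially.
      by_cases hi : Integrable (fun q : ℂ × ℂ => (pairEnergy N b q.2 - pairEnergy N q.1 q.2) ^ 2 *
        gaussWeight Real.pi b q.1) ((squareMeasure N).prod (squareMeasure N))
      · rw [integral_prod _ hi]
        calc _ ≤ ∫ c in square N,
              (6 * (N ^ 2 * T) * gaussWeight Real.pi b c + 3 * L ^ 2 * gaussWeight 1 b c) :=
              integral_mono_of_nonneg (Eventually.of_forall fun c => integral_nonneg fun a =>
                hnn (c, a)) ((g1.const_mul _).add (g2.const_mul _)) (Eventually.of_forall hbd)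
          _ ≤ 6 * (N ^ 2 * T) * (Real.pi / Real.pi) + 3 * L ^ 2 * (Real.pi / 1) := by
              rw [integral_add (g1.const_mul _) (g2.const_mul _), integral_const_mul,
                integral_const_mul]
              gcongr
              · exact setIntegral_gaussWeight_le Real.pi_pos b _
              · exact setIntegral_gaussWeight_le one_pos b _
          _ = _ := by rw [div_self Real.pi_ne_zero, mul_one, div_one]
      · rw [integral_undef hi]
        positivity
    have hout : ∫ p : ℂ × ℂ × ℂ, (pairEnergy N p.1 p.2.2 - pairEnergy N p.2.1 p.2.2) ^ 2 *
        gaussWeight Real.pi p.1 p.2.1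
        ∂((squareMeasure N).prod ((squareMeasure N).prod (squareMeasure N))) ≤
        N ^ 2 * (6 * (N ^ 2 * T) + 3 * L ^ 2 * Real.pi) := by
      by_cases hi : Integrable (fun p : ℂ × ℂ × ℂ =>
        (pairEnergy N p.1 p.2.2 - pairEnergy N p.2.1 p.2.2) ^ 2 * gaussWeight Real.pi p.1 p.2.1)
        ((squareMeasure N).prod ((squareMeasure N).prod (squareMeasure N)))
      · rw [integral_prod _ hi]
        calc _ ≤ ∫ b in square N, (6 * (N ^ 2 * T) + 3 * L ^ 2 * Real.pi) :=
              integral_mono_of_nonneg (Eventually.of_forall fun b => integral_nonneg fun q =>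
                mul_nonneg (sq_nonneg _) (gaussWeight_pos _ _ _).le) (integrable_const _)
                (Eventually.of_forall hin)
          _ = _ := by
              rw [integral_const, squareMeasure_real_univ N hN, smul_eq_mul]
      · rw [integral_undef hi]
        positivity
    calc _ ≤ 1 / 2 * (N ^ 2 * (6 * (N ^ 2 * T) + 3 * L ^ 2 * Real.pi)) := by gcongr
      _ = _ := by ring

/-- Split `g² ≤ 2 (g - g_R)² + 2 g_R²`. The Gaussian is discarded on the remainder and kept on the
bounded partial sum `g_R`, where it integrates to `π / c` in one variable. -/
lemma shortEnergy_le {c : ℝ} (hc : 0 < c) (N : ℝ) (hN : 0 < N) (R : ℕ) {M : ℝ}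
    (hM : ∀ z, |torusPartial R z| ≤ M) :
    shortEnergy c (squareMeasure N) (pairEnergy N) ≤
      2 * N ^ 4 * eisTail R + 2 * M ^ 2 * (Real.pi / c) * N ^ 2 := by
  have hg := isCentered_pairEnergy N hN
  have hi : Integrable (fun p : ℂ × ℂ => pairEnergy N p.1 p.2 ^ 2 * gaussWeight c p.1 p.2)
      ((squareMeasure N).prod (squareMeasure N)) :=
    hg.integrable_sq_mul (continuous_gaussWeight c).measurable fun p =>
      abs_gaussWeight_le_one hc p.1 p.2
  have hin : ∀ a : ℂ, ∫ b, pairEnergy N a b ^ 2 * gaussWeight c a b ∂(squareMeasure N) ≤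
      2 * (N ^ 2 * eisTail R) + 2 * M ^ 2 * (Real.pi / c) := fun a => by
    have i1 := (integrable_torusEnergy_sub_sq N hN a R).const_mul 2
    have i2 := ((integrable_gaussWeight hc a).integrableOn (s := square N)).const_mul (2 * M ^ 2)
    calc _ ≤ ∫ b in square N, (2 * (torusEnergy ((a - b) / N) - torusPartial R ((a - b) / N)) ^ 2 +
          2 * M ^ 2 * gaussWeight c a b) := by
          refine integral_mono_of_nonneg (Eventually.of_forall fun b =>
            mul_nonneg (sq_nonneg _) (gaussWeight_pos _ _ _).le) (i1.add i2)
            (Eventually.of_forall fun b => ?_)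
          have h1 := gaussWeight_le_one hc a b
          have h0 := gaussWeight_pos c a b
          simp only [pairEnergy]
          set x := torusEnergy ((a - b) / N)
          set u := torusPartial R ((a - b) / N) with hu
          have h2 : u ^ 2 ≤ M ^ 2 := sq_le_sq' (abs_le.1 (hM _)).1 (abs_le.1 (hM _)).2
          calc x ^ 2 * gaussWeight c a b
              ≤ (2 * (x - u) ^ 2 + 2 * u ^ 2) * gaussWeight c a b := by
                gcongr
                nlinarith [sq_nonneg (x - 2 * u)]
            _ = 2 * (x - u) ^ 2 * gaussWeight c a b + 2 * u ^ 2 * gaussWeight c a b := by ring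
            _ ≤ 2 * (x - u) ^ 2 * 1 + 2 * M ^ 2 * gaussWeight c a b := by gcongr
            _ = _ := by ring
      _ ≤ _ := by
          rw [integral_add i1 i2, integral_const_mul, integral_const_mul]
          gcongr
          · exact integral_torusEnergy_sub_sq_le N hN a R
          · exact setIntegral_gaussWeight_le hc a _
  rw [shortEnergy, integral_prod _ hi]
  calc _ ≤ ∫ a in square N, (2 * (N ^ 2 * eisTail R) + 2 * M ^ 2 * (Real.pi / c)) :=
        integral_mono_of_nonneg (Eventually.of_forall fun a => integral_nonneg fun b =>
          mul_nonneg (sq_nonneg _) (gaussWeight_pos _ _ _).le) (integrable_const _)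
          (Eventually.of_forall hin)
    _ = _ := by
        rw [integral_const, squareMeasure_real_univ N hN, smul_eq_mul]
        ring

/-- The order of limits: `R` is fixed first, so that the tail is below `ε / 2`, and only then does
`N` grow. The error `G` may depend on `R`, as the Lipschitz constant and the bound of the partial
sum do. -/
lemma eventually_le_of_tail {F : ℝ → ℝ} {A : ℝ} (h : ∀ R : ℕ, ∃ G : ℝ → ℝ,
    Tendsto G atTop (𝓝 0) ∧ ∀ N, 0 < N → F N ≤ A * eisTail R + G N) (ε : ℝ) (hε : 0 < ε) :
    ∀ᶠ N in atTop, F N ≤ ε := by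
  have h1 : Tendsto (fun R => A * eisTail R) atTop (𝓝 0) := by
    simpa using tendsto_eisTail.const_mul A
  obtain ⟨R, hR⟩ := (h1.eventually (gt_mem_nhds (half_pos hε))).exists
  obtain ⟨G, hG, hle⟩ := h R
  filter_upwards [hG.eventually (gt_mem_nhds (half_pos hε)), eventually_gt_atTop 0] with N h2 h3
  linarith [hle N h3]

lemma tendsto_const_div_sq (C : ℝ) : Tendsto (fun N : ℝ => C / N ^ 2) atTop (𝓝 0) :=
  (tendsto_pow_atTop (two_ne_zero)).const_div_atTop C

lemma eventually_selfEnergy_sub_crossEnergy_le (ε : ℝ) (hε : 0 < ε) : ∀ᶠ N in atTop,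
    (selfEnergy (squareMeasure N) (pairEnergy N) -
      crossEnergy (squareMeasure N) (pairEnergy N)) / N ^ 4 ≤ ε := by
  refine eventually_le_of_tail (A := 3) (fun R => ?_) ε hε
  obtain ⟨L, hL⟩ := abs_torusPartial_sub_le R
  refine ⟨fun N => eisTail 0 * ((∫ b in square N, leakage N b) / N ^ 2) +
    3 / 2 * Real.pi * L ^ 2 / N ^ 2, ?_, fun N hN => ?_⟩
  · simpa using (tendsto_integral_leakage.const_mul (eisTail 0)).add (tendsto_const_div_sq _)
  · rw [div_le_iff₀ (by positivity)]
    refine (selfEnergy_sub_crossEnergy_le N hN R hL).trans (le_of_eq ?_)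
    field_simp
    ring

lemma eventually_shortEnergy_le {c : ℝ} (hc : 0 < c) (ε : ℝ) (hε : 0 < ε) : ∀ᶠ N in atTop,
    shortEnergy c (squareMeasure N) (pairEnergy N) / N ^ 4 ≤ ε := by
  refine eventually_le_of_tail (A := 2) (fun R => ?_) ε hε
  obtain ⟨M, hM⟩ := abs_torusPartial_le R
  refine ⟨fun N => 2 * M ^ 2 * (Real.pi / c) / N ^ 2, tendsto_const_div_sq _, fun N hN => ?_⟩
  rw [div_le_iff₀ (by positivity)]
  refine (shortEnergy_le hc N hN R hM).trans (le_of_eq ?_)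
  field_simp

/-! ### Sums over tuples of distinct points: measurability and correlation formula. -/

section Tuples

variable {Ω : Type*} [MeasurableSpace Ω]

open Classical in
/-- The sum of `F` over the `k`-tuples of pairwise distinct points of a finite set. -/
noncomputable def tupleSum {M : Type*} [AddCommMonoid M] {k : ℕ} (T : Finset ℂ)
    (F : (Fin k → ℂ) → M) : M :=
  ∑ x ∈ (Fintype.piFinset fun _ : Fin k => T) with Function.Injective x, F x

/-- The sum of unit masses at the `k`-tuples of points of a finite set. -/
noncomputable def tupleMeasure (k : ℕ) (T : Finset ℂ) : Measure (Fin k → ℂ) :=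
  ∑ x ∈ Fintype.piFinset fun _ : Fin k => T, Measure.dirac x

lemma tupleMeasure_apply (k : ℕ) (T : Finset ℂ) {s : Set (Fin k → ℂ)} (hs : MeasurableSet s) :
    tupleMeasure k T s = ∑ x ∈ Fintype.piFinset fun _ : Fin k => T, s.indicator 1 x := by
  rw [tupleMeasure, Measure.finsetSum_apply]
  exact Finset.sum_congr rfl fun x _ => Measure.dirac_apply' x hs

instance (k : ℕ) (T : Finset ℂ) : IsFiniteMeasure (tupleMeasure k T) := by
  refine ⟨?_⟩
  rw [tupleMeasure_apply k T MeasurableSet.univ]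
  exact ENNReal.sum_lt_top.2 fun x _ => by simp

lemma tupleMeasure_pi (k : ℕ) (T : Finset ℂ) {s : Fin k → Set ℂ}
    (hs : ∀ i, MeasurableSet (s i)) :
    tupleMeasure k T (Set.univ.pi s) = ∏ i, ∑ a ∈ T, (s i).indicator 1 a := by
  rw [tupleMeasure_apply k T (MeasurableSet.univ_pi hs), Finset.prod_univ_sum]
  refine Finset.sum_congr rfl fun x _ => ?_
  by_cases hx : x ∈ Set.univ.pi s
  · rw [Set.indicator_of_mem hx]
    exact (Finset.prod_eq_one fun i _ =>
      Set.indicator_of_mem (hx i (Set.mem_univ i)) _).symm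
  · rw [Set.indicator_of_notMem hx]
    simp only [Set.mem_univ_pi, not_forall] at hx
    obtain ⟨i, hi⟩ := hx
    exact (Finset.prod_eq_zero (Finset.mem_univ i) (Set.indicator_of_notMem hi _)).symm

/-- The counting variables of a random finite set are measurable. -/
def HasMeasurableCounts (T : Ω → Finset ℂ) : Prop :=
  ∀ B : Set ℂ, MeasurableSet B → Measurable fun ω => ∑ a ∈ T ω, B.indicator (1 : ℂ → ℝ≥0∞) a

/-- Boxes form a generating π-system, and the mass of a box is a product of counting variables
because `tupleMeasure` keeps tuples with repetitions. -/
lemma HasMeasurableCounts.measurable_tupleMeasure {T : Ω → Finset ℂ} (hT : HasMeasurableCounts T)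
    (k : ℕ) : Measurable fun ω => tupleMeasure k (T ω) := by
  refine Measurable.measure_of_isPiSystem generateFrom_pi.symm isPiSystem_pi ?_ ?_
  · rintro _ ⟨s, hs, rfl⟩
    have hs' : ∀ i, MeasurableSet (s i) := fun i => hs i (Set.mem_univ i)
    simp_rw [tupleMeasure_pi k _ hs']
    exact Finset.measurable_prod _ fun i _ => hT _ (hs' i)
  · have : (Set.univ : Set (Fin k → ℂ)) = Set.univ.pi fun _ => Set.univ := (Set.pi_univ _).symm
    rw [this]
    simp_rw [tupleMeasure_pi k _ fun _ => MeasurableSet.univ]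
    exact Finset.measurable_prod _ fun i _ => hT _ MeasurableSet.univ

lemma measurableSet_injective (k : ℕ) : MeasurableSet {x : Fin k → ℂ | Function.Injective x} := by
  have : {x : Fin k → ℂ | Function.Injective x} = ⋂ i, ⋂ j, {x | x i = x j → i = j} := by
    ext x
    simp [Function.Injective]
  rw [this]
  refine MeasurableSet.iInter fun i => MeasurableSet.iInter fun j => ?_
  by_cases h : i = j
  · simp [h]
  · have hij : MeasurableSet {x : Fin k → ℂ | x i = x j} :=
      measurableSet_eq_fun (measurable_pi_apply i) (measurable_pi_apply j)
    have heq : {x : Fin k → ℂ | x i = x j → i = j} = {x : Fin k → ℂ | x i = x j}ᶜ := by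
      ext x
      simp [h]
    rw [heq]
    exact hij.compl

lemma HasMeasurableCounts.measurable_tupleSum {T : Ω → Finset ℂ} (hT : HasMeasurableCounts T)
    {k : ℕ} {F : (Fin k → ℂ) → ℝ≥0∞} (hF : Measurable F) :
    Measurable fun ω => tupleSum (T ω) F := by
  classical
  -- Distinctness is moved from the measure to the integrand.
  set G : (Fin k → ℂ) → ℝ≥0∞ := {x | Function.Injective x}.indicator F with hG
  have hGm : Measurable G := hF.indicator (measurableSet_injective k)
  have h : ∀ ω, tupleSum (T ω) F = ∫⁻ x, G x ∂(tupleMeasure k (T ω)) := fun ω => by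
    rw [tupleMeasure, lintegral_finsetSum_measure, tupleSum, Finset.sum_filter]
    refine Finset.sum_congr rfl fun x _ => ?_
    rw [lintegral_dirac' _ hGm, hG, Set.indicator_apply]
    rfl
  simp_rw [h]
  exact (Measure.measurable_lintegral hGm).comp (hT.measurable_tupleMeasure k)

lemma ofReal_tupleSum {k : ℕ} (T : Finset ℂ) {F : (Fin k → ℂ) → ℝ} (hF : ∀ x, 0 ≤ F x) :
    ENNReal.ofReal (tupleSum T F) = tupleSum T fun x => ENNReal.ofReal (F x) :=
  ENNReal.ofReal_sum_of_nonneg fun x _ => hF x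

lemma HasMeasurableCounts.measurable_tupleSum_real {T : Ω → Finset ℂ} (hT : HasMeasurableCounts T)
    {k : ℕ} {F : (Fin k → ℂ) → ℝ} (hF : Measurable F) :
    Measurable fun ω => tupleSum (T ω) F := by
  have h : ∀ ω, tupleSum (T ω) F = (tupleSum (T ω) fun x => ENNReal.ofReal (F x)).toReal -
      (tupleSum (T ω) fun x => ENNReal.ofReal (-F x)).toReal := fun ω => by
    have hmax : ∀ y : ℝ, ENNReal.ofReal y = ENNReal.ofReal (max y 0) := fun y => by
      rcases le_total y 0 with hy | hy
      · simp [hy, ENNReal.ofReal_of_nonpos hy]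
      · simp [hy]
    simp_rw [hmax (F _), hmax (-F _)]
    rw [← ofReal_tupleSum _ fun x => le_max_right _ _, ← ofReal_tupleSum _ fun x => le_max_right _ _,
      tupleSum, tupleSum, tupleSum,
      ENNReal.toReal_ofReal (Finset.sum_nonneg fun x _ => le_max_right _ _),
      ENNReal.toReal_ofReal (Finset.sum_nonneg fun x _ => le_max_right _ _),
      ← Finset.sum_sub_distrib]
    refine Finset.sum_congr rfl fun x _ => ?_
    rcases le_total (F x) 0 with hy | hy <;> simp [hy]
  simp_rw [h]
  exact (hT.measurable_tupleSum (ENNReal.measurable_ofReal.comp hF)).ennreal_toReal.sub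
    (hT.measurable_tupleSum (ENNReal.measurable_ofReal.comp hF.neg)).ennreal_toReal

/-- The correlation formula applied to `F` cut off to `Q^k`, which turns the sum over all tuples of
the process into a finite one. -/
lemma lintegral_tupleSum {P : Measure Ω} {X : Ω → Set ℂ} {k : ℕ} {ρ : (Fin k → ℂ) → ℝ}
    (hρ : HasCorrelation P X k ρ) {Q : Set ℂ} (hQ : MeasurableSet Q) {T : Ω → Finset ℂ}
    (hT : ∀ ω, (T ω : Set ℂ) = X ω ∩ Q) {F : (Fin k → ℂ) → ℝ≥0∞} (hF : Measurable F) :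
    ∫⁻ ω, tupleSum (T ω) F ∂P =
      ∫⁻ x, F x * ENNReal.ofReal (ρ x) ∂(Measure.pi fun _ : Fin k => volume.restrict Q) := by
  classical
  have hQk : MeasurableSet (Set.univ.pi fun _ : Fin k => Q) := MeasurableSet.univ_pi fun _ => hQ
  have h := hρ.2 ((Set.univ.pi fun _ : Fin k => Q).indicator F) (hF.indicator hQk)
  have hl : ∀ ω, ∑' x : distinctTuples k (X ω), (Set.univ.pi fun _ : Fin k => Q).indicator F x =
      tupleSum (T ω) F := fun ω => by
    have hmem : ∀ x : Fin k → ℂ, (x ∈ distinctTuples k (X ω) ∧ x ∈ Set.univ.pi fun _ => Q) ↔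
        (x ∈ Fintype.piFinset fun _ : Fin k => T ω) ∧ Function.Injective x := fun x => by
      have hi : ∀ i, x i ∈ T ω ↔ x i ∈ X ω ∧ x i ∈ Q := fun i => by
        rw [← Finset.mem_coe, hT]; rfl
      simp only [distinctTuples, Set.mem_ofPred_eq, Set.mem_univ_pi, Fintype.mem_piFinset, hi,
        forall_and]
      tauto
    rw [tsum_subtype (distinctTuples k (X ω)) ((Set.univ.pi fun _ : Fin k => Q).indicator F),
      Set.indicator_indicator, tupleSum, tsum_eq_sum
      (s := (Fintype.piFinset fun _ : Fin k => T ω).filter fun x => Function.Injective x)]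
    · refine Finset.sum_congr rfl fun x hx => ?_
      rw [Finset.mem_filter] at hx
      exact Set.indicator_of_mem (Set.mem_inter ((hmem x).2 hx).1 ((hmem x).2 hx).2) _
    · intro x hx
      rw [Finset.mem_filter] at hx
      exact Set.indicator_of_notMem (fun h => hx ((hmem x).1 ⟨h.1, h.2⟩)) _
  simp_rw [hl] at h
  rw [h, ← Measure.restrict_pi_pi, ← lintegral_indicator hQk, ← volume_pi]
  refine lintegral_congr fun x => ?_
  by_cases hx : x ∈ Set.univ.pi fun _ : Fin k => Q
  · rw [Set.indicator_of_mem hx, Set.indicator_of_mem hx]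
  · rw [Set.indicator_of_notMem hx, Set.indicator_of_notMem hx, zero_mul]

lemma integral_tupleSum_of_nonneg {P : Measure Ω} {X : Ω → Set ℂ} {k : ℕ} {ρ : (Fin k → ℂ) → ℝ}
    (hρ : HasCorrelation P X k ρ) {Q : Set ℂ} (hQ : MeasurableSet Q) {T : Ω → Finset ℂ}
    (hT : ∀ ω, (T ω : Set ℂ) = X ω ∩ Q) (hTm : HasMeasurableCounts T)
    {F : (Fin k → ℂ) → ℝ} (hF : Measurable F) (hF0 : ∀ x, 0 ≤ F x)
    (hint : Integrable (fun x => F x * ρ x) (Measure.pi fun _ : Fin k => volume.restrict Q)) :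
    Integrable (fun ω => tupleSum (T ω) F) P ∧ ∫ ω, tupleSum (T ω) F ∂P =
      ∫ x, F x * ρ x ∂(Measure.pi fun _ : Fin k => volume.restrict Q) := by
  have hm := hTm.measurable_tupleSum_real hF
  have hnn : ∀ ω, 0 ≤ tupleSum (T ω) F := fun ω => Finset.sum_nonneg fun x _ => hF0 x
  have hFρ : ∀ x, 0 ≤ F x * ρ x := fun x => mul_nonneg (hF0 x) (hρ.1 x)
  have h : ∫⁻ ω, ENNReal.ofReal (tupleSum (T ω) F) ∂P = ∫⁻ x, ENNReal.ofReal (F x * ρ x)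
      ∂(Measure.pi fun _ : Fin k => volume.restrict Q) := by
    simp_rw [ofReal_tupleSum _ hF0, ENNReal.ofReal_mul (hF0 _)]
    exact lintegral_tupleSum hρ hQ hT (ENNReal.measurable_ofReal.comp hF)
  refine ⟨⟨hm.aestronglyMeasurable, ?_⟩, ?_⟩
  · rw [hasFiniteIntegral_iff_ofReal (Eventually.of_forall hnn), h,
      ← ofReal_integral_eq_lintegral_ofReal hint (Eventually.of_forall hFρ)]
    exact ENNReal.ofReal_lt_top
  · rw [integral_eq_lintegral_of_nonneg_ae (Eventually.of_forall hnn) hm.aestronglyMeasurable, h,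
      integral_eq_lintegral_of_nonneg_ae (Eventually.of_forall hFρ) hint.aestronglyMeasurable]

/-- The correlation formula for signed test functions. -/
lemma integral_tupleSum {P : Measure Ω} {X : Ω → Set ℂ} {k : ℕ} {ρ : (Fin k → ℂ) → ℝ}
    (hρ : HasCorrelation P X k ρ) {Q : Set ℂ} (hQ : MeasurableSet Q) {T : Ω → Finset ℂ}
    (hT : ∀ ω, (T ω : Set ℂ) = X ω ∩ Q) (hTm : HasMeasurableCounts T)
    {F : (Fin k → ℂ) → ℝ} (hF : Measurable F)
    (hint : Integrable (fun x => F x * ρ x) (Measure.pi fun _ : Fin k => volume.restrict Q)) :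
    Integrable (fun ω => tupleSum (T ω) F) P ∧ ∫ ω, tupleSum (T ω) F ∂P =
      ∫ x, F x * ρ x ∂(Measure.pi fun _ : Fin k => volume.restrict Q) := by
  have e1 : ∀ x, max (F x) 0 * ρ x = max (F x * ρ x) 0 := fun x => by
    rw [max_mul_of_nonneg _ _ (hρ.1 x), zero_mul]
  have e2 : ∀ x, max (-F x) 0 * ρ x = max (-(F x * ρ x)) 0 := fun x => by
    rw [max_mul_of_nonneg _ _ (hρ.1 x), zero_mul, neg_mul]
  have i1 : Integrable (fun x => max (F x) 0 * ρ x)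
      (Measure.pi fun _ : Fin k => volume.restrict Q) := by
    simp_rw [e1]; exact hint.pos_part
  have i2 : Integrable (fun x => max (-F x) 0 * ρ x)
      (Measure.pi fun _ : Fin k => volume.restrict Q) := by
    simp_rw [e2]; exact hint.neg_part
  have h1 := integral_tupleSum_of_nonneg hρ hQ hT hTm (hF.max measurable_const)
    (fun x => le_max_right (F x) 0) i1
  have h2 := integral_tupleSum_of_nonneg hρ hQ hT hTm (F := fun x => max (-F x) 0)
    (hF.neg.max measurable_const) (fun x => le_max_right (-F x) 0) i2
  have hmax : ∀ y : ℝ, y = max y 0 - max (-y) 0 := fun y => by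
    rcases le_total y 0 with hy | hy <;> simp [hy]
  have h : ∀ ω, tupleSum (T ω) F =
      tupleSum (T ω) (fun x => max (F x) 0) - tupleSum (T ω) fun x => max (-F x) 0 := fun ω => by
    rw [tupleSum, tupleSum, tupleSum, ← Finset.sum_sub_distrib]
    exact Finset.sum_congr rfl fun x _ => hmax _
  simp_rw [h]
  refine ⟨h1.1.sub h2.1, ?_⟩
  rw [integral_sub h1.1 h2.1, h1.2, h2.2, ← integral_sub i1 i2]
  refine integral_congr_ae (Eventually.of_forall fun x => ?_)
  simp only
  rw [← sub_mul, ← hmax]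

end Tuples

/-! ### Parametrizing tuples by nested products. -/

section VecMeasure

variable (μ : Measure ℂ) [IsFiniteMeasure μ]

lemma measurePreserving_vec2 : MeasurePreserving (fun p : ℂ × ℂ => ![p.1, p.2]) (μ.prod μ)
    (Measure.pi fun _ => μ) := by
  have hm : Measurable fun p : ℂ × ℂ => ![p.1, p.2] := by
    refine measurable_pi_iff.2 fun i => ?_
    fin_cases i <;> simp <;> fun_prop
  refine ⟨hm, (Measure.pi_eq fun s hs => ?_).symm⟩
  rw [Measure.map_apply hm (MeasurableSet.univ_pi hs)]
  have : (fun p : ℂ × ℂ => ![p.1, p.2]) ⁻¹' Set.univ.pi s = s 0 ×ˢ s 1 := by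
    ext p
    simp [Fin.forall_fin_two]
  rw [this, Measure.prod_prod, Fin.prod_univ_two]

lemma measurePreserving_vec3 : MeasurePreserving (fun p : ℂ × ℂ × ℂ => ![p.1, p.2.1, p.2.2])
    (μ.prod (μ.prod μ)) (Measure.pi fun _ => μ) := by
  have hm : Measurable fun p : ℂ × ℂ × ℂ => ![p.1, p.2.1, p.2.2] := by
    refine measurable_pi_iff.2 fun i => ?_
    fin_cases i <;> simp <;> fun_prop
  refine ⟨hm, (Measure.pi_eq fun s hs => ?_).symm⟩
  rw [Measure.map_apply hm (MeasurableSet.univ_pi hs)]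
  have : (fun p : ℂ × ℂ × ℂ => ![p.1, p.2.1, p.2.2]) ⁻¹' Set.univ.pi s =
      s 0 ×ˢ (s 1 ×ˢ s 2) := by
    ext p
    simp [Fin.forall_fin_succ]
  rw [this, Measure.prod_prod, Measure.prod_prod, Fin.prod_univ_three, mul_assoc]

lemma measurePreserving_vec4 : MeasurePreserving
    (fun p : (ℂ × ℂ) × ℂ × ℂ => ![p.1.1, p.1.2, p.2.1, p.2.2])
    ((μ.prod μ).prod (μ.prod μ)) (Measure.pi fun _ => μ) := by
  have hm : Measurable fun p : (ℂ × ℂ) × ℂ × ℂ => ![p.1.1, p.1.2, p.2.1, p.2.2] := by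
    refine measurable_pi_iff.2 fun i => ?_
    fin_cases i <;> simp <;> fun_prop
  refine ⟨hm, (Measure.pi_eq fun s hs => ?_).symm⟩
  rw [Measure.map_apply hm (MeasurableSet.univ_pi hs)]
  have : (fun p : (ℂ × ℂ) × ℂ × ℂ => ![p.1.1, p.1.2, p.2.1, p.2.2]) ⁻¹' Set.univ.pi s =
      (s 0 ×ˢ s 1) ×ˢ (s 2 ×ˢ s 3) := by
    ext p
    simp [Fin.forall_fin_succ, and_assoc]
  rw [this, Measure.prod_prod, Measure.prod_prod, Measure.prod_prod, Fin.prod_univ_four]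
  ring

end VecMeasure

/-! ### The square of a pair sum. -/

section Combinatorics

open Classical in
lemma tupleSum_two (T : Finset ℂ) (F : (Fin 2 → ℂ) → ℝ) :
    tupleSum T F = ∑ a ∈ T, ∑ b ∈ T, if a ≠ b then F ![a, b] else 0 := by
  rw [tupleSum, Finset.sum_filter, ← Finset.sum_product']
  refine Finset.sum_nbij' (fun x => (x 0, x 1)) (fun p => ![p.1, p.2]) ?_ ?_ ?_ ?_ ?_
  · intro x hx
    rw [Fintype.mem_piFinset] at hx
    simp [hx]
  · intro p hp
    simp only [Finset.mem_product] at hp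
    simp [Fintype.mem_piFinset, Fin.forall_fin_succ, hp]
  · intro x _
    ext i
    fin_cases i <;> rfl
  · intro p _
    rfl
  · intro x _
    have h1 : x = ![x 0, x 1] := by ext i; fin_cases i <;> rfl
    have h2 : Function.Injective x ↔ x 0 ≠ x 1 := by
      refine ⟨fun h => h.ne (by decide), fun h i j => ?_⟩
      fin_cases i <;> fin_cases j <;> simp [h, h.symm]
    simp only [h2, ← h1]

open Classical in
lemma tupleSum_three (T : Finset ℂ) (F : (Fin 3 → ℂ) → ℝ) :
    tupleSum T F = ∑ a ∈ T, ∑ b ∈ T, ∑ c ∈ T,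
      if a ≠ b ∧ a ≠ c ∧ b ≠ c then F ![a, b, c] else 0 := by
  rw [tupleSum, Finset.sum_filter]
  simp_rw [← Finset.sum_product']
  refine Finset.sum_nbij' (fun x => (x 0, x 1, x 2)) (fun p => ![p.1, p.2.1, p.2.2]) ?_ ?_ ?_ ?_ ?_
  · intro x hx
    rw [Fintype.mem_piFinset] at hx
    simp [hx]
  · intro p hp
    simp only [Finset.mem_product] at hp
    simp [Fintype.mem_piFinset, Fin.forall_fin_succ, hp]
  · intro x _
    ext i
    fin_cases i <;> rfl
  · intro p _
    rfl
  · intro x _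
    have h1 : x = ![x 0, x 1, x 2] := by ext i; fin_cases i <;> rfl
    have h2 : Function.Injective x ↔ x 0 ≠ x 1 ∧ x 0 ≠ x 2 ∧ x 1 ≠ x 2 := by
      refine ⟨fun h => ⟨h.ne (by decide), h.ne (by decide), h.ne (by decide)⟩,
        fun ⟨h1, h2, h3⟩ i j => ?_⟩
      fin_cases i <;> fin_cases j <;> simp [h1, h2, h3, h1.symm, h2.symm, h3.symm]
    simp only [h2, ← h1]

open Classical in
lemma tupleSum_four (T : Finset ℂ) (F : (Fin 4 → ℂ) → ℝ) :
    tupleSum T F = ∑ a ∈ T, ∑ b ∈ T, ∑ c ∈ T, ∑ d ∈ T,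
      if a ≠ b ∧ a ≠ c ∧ a ≠ d ∧ b ≠ c ∧ b ≠ d ∧ c ≠ d then F ![a, b, c, d] else 0 := by
  rw [tupleSum, Finset.sum_filter]
  simp_rw [← Finset.sum_product']
  refine Finset.sum_nbij' (fun x => (x 0, x 1, x 2, x 3))
    (fun p => ![p.1, p.2.1, p.2.2.1, p.2.2.2]) ?_ ?_ ?_ ?_ ?_
  · intro x hx
    rw [Fintype.mem_piFinset] at hx
    simp [hx]
  · intro p hp
    simp only [Finset.mem_product] at hp
    simp [Fintype.mem_piFinset, Fin.forall_fin_succ, hp]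
  · intro x _
    ext i
    fin_cases i <;> rfl
  · intro p _
    rfl
  · intro x _
    have h1 : x = ![x 0, x 1, x 2, x 3] := by ext i; fin_cases i <;> rfl
    have h2 : Function.Injective x ↔
        x 0 ≠ x 1 ∧ x 0 ≠ x 2 ∧ x 0 ≠ x 3 ∧ x 1 ≠ x 2 ∧ x 1 ≠ x 3 ∧ x 2 ≠ x 3 := by
      refine ⟨fun h => ⟨h.ne (by decide), h.ne (by decide), h.ne (by decide), h.ne (by decide),
        h.ne (by decide), h.ne (by decide)⟩, fun ⟨h1, h2, h3, h4, h5, h6⟩ i j => ?_⟩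
      fin_cases i <;> fin_cases j <;> simp [h1, h2, h3, h4, h5, h6, h1.symm, h2.symm, h3.symm,
        h4.symm, h5.symm, h6.symm]
    simp only [h2, ← h1]

/-- The square of a sum over pairs, split according to the coincidences between the pairs. -/
lemma sq_tupleSum_two (T : Finset ℂ) {g : ℂ → ℂ → ℝ} (hg : ∀ a b, g a b = g b a) :
    (tupleSum T fun x : Fin 2 → ℂ => g (x 0) (x 1)) ^ 2 =
      tupleSum T (fun x : Fin 4 → ℂ => g (x 0) (x 1) * g (x 2) (x 3)) +
      4 * tupleSum T (fun x : Fin 3 → ℂ => g (x 0) (x 2) * g (x 1) (x 2)) +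
      2 * tupleSum T (fun x : Fin 2 → ℂ => g (x 0) (x 1) ^ 2) := by
  classical
  rw [tupleSum_two, tupleSum_two, tupleSum_three, tupleSum_four]
  simp only [Matrix.cons_val_zero, Matrix.cons_val_one, Matrix.cons_val]
  -- Setting the interaction to zero on the diagonal absorbs the conditions `a ≠ b` and `c ≠ d`.
  set h : ℂ → ℂ → ℝ := fun a b => if a ≠ b then g a b else 0 with hh
  have hs : ∀ a b, h a b = h b a := fun a b => by
    by_cases hab : a = b
    · rw [hab]
    · simp only [hh, if_pos hab, if_pos (Ne.symm hab), hg a b]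
  have h0 : ∀ a, h a a = 0 := fun a => by simp [hh]
  have hgh : ∀ a b, a ≠ b → g a b = h a b := fun a b hab => by simp [hh, hab]
  have e4 : ∀ a b c d : ℂ, (if a ≠ b ∧ a ≠ c ∧ a ≠ d ∧ b ≠ c ∧ b ≠ d ∧ c ≠ d then
      g a b * g c d else 0) = if a ≠ c ∧ a ≠ d ∧ b ≠ c ∧ b ≠ d then h a b * h c d else 0 := by
    intro a b c d
    by_cases hab : a = b
    · simp [hab, h0]
    by_cases hcd : c = d
    · simp [hcd, h0]
    rw [hgh a b hab, hgh c d hcd]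
    simp [hab, hcd]
  have e3 : ∀ a b c : ℂ, (if a ≠ b ∧ a ≠ c ∧ b ≠ c then g a c * g b c else 0) =
      if a ≠ b then h a c * h b c else 0 := by
    intro a b c
    by_cases hac : a = c
    · simp [hac, h0]
    by_cases hbc : b = c
    · simp [hbc, h0]
    rw [hgh a c hac, hgh b c hbc]
    simp [hac, hbc]
  have e2 : ∀ a b : ℂ, (if a ≠ b then g a b ^ 2 else 0) = h a b ^ 2 := by
    intro a b
    by_cases hab : a = b <;> simp [hh, hab]
  simp_rw [e4, e3, e2]
  -- Two ordered pairs of distinct points share no point, exactly one (four ways) or both (two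
  -- ways): the origin of the coefficients `1`, `4` and `2`.
  have split : ∀ a b c d : ℂ, h a b * h c d =
      (if a ≠ c ∧ a ≠ d ∧ b ≠ c ∧ b ≠ d then h a b * h c d else 0) +
      (if a = c then (if b ≠ d then h a b * h c d else 0) else 0) +
      (if b = c then (if a ≠ d then h a b * h c d else 0) else 0) +
      (if a = d then (if b ≠ c then h a b * h c d else 0) else 0) +
      (if b = d then (if a ≠ c then h a b * h c d else 0) else 0) +
      (if a = c then (if b = d then h a b * h c d else 0) else 0) +
      (if b = c then (if a = d then h a b * h c d else 0) else 0) := by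
    intro a b c d
    by_cases hab : a = b
    · subst hab; simp [h0]
    by_cases hcd : c = d
    · subst hcd; simp [h0]
    generalize h a b * h c d = K
    grind
  rw [sq, Finset.sum_mul_sum]
  have start : ∑ a ∈ T, ∑ c ∈ T, (∑ b ∈ T, h a b) * ∑ d ∈ T, h c d =
      ∑ a ∈ T, ∑ b ∈ T, ∑ c ∈ T, ∑ d ∈ T, h a b * h c d := by
    refine Finset.sum_congr rfl fun a _ => ?_
    simp_rw [Finset.sum_mul_sum]
    rw [Finset.sum_comm]
  rw [start]
  have cfst : ∀ x ∈ T, ∀ φ : ℂ → ℂ → ℝ,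
      ∑ c ∈ T, ∑ d ∈ T, (if x = c then φ c d else 0) = ∑ d ∈ T, φ x d := fun x hx φ => by
    rw [Finset.sum_comm]
    exact Finset.sum_congr rfl fun d _ => by rw [Finset.sum_ite_eq, if_pos hx]
  have csnd : ∀ x ∈ T, ∀ φ : ℂ → ℂ → ℝ,
      ∑ c ∈ T, ∑ d ∈ T, (if x = d then φ c d else 0) = ∑ c ∈ T, φ c x := fun x hx φ =>
    Finset.sum_congr rfl fun c _ => by rw [Finset.sum_ite_eq, if_pos hx]
  have inner : ∀ a ∈ T, ∀ b ∈ T, ∑ c ∈ T, ∑ d ∈ T, h a b * h c d =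
      (∑ c ∈ T, ∑ d ∈ T, if a ≠ c ∧ a ≠ d ∧ b ≠ c ∧ b ≠ d then h a b * h c d else 0) +
      2 * (∑ c ∈ T, if b ≠ c then h b a * h c a else 0) +
      2 * (∑ c ∈ T, if a ≠ c then h a b * h c b else 0) + 2 * h a b ^ 2 := by
    intro a ha b hb
    rw [Finset.sum_congr rfl fun c _ => Finset.sum_congr rfl fun d _ => split a b c d]
    simp only [Finset.sum_add_distrib]
    rw [cfst a ha fun c d => if b ≠ d then h a b * h c d else 0,
      cfst b hb fun c d => if a ≠ d then h a b * h c d else 0,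
      csnd a ha fun c d => if b ≠ c then h a b * h c d else 0,
      csnd b hb fun c d => if a ≠ c then h a b * h c d else 0,
      cfst a ha fun c d => if b = d then h a b * h c d else 0,
      cfst b hb fun c d => if a = d then h a b * h c d else 0,
      Finset.sum_ite_eq, Finset.sum_ite_eq, if_pos ha, if_pos hb]
    have r1 : ∑ c ∈ T, (if b ≠ c then h a b * h a c else 0) =
        ∑ c ∈ T, if b ≠ c then h b a * h c a else 0 :=
      Finset.sum_congr rfl fun c _ => by rw [hs a b, hs a c]
    have r2 : ∑ c ∈ T, (if a ≠ c then h a b * h b c else 0) =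
        ∑ c ∈ T, if a ≠ c then h a b * h c b else 0 :=
      Finset.sum_congr rfl fun c _ => by rw [hs b c]
    have r3 : ∑ c ∈ T, (if b ≠ c then h a b * h c a else 0) =
        ∑ c ∈ T, if b ≠ c then h b a * h c a else 0 :=
      Finset.sum_congr rfl fun c _ => by rw [hs a b]
    rw [r1, r2, r3, hs b a]
    ring
  rw [Finset.sum_congr rfl fun a ha => Finset.sum_congr rfl fun b hb => inner a ha b hb]
  simp only [Finset.sum_add_distrib, ← Finset.mul_sum]
  have s1 : ∑ a ∈ T, ∑ b ∈ T, ∑ c ∈ T, (if b ≠ c then h b a * h c a else 0) =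
      ∑ a ∈ T, ∑ b ∈ T, ∑ c ∈ T, if a ≠ b then h a c * h b c else 0 := by
    rw [Finset.sum_comm]
    exact Finset.sum_congr rfl fun b _ => Finset.sum_comm
  have s2 : ∑ a ∈ T, ∑ b ∈ T, ∑ c ∈ T, (if a ≠ c then h a b * h c b else 0) =
      ∑ a ∈ T, ∑ b ∈ T, ∑ c ∈ T, if a ≠ b then h a c * h b c else 0 :=
    Finset.sum_congr rfl fun a _ => Finset.sum_comm
  rw [s1, s2]
  ring

end Combinatorics

/-! ### The Ginibre kernel and its determinants of order up to four. -/

lemma ginibreKernel_self (x : ℂ) : ginibreKernel x x = 1 := by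
  rw [ginibreKernel, mul_assoc 2, Complex.mul_conj, Complex.normSq_eq_norm_sq]
  push_cast
  ring_nf
  simp

lemma conj_ginibreKernel (x y : ℂ) :
    (starRingEnd ℂ) (ginibreKernel x y) = ginibreKernel y x := by
  rw [ginibreKernel, ginibreKernel, ← Complex.exp_conj]
  congr 1
  simp only [map_mul, map_neg, map_sub, map_add, map_pow, map_div₀, Complex.conj_ofReal,
    Complex.conj_conj, map_ofNat]
  ring

lemma norm_ginibreKernel (x y : ℂ) : ‖ginibreKernel x y‖ = gaussWeight (Real.pi / 2) x y := by
  rw [ginibreKernel, Complex.norm_exp, gaussWeight]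
  congr 1
  have h : (-(Real.pi / 2 : ℂ) * ((‖x‖ : ℂ) ^ 2 + (‖y‖ : ℂ) ^ 2 - 2 * x * (starRingEnd ℂ) y)).re =
      -(Real.pi / 2) * (‖x‖ ^ 2 + ‖y‖ ^ 2 - 2 * (x * (starRingEnd ℂ) y).re) := by
    have h1 : (-(Real.pi / 2 : ℂ) * ((‖x‖ : ℂ) ^ 2 + (‖y‖ : ℂ) ^ 2 -
        2 * x * (starRingEnd ℂ) y)) = ((-(Real.pi / 2) : ℝ) : ℂ) *
        (((‖x‖ ^ 2 + ‖y‖ ^ 2 : ℝ) : ℂ) - ((2 : ℝ) : ℂ) * (x * (starRingEnd ℂ) y)) := by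
      push_cast
      ring
    rw [h1, Complex.re_ofReal_mul, Complex.sub_re, Complex.ofReal_re, Complex.re_ofReal_mul]
  rw [h, ← Complex.normSq_eq_norm_sq, ← Complex.normSq_eq_norm_sq, ← Complex.normSq_eq_norm_sq,
    Complex.normSq_sub]

lemma gaussWeight_mul_self (c : ℝ) (x y : ℂ) :
    gaussWeight c x y * gaussWeight c x y = gaussWeight (2 * c) x y := by
  rw [gaussWeight, gaussWeight, ← Real.exp_add]
  congr 1
  ring

lemma ginibreKernel_mul_swap (x y : ℂ) :
    ginibreKernel x y * ginibreKernel y x = (gaussWeight Real.pi x y : ℂ) := by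
  rw [← conj_ginibreKernel x y, Complex.mul_conj, Complex.normSq_eq_norm_sq, norm_ginibreKernel,
    sq, gaussWeight_mul_self]
  congr 2
  ring

lemma continuous_ginibreKernel : Continuous fun p : ℂ × ℂ => ginibreKernel p.1 p.2 := by
  unfold ginibreKernel
  fun_prop

lemma measurable_ginibreKernel_comp {α : Type*} [MeasurableSpace α] {u v : α → ℂ}
    (hu : Measurable u) (hv : Measurable v) : Measurable fun p => ginibreKernel (u p) (v p) := by
  have h : Measurable ((fun p : ℂ × ℂ => ginibreKernel p.1 p.2) ∘ fun p => (u p, v p)) :=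
    Measurable.comp continuous_ginibreKernel.measurable (hu.prodMk hv)
  exact h

/-- The real part of the three-cycle of the kernel. -/
noncomputable def cycle3 (a b c : ℂ) : ℝ :=
  (ginibreKernel a b * ginibreKernel b c * ginibreKernel c a).re

/-- The real part of the four-cycle of the kernel. -/
noncomputable def cycle4 (a b c d : ℂ) : ℝ :=
  (ginibreKernel a b * ginibreKernel b c * ginibreKernel c d * ginibreKernel d a).re

/-- The kernel is Hermitian, so the two orientations of a cycle are complex conjugates; this makes
the determinants real. -/
lemma cycle3_add (a b c : ℂ) :
    ginibreKernel a b * ginibreKernel b c * ginibreKernel c a +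
      ginibreKernel a c * ginibreKernel c b * ginibreKernel b a = ((2 * cycle3 a b c : ℝ) : ℂ) := by
  rw [cycle3, ← Complex.add_conj]
  simp only [map_mul, conj_ginibreKernel]
  ring

lemma cycle4_add (a b c d : ℂ) :
    ginibreKernel a b * ginibreKernel b c * ginibreKernel c d * ginibreKernel d a +
      ginibreKernel a d * ginibreKernel d c * ginibreKernel c b * ginibreKernel b a =
      ((2 * cycle4 a b c d : ℝ) : ℂ) := by
  rw [cycle4, ← Complex.add_conj]
  simp only [map_mul, conj_ginibreKernel]
  ring

lemma det_two_eq (a b : ℂ) :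
    (Matrix.of fun i j => ginibreKernel (![a, b] i) (![a, b] j)).det =
      ((1 - gaussWeight Real.pi a b : ℝ) : ℂ) := by
  rw [Matrix.det_fin_two]
  simp [ginibreKernel_self, ginibreKernel_mul_swap]

lemma det_three_eq (a b c : ℂ) :
    (Matrix.of fun i j => ginibreKernel (![a, b, c] i) (![a, b, c] j)).det =
      ((1 - gaussWeight Real.pi a b - gaussWeight Real.pi a c - gaussWeight Real.pi b c +
        2 * cycle3 a b c : ℝ) : ℂ) := by
  rw [Matrix.det_fin_three, Complex.ofReal_add, ← cycle3_add]
  simp only [Complex.ofReal_sub, Complex.ofReal_one, ← ginibreKernel_mul_swap]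
  simp [ginibreKernel_self]
  ring

/-- Permutations are grouped by cycle type: the identity, six transpositions, four inverse pairs of
3-cycles, three products of disjoint transpositions, and three inverse pairs of 4-cycles. -/
lemma det_four_eq (a b c d : ℂ) :
    (Matrix.of fun i j => ginibreKernel (![a, b, c, d] i) (![a, b, c, d] j)).det =
      ((1 - gaussWeight Real.pi a b - gaussWeight Real.pi a c - gaussWeight Real.pi a d -
        gaussWeight Real.pi b c - gaussWeight Real.pi b d - gaussWeight Real.pi c d +
        2 * cycle3 a b c + 2 * cycle3 a b d + 2 * cycle3 a c d + 2 * cycle3 b c d +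
        gaussWeight Real.pi a b * gaussWeight Real.pi c d +
        gaussWeight Real.pi a c * gaussWeight Real.pi b d +
        gaussWeight Real.pi a d * gaussWeight Real.pi b c -
        2 * cycle4 a b c d - 2 * cycle4 a b d c - 2 * cycle4 a c b d : ℝ) : ℂ) := by
  simp only [Complex.ofReal_sub, Complex.ofReal_add, Complex.ofReal_one]
  simp only [← cycle3_add, ← cycle4_add, Complex.ofReal_mul (gaussWeight _ _ _),
    ← ginibreKernel_mul_swap]
  rw [Matrix.det_succ_row_zero]
  simp only [Matrix.det_fin_three, Fin.sum_univ_four, Matrix.submatrix_apply, Matrix.of_apply,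
    Fin.succAbove, Fin.lt_def]
  simp [ginibreKernel_self]
  ring

lemma abs_cycle3_le (a b c : ℂ) : |cycle3 a b c| ≤
    gaussWeight (Real.pi / 2) a b * gaussWeight (Real.pi / 2) b c *
      gaussWeight (Real.pi / 2) c a := by
  refine (Complex.abs_re_le_norm _).trans (le_of_eq ?_)
  simp only [norm_mul, norm_ginibreKernel]

lemma abs_cycle4_le (a b c d : ℂ) : |cycle4 a b c d| ≤
    gaussWeight (Real.pi / 2) a b * gaussWeight (Real.pi / 2) b c *
      gaussWeight (Real.pi / 2) c d * gaussWeight (Real.pi / 2) d a := by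
  refine (Complex.abs_re_le_norm _).trans (le_of_eq ?_)
  simp only [norm_mul, norm_ginibreKernel]

lemma measurable_cycle3_comp {α : Type*} [MeasurableSpace α] {u v w : α → ℂ}
    (hu : Measurable u) (hv : Measurable v) (hw : Measurable w) :
    Measurable fun p => cycle3 (u p) (v p) (w p) :=
  Complex.measurable_re.comp (((measurable_ginibreKernel_comp hu hv).mul
    (measurable_ginibreKernel_comp hv hw)).mul (measurable_ginibreKernel_comp hw hu))

lemma measurable_cycle4_comp {α : Type*} [MeasurableSpace α] {u v w x : α → ℂ}
    (hu : Measurable u) (hv : Measurable v) (hw : Measurable w) (hx : Measurable x) :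
    Measurable fun p => cycle4 (u p) (v p) (w p) (x p) :=
  Complex.measurable_re.comp ((((measurable_ginibreKernel_comp hu hv).mul
    (measurable_ginibreKernel_comp hv hw)).mul (measurable_ginibreKernel_comp hw hx)).mul
    (measurable_ginibreKernel_comp hx hu))

lemma abs_cycle3_le_one (a b c : ℂ) : |cycle3 a b c| ≤ 1 := by
  have h : ∀ x y, gaussWeight (Real.pi / 2) x y ≤ 1 := gaussWeight_le_one (by positivity)
  have h0 : ∀ x y, 0 ≤ gaussWeight (Real.pi / 2) x y := fun x y => (gaussWeight_pos _ x y).le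
  exact (abs_cycle3_le a b c).trans
    (mul_le_one₀ (mul_le_one₀ (h _ _) (h0 _ _) (h _ _)) (h0 _ _) (h _ _))

lemma norm_sub_sq_le (x y z : ℂ) : ‖x - z‖ ^ 2 ≤ 2 * (‖x - y‖ ^ 2 + ‖y - z‖ ^ 2) := by
  have h := norm_sub_le_norm_sub_add_norm_sub x y z
  nlinarith [norm_nonneg (x - z), sq_nonneg (‖x - y‖ - ‖y - z‖), norm_nonneg (x - y),
    norm_nonneg (y - z)]

/-- The Gaussian weight that dominates all four-cycles of the kernel. -/
noncomputable def cycleWeight (p : (ℂ × ℂ) × ℂ × ℂ) : ℝ :=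
  gaussWeight (Real.pi / 8) p.1.1 p.1.2 * gaussWeight (Real.pi / 8) p.2.1 p.2.2 *
    (gaussWeight (Real.pi / 8) p.1.1 p.2.1 * gaussWeight (Real.pi / 8) p.1.2 p.2.2)

/-- The factor `4` is the ratio of the exponents `π/2` and `π/8`: this loss allows one common weight
for all 4-cycles, whichever edges they use. -/
lemma four_gaussWeight_le {a b c d : ℂ} {x₁ y₁ x₂ y₂ x₃ y₃ x₄ y₄ : ℂ}
    (h : ‖a - b‖ ^ 2 + ‖c - d‖ ^ 2 + (‖a - c‖ ^ 2 + ‖b - d‖ ^ 2) ≤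
      4 * (‖x₁ - y₁‖ ^ 2 + ‖x₂ - y₂‖ ^ 2 + ‖x₃ - y₃‖ ^ 2 + ‖x₄ - y₄‖ ^ 2)) :
    gaussWeight (Real.pi / 2) x₁ y₁ * gaussWeight (Real.pi / 2) x₂ y₂ *
      gaussWeight (Real.pi / 2) x₃ y₃ * gaussWeight (Real.pi / 2) x₄ y₄ ≤
      cycleWeight ((a, b), (c, d)) := by
  simp only [cycleWeight, gaussWeight, ← Real.exp_add, Real.exp_le_exp]
  nlinarith [Real.pi_pos]

lemma abs_cycle4_sum_le (a b c d : ℂ) :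
    |-2 * cycle4 a b c d - 2 * cycle4 a b d c - 2 * cycle4 a c b d| ≤
      6 * cycleWeight ((a, b), (c, d)) := by
  have e : ∀ x y : ℂ, ‖x - y‖ ^ 2 = ‖y - x‖ ^ 2 := fun x y => by rw [norm_sub_rev]
  have n : ∀ x y : ℂ, 0 ≤ ‖x - y‖ ^ 2 := fun x y => sq_nonneg _
  -- An edge of the weight that is missing from the cycle is replaced by two edges of the cycle via
  -- `|x - z|² ≤ 2 (|x - y|² + |y - z|²)`. The shared edge then has coefficient exactly `4`. The
  -- cycle `a b d c` already has the edges of the weight.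
  have h1 := (abs_cycle4_le a b c d).trans (four_gaussWeight_le (a := a) (b := b) (c := c) (d := d)
    (by linarith [norm_sub_sq_le a b c, norm_sub_sq_le b c d, n a b, n b c, n c d, n d a]))
  have h2 := (abs_cycle4_le a b d c).trans (four_gaussWeight_le (a := a) (b := b) (c := c) (d := d)
    (by linarith [n a b, n b d, n d c, n c a, e c d, e a c]))
  have h3 := (abs_cycle4_le a c b d).trans (four_gaussWeight_le (a := a) (b := b) (c := c) (d := d)
    (by linarith [norm_sub_sq_le a c b, norm_sub_sq_le c b d, n a c, n c b, n b d, n d a]))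
  rw [abs_le] at *
  constructor <;> linarith [h1.1, h1.2, h2.1, h2.2, h3.1, h3.2]

/-! ### Vanishing by centering and Schur-type bounds. -/

section

variable {μ : Measure ℂ} [IsFiniteMeasure μ] {g : ℂ → ℂ → ℝ}

lemma IsCentered.integral_mul_fst (hg : IsCentered μ g) (ψ : ℂ → ℝ) :
    ∫ q : ℂ × ℂ, g q.1 q.2 * ψ q.1 ∂(μ.prod μ) = 0 := by
  by_cases hi : Integrable (fun q : ℂ × ℂ => g q.1 q.2 * ψ q.1) (μ.prod μ)
  · rw [integral_prod _ hi]
    simp [integral_mul_const, hg.integral_eq_zero]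
  · exact integral_undef hi

lemma IsCentered.integral_mul_snd (hg : IsCentered μ g) (ψ : ℂ → ℝ) :
    ∫ q : ℂ × ℂ, g q.1 q.2 * ψ q.2 ∂(μ.prod μ) = 0 := by
  rw [← integral_prod_swap]
  simp only [Prod.fst_swap, Prod.snd_swap]
  simp_rw [hg.symm]
  exact hg.integral_mul_fst ψ

lemma IsCentered.integrable_pair_mul (hg : IsCentered μ g) {w : (ℂ × ℂ) × ℂ × ℂ → ℝ}
    (hw : Measurable w) {C : ℝ} (hC : ∀ p, |w p| ≤ C) :
    Integrable (fun p : (ℂ × ℂ) × ℂ × ℂ => g p.1.1 p.1.2 * g p.2.1 p.2.2 * w p)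
      ((μ.prod μ).prod (μ.prod μ)) :=
  (hg.integrable.mul_prod hg.integrable).mul_bdd hw.aestronglyMeasurable (Eventually.of_forall hC)

/-- For a fixed first pair, the weight ignores one point of the second pair, and integrating `g`
over that point gives zero. -/
lemma IsCentered.integral_pair_mul_eq_zero_of_snd (hg : IsCentered μ g)
    {w : (ℂ × ℂ) × ℂ × ℂ → ℝ}
    (h : ∀ p, ∃ ψ : ℂ → ℝ, (∀ q, w (p, q) = ψ q.1) ∨ ∀ q, w (p, q) = ψ q.2) :
    ∫ p : (ℂ × ℂ) × ℂ × ℂ, g p.1.1 p.1.2 * g p.2.1 p.2.2 * w p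
      ∂((μ.prod μ).prod (μ.prod μ)) = 0 := by
  by_cases hi : Integrable (fun p : (ℂ × ℂ) × ℂ × ℂ => g p.1.1 p.1.2 * g p.2.1 p.2.2 * w p)
    ((μ.prod μ).prod (μ.prod μ))
  · rw [integral_prod _ hi]
    refine integral_eq_zero_of_ae (Eventually.of_forall fun p => ?_)
    obtain ⟨ψ, hψ | hψ⟩ := h p
    · simp only [hψ, mul_assoc, integral_const_mul, hg.integral_mul_fst ψ, mul_zero, Pi.zero_apply]
    · simp only [hψ, mul_assoc, integral_const_mul, hg.integral_mul_snd ψ, mul_zero, Pi.zero_apply]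
  · exact integral_undef hi

lemma IsCentered.integral_pair_mul_eq_zero_of_fst (hg : IsCentered μ g)
    {w : (ℂ × ℂ) × ℂ × ℂ → ℝ}
    (h : ∀ q, ∃ ψ : ℂ → ℝ, (∀ p, w (p, q) = ψ p.1) ∨ ∀ p, w (p, q) = ψ p.2) :
    ∫ p : (ℂ × ℂ) × ℂ × ℂ, g p.1.1 p.1.2 * g p.2.1 p.2.2 * w p
      ∂((μ.prod μ).prod (μ.prod μ)) = 0 := by
  rw [← integral_prod_swap]
  simp only [Prod.fst_swap, Prod.snd_swap]
  rw [← hg.integral_pair_mul_eq_zero_of_snd (w := fun p => w p.swap) h]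
  refine integral_congr_ae (Eventually.of_forall fun p => ?_)
  simp only
  ring

/-- A Schur test: `|xy| ≤ (x² + y²) / 2`, the two halves agree by the symmetry of `w`, and
integrating out one pair leaves the marginal of `w`, bounded by `u`. -/
lemma IsCentered.integral_pair_mul_le (hg : IsCentered μ g) {F w : (ℂ × ℂ) × ℂ × ℂ → ℝ}
    (hF : Measurable F) (hw : Measurable w) {C : ℝ} (hC : ∀ p, |w p| ≤ C)
    (hFw : ∀ p, |F p| ≤ w p) (hsymm : ∀ p, w p.swap = w p) {u : ℂ × ℂ → ℝ} {C' : ℝ}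
    (hu : Measurable u) (hC' : ∀ p, |u p| ≤ C') (hwu : ∀ p, ∫ q, w (p, q) ∂(μ.prod μ) ≤ u p) :
    ∫ p : (ℂ × ℂ) × ℂ × ℂ, g p.1.1 p.1.2 * g p.2.1 p.2.2 * F p
      ∂((μ.prod μ).prod (μ.prod μ)) ≤ ∫ p : ℂ × ℂ, g p.1 p.2 ^ 2 * u p ∂(μ.prod μ) := by
  have iF := hg.integrable_pair_mul hF fun p => (hFw p).trans ((le_abs_self _).trans (hC p))
  have i1 : Integrable (fun p : (ℂ × ℂ) × ℂ × ℂ => g p.1.1 p.1.2 ^ 2 * w p)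
      ((μ.prod μ).prod (μ.prod μ)) :=
    (hg.integrable_sq.comp_fst (μ.prod μ)).mul_bdd hw.aestronglyMeasurable
      (Eventually.of_forall hC)
  have i2 : Integrable (fun p : (ℂ × ℂ) × ℂ × ℂ => g p.2.1 p.2.2 ^ 2 * w p)
      ((μ.prod μ).prod (μ.prod μ)) :=
    (hg.integrable_sq.comp_snd (μ.prod μ)).mul_bdd hw.aestronglyMeasurable
      (Eventually.of_forall hC)
  have e : ∫ p : (ℂ × ℂ) × ℂ × ℂ, g p.2.1 p.2.2 ^ 2 * w p ∂((μ.prod μ).prod (μ.prod μ)) =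
      ∫ p : (ℂ × ℂ) × ℂ × ℂ, g p.1.1 p.1.2 ^ 2 * w p ∂((μ.prod μ).prod (μ.prod μ)) := by
    rw [← integral_prod_swap]
    simp only [Prod.snd_swap, hsymm]
  calc _ ≤ ∫ p : (ℂ × ℂ) × ℂ × ℂ,
        (1 / 2 * (g p.1.1 p.1.2 ^ 2 * w p) + 1 / 2 * (g p.2.1 p.2.2 ^ 2 * w p))
        ∂((μ.prod μ).prod (μ.prod μ)) := by
        refine integral_mono iF ((i1.const_mul _).add (i2.const_mul _)) fun p => ?_
        have h1 : g p.1.1 p.1.2 * g p.2.1 p.2.2 * F p ≤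
            |g p.1.1 p.1.2| * |g p.2.1 p.2.2| * w p := by
          refine (le_abs_self _).trans ?_
          rw [abs_mul, abs_mul]
          gcongr
          exact hFw p
        refine h1.trans ?_
        have hw0 : 0 ≤ w p := (abs_nonneg _).trans (hFw p)
        have h2 : |g p.1.1 p.1.2| * |g p.2.1 p.2.2| ≤
            1 / 2 * g p.1.1 p.1.2 ^ 2 + 1 / 2 * g p.2.1 p.2.2 ^ 2 := by
          nlinarith [sq_abs (g p.1.1 p.1.2), sq_abs (g p.2.1 p.2.2),
            sq_nonneg (|g p.1.1 p.1.2| - |g p.2.1 p.2.2|)]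
        calc _ ≤ (1 / 2 * g p.1.1 p.1.2 ^ 2 + 1 / 2 * g p.2.1 p.2.2 ^ 2) * w p := by gcongr
          _ = _ := by ring
    _ = ∫ p : (ℂ × ℂ) × ℂ × ℂ, g p.1.1 p.1.2 ^ 2 * w p ∂((μ.prod μ).prod (μ.prod μ)) := by
        rw [integral_add (i1.const_mul _) (i2.const_mul _), integral_const_mul, integral_const_mul,
          e]
        ring
    _ = ∫ p : ℂ × ℂ, g p.1 p.2 ^ 2 * ∫ q, w (p, q) ∂(μ.prod μ) ∂(μ.prod μ) := by
        rw [integral_prod _ i1]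
        simp only [integral_const_mul]
    _ ≤ _ := by
        refine integral_mono_of_nonneg (Eventually.of_forall fun p => mul_nonneg (sq_nonneg _)
          (integral_nonneg fun q => (abs_nonneg _).trans (hFw _)))
          (hg.integrable_sq_mul hu hC') (Eventually.of_forall fun p => ?_)
        simp only
        gcongr
        exact hwu p

end

/-- Bounded measurable weights. -/
def IsBddMeasurable {α : Type*} [MeasurableSpace α] (w : α → ℝ) : Prop :=
  Measurable w ∧ ∃ C : ℝ, ∀ p, |w p| ≤ C

section

variable {α : Type*} [MeasurableSpace α] {v w : α → ℝ}

lemma IsBddMeasurable.add (hv : IsBddMeasurable v) (hw : IsBddMeasurable w) :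
    IsBddMeasurable fun p => v p + w p :=
  let ⟨C, hC⟩ := hv.2
  let ⟨D, hD⟩ := hw.2
  ⟨hv.1.add hw.1, C + D, fun p => (abs_add_le _ _).trans (add_le_add (hC p) (hD p))⟩

lemma IsBddMeasurable.sub (hv : IsBddMeasurable v) (hw : IsBddMeasurable w) :
    IsBddMeasurable fun p => v p - w p :=
  let ⟨C, hC⟩ := hv.2
  let ⟨D, hD⟩ := hw.2
  ⟨hv.1.sub hw.1, C + D, fun p => (abs_sub _ _).trans (add_le_add (hC p) (hD p))⟩

lemma IsBddMeasurable.mul (hv : IsBddMeasurable v) (hw : IsBddMeasurable w) :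
    IsBddMeasurable fun p => v p * w p :=
  let ⟨C, hC⟩ := hv.2
  let ⟨D, hD⟩ := hw.2
  ⟨hv.1.mul hw.1, C * D, fun p => by
    rw [abs_mul]
    exact mul_le_mul (hC p) (hD p) (abs_nonneg _) ((abs_nonneg _).trans (hC p))⟩

lemma isBddMeasurable_const (c : ℝ) : IsBddMeasurable fun _ : α => c :=
  ⟨measurable_const, |c|, fun _ => le_rfl⟩

lemma isBddMeasurable_gaussWeight {c : ℝ} (hc : 0 < c) {x y : α → ℂ} (hx : Measurable x)
    (hy : Measurable y) : IsBddMeasurable fun p => gaussWeight c (x p) (y p) :=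
  ⟨measurable_gaussWeight_comp c hx hy, 1, fun _ => abs_gaussWeight_le_one hc _ _⟩

lemma isBddMeasurable_cycle3 {x y z : α → ℂ} (hx : Measurable x) (hy : Measurable y)
    (hz : Measurable z) : IsBddMeasurable fun p => cycle3 (x p) (y p) (z p) :=
  ⟨measurable_cycle3_comp hx hy hz, 1, fun _ => abs_cycle3_le_one _ _ _⟩

lemma isBddMeasurable_cycleWeight : IsBddMeasurable cycleWeight := by
  have h : (0 : ℝ) < Real.pi / 8 := by positivity
  unfold cycleWeight
  exact ((isBddMeasurable_gaussWeight h (by fun_prop) (by fun_prop)).mul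
    (isBddMeasurable_gaussWeight h (by fun_prop) (by fun_prop))).mul
    ((isBddMeasurable_gaussWeight h (by fun_prop) (by fun_prop)).mul
    (isBddMeasurable_gaussWeight h (by fun_prop) (by fun_prop)))

end

/-! ### Integrals of the interaction against the correlation functions. -/

/-- The two-point correlation function of the Ginibre process. -/
noncomputable def rho2 (a b : ℂ) : ℝ := 1 - gaussWeight Real.pi a b

/-- The three-point correlation function of the Ginibre process. -/
noncomputable def rho3 (a b c : ℂ) : ℝ :=
  1 - gaussWeight Real.pi a b - gaussWeight Real.pi a c - gaussWeight Real.pi b c +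
    2 * cycle3 a b c

/-- The four-point correlation function of the Ginibre process. -/
noncomputable def rho4 (a b c d : ℂ) : ℝ :=
  1 - gaussWeight Real.pi a b - gaussWeight Real.pi a c - gaussWeight Real.pi a d -
    gaussWeight Real.pi b c - gaussWeight Real.pi b d - gaussWeight Real.pi c d +
    2 * cycle3 a b c + 2 * cycle3 a b d + 2 * cycle3 a c d + 2 * cycle3 b c d +
    gaussWeight Real.pi a b * gaussWeight Real.pi c d +
    gaussWeight Real.pi a c * gaussWeight Real.pi b d +
    gaussWeight Real.pi a d * gaussWeight Real.pi b c -
    2 * cycle4 a b c d - 2 * cycle4 a b d c - 2 * cycle4 a c b d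

lemma isBddMeasurable_cycle4_sum : IsBddMeasurable fun p : (ℂ × ℂ) × ℂ × ℂ =>
    -2 * cycle4 p.1.1 p.1.2 p.2.1 p.2.2 - 2 * cycle4 p.1.1 p.1.2 p.2.2 p.2.1 -
      2 * cycle4 p.1.1 p.2.1 p.1.2 p.2.2 := by
  obtain ⟨C, hC⟩ := isBddMeasurable_cycleWeight.2
  refine ⟨?_, 6 * C, fun p => (abs_cycle4_sum_le _ _ _ _).trans ?_⟩
  · have m1 : Measurable fun p : (ℂ × ℂ) × ℂ × ℂ => p.1.1 := by fun_prop
    have m2 : Measurable fun p : (ℂ × ℂ) × ℂ × ℂ => p.1.2 := by fun_prop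
    have m3 : Measurable fun p : (ℂ × ℂ) × ℂ × ℂ => p.2.1 := by fun_prop
    have m4 : Measurable fun p : (ℂ × ℂ) × ℂ × ℂ => p.2.2 := by fun_prop
    exact (((measurable_cycle4_comp m1 m2 m3 m4).const_mul _).sub
      ((measurable_cycle4_comp m1 m2 m4 m3).const_mul _)).sub
      ((measurable_cycle4_comp m1 m3 m2 m4).const_mul _)
  · exact mul_le_mul_of_nonneg_left ((le_abs_self _).trans (hC p)) (by norm_num)

lemma IsCentered.integrable_sq_mul_rho2 {μ : Measure ℂ} {g : ℂ → ℂ → ℝ}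
    (hg : IsCentered μ g) :
    Integrable (fun q : ℂ × ℂ => g q.1 q.2 ^ 2 * rho2 q.1 q.2) (μ.prod μ) := by
  obtain ⟨C, hC⟩ := ((isBddMeasurable_const 1).sub (isBddMeasurable_gaussWeight Real.pi_pos
    (measurable_fst (α := ℂ) (β := ℂ)) measurable_snd)).2
  exact hg.integrable_sq_mul (measurable_const.sub (continuous_gaussWeight _).measurable) hC

lemma IsCentered.integral_sq_mul_rho2_le {μ : Measure ℂ} {g : ℂ → ℂ → ℝ} (hg : IsCentered μ g) :
    ∫ q : ℂ × ℂ, g q.1 q.2 ^ 2 * rho2 q.1 q.2 ∂(μ.prod μ) ≤ selfEnergy μ g := by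
  refine integral_mono hg.integrable_sq_mul_rho2 hg.integrable_sq fun q => ?_
  have := gaussWeight_pos Real.pi q.1 q.2
  exact mul_le_of_le_one_right (sq_nonneg _) (by rw [rho2]; linarith)

section

variable {μ : Measure ℂ} [IsFiniteMeasure μ] {g : ℂ → ℂ → ℝ}

/-- The mean of the interaction against the squared modulus of the kernel. -/
noncomputable def kernelEnergy (μ : Measure ℂ) (g : ℂ → ℂ → ℝ) : ℝ :=
  ∫ q : ℂ × ℂ, g q.1 q.2 * gaussWeight Real.pi q.1 q.2 ∂(μ.prod μ)

/-- The integral of two disjoint interactions against a weight. -/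
noncomputable def pairIntegral (μ : Measure ℂ) (g : ℂ → ℂ → ℝ) (w : (ℂ × ℂ) × ℂ × ℂ → ℝ) : ℝ :=
  ∫ p : (ℂ × ℂ) × ℂ × ℂ, g p.1.1 p.1.2 * g p.2.1 p.2.2 * w p ∂((μ.prod μ).prod (μ.prod μ))

/-- The integral of two interactions with a common point against a weight. -/
noncomputable def starIntegral (μ : Measure ℂ) (g : ℂ → ℂ → ℝ) (w : ℂ × ℂ × ℂ → ℝ) : ℝ :=
  ∫ p : ℂ × ℂ × ℂ, g p.1 p.2.2 * g p.2.1 p.2.2 * w p ∂(μ.prod (μ.prod μ))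

lemma IsCentered.integrable_pair (hg : IsCentered μ g) {w : (ℂ × ℂ) × ℂ × ℂ → ℝ}
    (hw : IsBddMeasurable w) :
    Integrable (fun p : (ℂ × ℂ) × ℂ × ℂ => g p.1.1 p.1.2 * g p.2.1 p.2.2 * w p)
      ((μ.prod μ).prod (μ.prod μ)) :=
  let ⟨_, hC⟩ := hw.2
  hg.integrable_pair_mul hw.1 hC

lemma IsCentered.integrable_star (hg : IsCentered μ g) {w : ℂ × ℂ × ℂ → ℝ}
    (hw : IsBddMeasurable w) :
    Integrable (fun p : ℂ × ℂ × ℂ => g p.1 p.2.2 * g p.2.1 p.2.2 * w p) (μ.prod (μ.prod μ)) :=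
  let ⟨_, hC⟩ := hw.2
  hg.integrable_triple_mul hw.1 hC

lemma IsCentered.pairIntegral_add (hg : IsCentered μ g) {v w : (ℂ × ℂ) × ℂ × ℂ → ℝ}
    (hv : IsBddMeasurable v) (hw : IsBddMeasurable w) :
    pairIntegral μ g (fun p => v p + w p) = pairIntegral μ g v + pairIntegral μ g w := by
  rw [pairIntegral, pairIntegral, pairIntegral,
    ← integral_add (hg.integrable_pair hv) (hg.integrable_pair hw)]
  simp_rw [mul_add]

lemma IsCentered.starIntegral_add (hg : IsCentered μ g) {v w : ℂ × ℂ × ℂ → ℝ}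
    (hv : IsBddMeasurable v) (hw : IsBddMeasurable w) :
    starIntegral μ g (fun p => v p + w p) = starIntegral μ g v + starIntegral μ g w := by
  rw [starIntegral, starIntegral, starIntegral,
    ← integral_add (hg.integrable_star hv) (hg.integrable_star hw)]
  simp_rw [mul_add]

/-- The second point appears only in the factor `g p.2.1 p.2.2`, whose mean in that variable is
zero. -/
lemma IsCentered.starIntegral_eq_zero_of_snd (hg : IsCentered μ g) (ψ : ℂ → ℂ → ℝ) :
    starIntegral μ g (fun p => ψ p.1 p.2.2) = 0 := by
  rw [starIntegral]
  by_cases hi : Integrable (fun p : ℂ × ℂ × ℂ => g p.1 p.2.2 * g p.2.1 p.2.2 * ψ p.1 p.2.2)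
    (μ.prod (μ.prod μ))
  · rw [integral_prod _ hi]
    refine integral_eq_zero_of_ae (Eventually.of_forall fun a => ?_)
    simp only [Pi.zero_apply]
    rw [← hg.integral_mul_snd fun c => g a c * ψ a c]
    refine integral_congr_ae (Eventually.of_forall fun p => ?_)
    simp only
    ring
  · exact integral_undef hi

lemma starIntegral_leftComm (w : ℂ × ℂ × ℂ → ℝ) :
    starIntegral μ g (fun p => w (leftComm p)) = starIntegral μ g w := by
  rw [starIntegral, starIntegral, ← (measurePreserving_leftComm μ).integral_comp' (fun p =>
    g p.1 p.2.2 * g p.2.1 p.2.2 * w p)]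
  refine integral_congr_ae (Eventually.of_forall fun p => ?_)
  simp only
  rw [mul_comm (g p.1 p.2.2)]
  rfl

lemma IsCentered.starIntegral_eq_zero_of_fst (hg : IsCentered μ g) (ψ : ℂ → ℂ → ℝ) :
    starIntegral μ g (fun p => ψ p.2.1 p.2.2) = 0 := by
  rw [← starIntegral_leftComm]
  exact hg.starIntegral_eq_zero_of_snd ψ

/-- The Schur test for two interactions sharing their last point; the symmetry used is the exchange
of the two outer points. -/
lemma IsCentered.starIntegral_le (hg : IsCentered μ g) {F w : ℂ × ℂ × ℂ → ℝ}
    (hF : IsBddMeasurable F) (hw : IsBddMeasurable w) (hFw : ∀ p, |F p| ≤ w p)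
    (hsymm : ∀ p, w (leftComm p) = w p) {u : ℂ × ℂ → ℝ} (hu : IsBddMeasurable u)
    (hwu : ∀ p, ∫ a, w (a, p) ∂μ ≤ u p) :
    starIntegral μ g F ≤ ∫ p : ℂ × ℂ, g p.1 p.2 ^ 2 * u p ∂(μ.prod μ) := by
  obtain ⟨C, hC⟩ := hw.2
  obtain ⟨C', hC'⟩ := hu.2
  have i1 := hg.integrable_fst_sq_mul hw.1 hC
  have i2 := hg.integrable_snd_sq_mul hw.1 hC
  calc starIntegral μ g F ≤ ∫ p : ℂ × ℂ × ℂ,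
        (1 / 2 * (g p.1 p.2.2 ^ 2 * w p) + 1 / 2 * (g p.2.1 p.2.2 ^ 2 * w p))
        ∂(μ.prod (μ.prod μ)) := by
        refine integral_mono (hg.integrable_star hF) ((i1.const_mul _).add (i2.const_mul _))
          fun p => ?_
        have h1 : g p.1 p.2.2 * g p.2.1 p.2.2 * F p ≤
            |g p.1 p.2.2| * |g p.2.1 p.2.2| * w p := by
          refine (le_abs_self _).trans ?_
          rw [abs_mul, abs_mul]
          gcongr
          exact hFw p
        refine h1.trans ?_
        have hw0 : 0 ≤ w p := (abs_nonneg _).trans (hFw p)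
        have h2 : |g p.1 p.2.2| * |g p.2.1 p.2.2| ≤
            1 / 2 * g p.1 p.2.2 ^ 2 + 1 / 2 * g p.2.1 p.2.2 ^ 2 := by
          nlinarith [sq_abs (g p.1 p.2.2), sq_abs (g p.2.1 p.2.2),
            sq_nonneg (|g p.1 p.2.2| - |g p.2.1 p.2.2|)]
        calc _ ≤ (1 / 2 * g p.1 p.2.2 ^ 2 + 1 / 2 * g p.2.1 p.2.2 ^ 2) * w p := by gcongr
          _ = _ := by ring
    _ = ∫ p : ℂ × ℂ × ℂ, g p.2.1 p.2.2 ^ 2 * w p ∂(μ.prod (μ.prod μ)) := by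
        rw [integral_add (i1.const_mul _) (i2.const_mul _), integral_const_mul, integral_const_mul,
          integral_fst_sq_mul_eq hsymm]
        ring
    _ = ∫ p : ℂ × ℂ, g p.1 p.2 ^ 2 * ∫ a, w (a, p) ∂μ ∂(μ.prod μ) := by
        rw [integral_prod_symm _ i2]
        simp only [integral_const_mul]
    _ ≤ _ := by
        refine integral_mono_of_nonneg (Eventually.of_forall fun p => mul_nonneg (sq_nonneg _)
          (integral_nonneg fun q => (abs_nonneg _).trans (hFw _)))
          (hg.integrable_sq_mul hu.1 hC') (Eventually.of_forall fun p => ?_)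
        simp only
        gcongr
        exact hwu p

lemma IsCentered.pairIntegral_le (hg : IsCentered μ g) {F w : (ℂ × ℂ) × ℂ × ℂ → ℝ}
    (hF : IsBddMeasurable F) (hw : IsBddMeasurable w) (hFw : ∀ p, |F p| ≤ w p)
    (hsymm : ∀ p, w p.swap = w p) {u : ℂ × ℂ → ℝ} (hu : IsBddMeasurable u)
    (hwu : ∀ p, ∫ q, w (p, q) ∂(μ.prod μ) ≤ u p) :
    pairIntegral μ g F ≤ ∫ p : ℂ × ℂ, g p.1 p.2 ^ 2 * u p ∂(μ.prod μ) :=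
  let ⟨_, hC⟩ := hw.2
  let ⟨_, hC'⟩ := hu.2
  hg.integral_pair_mul_le hF.1 hw.1 hC hFw hsymm hu.1 hC' hwu

lemma IsCentered.integral_rho2 (hg : IsCentered μ g) :
    ∫ q : ℂ × ℂ, g q.1 q.2 * rho2 q.1 q.2 ∂(μ.prod μ) = -kernelEnergy μ g := by
  have h1 : Integrable (fun q : ℂ × ℂ => g q.1 q.2 * gaussWeight Real.pi q.1 q.2) (μ.prod μ) :=
    hg.integrable.mul_bdd (continuous_gaussWeight _).aestronglyMeasurable
      (Eventually.of_forall fun q => abs_gaussWeight_le_one Real.pi_pos q.1 q.2)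
  have h0 := hg.integral_mul_fst fun _ => 1
  simp only [mul_one] at h0
  simp only [rho2, mul_sub, mul_one]
  rw [integral_sub hg.integrable h1, h0, zero_sub, kernelEnergy]

lemma isBddMeasurable_rho3 : IsBddMeasurable fun p : ℂ × ℂ × ℂ => rho3 p.1 p.2.1 p.2.2 := by
  have m1 : Measurable fun p : ℂ × ℂ × ℂ => p.1 := by fun_prop
  have m2 : Measurable fun p : ℂ × ℂ × ℂ => p.2.1 := by fun_prop
  have m3 : Measurable fun p : ℂ × ℂ × ℂ => p.2.2 := by fun_prop
  have hk {x y : ℂ × ℂ × ℂ → ℂ} (hx : Measurable x) (hy : Measurable y) :=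
    isBddMeasurable_gaussWeight Real.pi_pos hx hy
  exact ((((isBddMeasurable_const 1).sub (hk m1 m2)).sub (hk m1 m3)).sub (hk m2 m3)).add
    ((isBddMeasurable_const 2).mul (isBddMeasurable_cycle3 m1 m2 m3))

lemma gaussWeight_anti {c d : ℝ} (h : c ≤ d) (x y : ℂ) : gaussWeight d x y ≤ gaussWeight c x y := by
  rw [gaussWeight, gaussWeight, Real.exp_le_exp]
  nlinarith [sq_nonneg ‖x - y‖]

/-- Of the terms of `rho3`, only the transposition of the two outer points and the 3-cycles involve
both of these points. The former gives `-crossEnergy`; the latter are localized and go through the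
Schur test. -/
lemma IsCentered.starIntegral_rho3_le {N : ℝ} (hg : IsCentered (squareMeasure N) g) :
    starIntegral (squareMeasure N) g (fun p => rho3 p.1 p.2.1 p.2.2) ≤
      -crossEnergy (squareMeasure N) g + 4 * shortEnergy (Real.pi / 8) (squareMeasure N) g := by
  have m1 : Measurable fun p : ℂ × ℂ × ℂ => p.1 := by fun_prop
  have m2 : Measurable fun p : ℂ × ℂ × ℂ => p.2.1 := by fun_prop
  have m3 : Measurable fun p : ℂ × ℂ × ℂ => p.2.2 := by fun_prop
  have hk {x y : ℂ × ℂ × ℂ → ℂ} (hx : Measurable x) (hy : Measurable y) :=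
    isBddMeasurable_gaussWeight Real.pi_pos hx hy
  have hp2 : 0 < Real.pi / 2 := by positivity
  have hp8 : 0 < Real.pi / 8 := by positivity
  have hk2 {x y : ℂ × ℂ × ℂ → ℂ} (hx : Measurable x) (hy : Measurable y) :=
    isBddMeasurable_gaussWeight hp2 hx hy
  set w1 : ℂ × ℂ × ℂ → ℝ := fun p => 1 - gaussWeight Real.pi p.1 p.2.2 with hw1
  set w2 : ℂ × ℂ × ℂ → ℝ := fun p => -1 * gaussWeight Real.pi p.2.1 p.2.2 with hw2
  set w3 : ℂ × ℂ × ℂ → ℝ := fun p => -1 * gaussWeight Real.pi p.1 p.2.1 with hw3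
  set w4 : ℂ × ℂ × ℂ → ℝ := fun p => 2 * cycle3 p.1 p.2.1 p.2.2 with hw4
  have b1 : IsBddMeasurable w1 := (isBddMeasurable_const 1).sub (hk m1 m3)
  have b2 : IsBddMeasurable w2 := (isBddMeasurable_const (-1)).mul (hk m2 m3)
  have b3 : IsBddMeasurable w3 := (isBddMeasurable_const (-1)).mul (hk m1 m2)
  have b4 : IsBddMeasurable w4 := (isBddMeasurable_const 2).mul (isBddMeasurable_cycle3 m1 m2 m3)
  have hsplit : (fun p : ℂ × ℂ × ℂ => rho3 p.1 p.2.1 p.2.2) =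
      fun p => ((w1 p + w2 p) + w3 p) + w4 p := by
    funext p
    simp only [rho3, hw1, hw2, hw3, hw4]
    ring
  rw [hsplit, hg.starIntegral_add ((b1.add b2).add b3) b4, hg.starIntegral_add (b1.add b2) b3,
    hg.starIntegral_add b1 b2, hg.starIntegral_eq_zero_of_snd fun a c => 1 - gaussWeight Real.pi a c,
    hg.starIntegral_eq_zero_of_fst fun b c => -1 * gaussWeight Real.pi b c, zero_add, zero_add]
  refine add_le_add (le_of_eq ?_) ?_
  · rw [starIntegral, crossEnergy, ← integral_neg]
    refine integral_congr_ae (Eventually.of_forall fun p => ?_)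
    simp only [hw3]
    ring
  · have h := hg.starIntegral_le (F := w4) b4
      (w := fun p => 2 * (gaussWeight (Real.pi / 2) p.1 p.2.1 *
        gaussWeight (Real.pi / 2) p.2.1 p.2.2 * gaussWeight (Real.pi / 2) p.1 p.2.2))
      ((isBddMeasurable_const 2).mul (((hk2 m1 m2).mul (hk2 m2 m3)).mul (hk2 m1 m3)))
      (fun p => by
        rw [hw4, abs_mul, abs_two]
        have := abs_cycle3_le p.1 p.2.1 p.2.2
        rw [gaussWeight_comm _ p.2.2] at this
        gcongr)
      (fun p => by
        change 2 * (gaussWeight (Real.pi / 2) p.2.1 p.1 * gaussWeight (Real.pi / 2) p.1 p.2.2 *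
          gaussWeight (Real.pi / 2) p.2.1 p.2.2) = _
        rw [gaussWeight_comm _ p.2.1 p.1]
        ring)
      -- The constant is `2 · π / (π/2)`. The exponent is weakened from `π/2` to `π/8` to match the
      -- weight needed for the 4-cycles.
      (u := fun q => 4 * gaussWeight (Real.pi / 8) q.1 q.2)
      ((isBddMeasurable_const 4).mul
        (isBddMeasurable_gaussWeight hp8 measurable_fst measurable_snd))
      (fun q => by
        have hi := ((integrable_gaussWeight hp2 q.1).integrableOn (s := square N)).const_mul
          (2 * gaussWeight (Real.pi / 8) q.1 q.2)
        calc _ ≤ ∫ a in square N,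
              2 * gaussWeight (Real.pi / 8) q.1 q.2 * gaussWeight (Real.pi / 2) q.1 a := by
              refine integral_mono_of_nonneg (Eventually.of_forall fun a => ?_) hi
                (Eventually.of_forall fun a => ?_)
              · have := gaussWeight_pos (Real.pi / 2) a q.1
                have := gaussWeight_pos (Real.pi / 2) q.1 q.2
                have := gaussWeight_pos (Real.pi / 2) a q.2
                simp only [Pi.zero_apply]
                positivity
              · have h1 := gaussWeight_pos (Real.pi / 2) a q.1
                have h2 := gaussWeight_pos (Real.pi / 2) q.1 q.2
                have h3 := gaussWeight_le_one hp2 a q.2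
                have h5 := gaussWeight_pos (Real.pi / 2) a q.2
                have h6 := gaussWeight_pos (Real.pi / 8) q.1 q.2
                have h4 : gaussWeight (Real.pi / 2) q.1 q.2 ≤ gaussWeight (Real.pi / 8) q.1 q.2 :=
                  gaussWeight_anti (by linarith [Real.pi_pos]) _ _
                simp only
                rw [gaussWeight_comm _ q.1 a]
                calc 2 * (gaussWeight (Real.pi / 2) a q.1 * gaussWeight (Real.pi / 2) q.1 q.2 *
                      gaussWeight (Real.pi / 2) a q.2)
                    ≤ 2 * (gaussWeight (Real.pi / 2) a q.1 * gaussWeight (Real.pi / 8) q.1 q.2 *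
                      1) := by gcongr
                  _ = _ := by ring
          _ ≤ 2 * gaussWeight (Real.pi / 8) q.1 q.2 * (Real.pi / (Real.pi / 2)) := by
              rw [integral_const_mul]
              have := gaussWeight_pos (Real.pi / 8) q.1 q.2
              gcongr
              exact setIntegral_gaussWeight_le hp2 _ _
          _ = _ := by
              field_simp
              ring)
    refine h.trans (le_of_eq ?_)
    rw [shortEnergy, ← integral_const_mul]
    refine integral_congr_ae (Eventually.of_forall fun p => ?_)
    simp only
    ring

lemma isBddMeasurable_rho4 :
    IsBddMeasurable fun p : (ℂ × ℂ) × ℂ × ℂ => rho4 p.1.1 p.1.2 p.2.1 p.2.2 := by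
  have m1 : Measurable fun p : (ℂ × ℂ) × ℂ × ℂ => p.1.1 := by fun_prop
  have m2 : Measurable fun p : (ℂ × ℂ) × ℂ × ℂ => p.1.2 := by fun_prop
  have m3 : Measurable fun p : (ℂ × ℂ) × ℂ × ℂ => p.2.1 := by fun_prop
  have m4 : Measurable fun p : (ℂ × ℂ) × ℂ × ℂ => p.2.2 := by fun_prop
  have hk {x y : (ℂ × ℂ) × ℂ × ℂ → ℂ} (hx : Measurable x) (hy : Measurable y) :=
    isBddMeasurable_gaussWeight Real.pi_pos hx hy
  have hc {x y z : (ℂ × ℂ) × ℂ × ℂ → ℂ} (hx : Measurable x) (hy : Measurable y)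
      (hz : Measurable z) := (isBddMeasurable_const 2).mul (isBddMeasurable_cycle3 hx hy hz)
  have h := ((((((((((((((isBddMeasurable_const 1).sub (hk m1 m2)).sub (hk m1 m3)).sub
    (hk m1 m4)).sub (hk m2 m3)).sub (hk m2 m4)).sub (hk m3 m4)).add (hc m1 m2 m3)).add
    (hc m1 m2 m4)).add (hc m1 m3 m4)).add (hc m2 m3 m4)).add ((hk m1 m2).mul (hk m3 m4))).add
    ((hk m1 m3).mul (hk m2 m4))).add ((hk m1 m4).mul (hk m2 m3))).add isBddMeasurable_cycle4_sum
  convert h using 2 with p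
  rw [rho4]
  ring

lemma integral_gaussWeight_mul_gaussWeight_le {c : ℝ} (hc : 0 < c) (N : ℝ) (a b : ℂ) :
    ∫ q : ℂ × ℂ, gaussWeight c a q.1 * gaussWeight c b q.2
      ∂((squareMeasure N).prod (squareMeasure N)) ≤ (Real.pi / c) * (Real.pi / c) := by
  rw [integral_prod_mul (fun x => gaussWeight c a x) (fun y => gaussWeight c b y)]
  have h := setIntegral_gaussWeight_le hc a (square N)
  exact mul_le_mul h (setIntegral_gaussWeight_le hc b (square N))
    (integral_nonneg fun y => (gaussWeight_pos _ _ _).le) (by positivity)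

/-- Permutations with a fixed point contribute nothing, by centering. There remain the products of
two transpositions, one of which gives exactly the squared mean, and the 4-cycles. -/
lemma IsCentered.pairIntegral_rho4_le {N : ℝ} (hg : IsCentered (squareMeasure N) g) :
    pairIntegral (squareMeasure N) g (fun p => rho4 p.1.1 p.1.2 p.2.1 p.2.2) ≤
      kernelEnergy (squareMeasure N) g ^ 2 + 2 * selfEnergy (squareMeasure N) g +
        384 * shortEnergy (Real.pi / 8) (squareMeasure N) g := by
  have m1 : Measurable fun p : (ℂ × ℂ) × ℂ × ℂ => p.1.1 := by fun_prop
  have m2 : Measurable fun p : (ℂ × ℂ) × ℂ × ℂ => p.1.2 := by fun_prop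
  have m3 : Measurable fun p : (ℂ × ℂ) × ℂ × ℂ => p.2.1 := by fun_prop
  have m4 : Measurable fun p : (ℂ × ℂ) × ℂ × ℂ => p.2.2 := by fun_prop
  have hp8 : 0 < Real.pi / 8 := by positivity
  have hk {x y : (ℂ × ℂ) × ℂ × ℂ → ℂ} (hx : Measurable x) (hy : Measurable y) :=
    isBddMeasurable_gaussWeight Real.pi_pos hx hy
  have hc {x y z : (ℂ × ℂ) × ℂ × ℂ → ℂ} (hx : Measurable x) (hy : Measurable y)
      (hz : Measurable z) := (isBddMeasurable_const 2).mul (isBddMeasurable_cycle3 hx hy hz)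
  set k : ℂ → ℂ → ℝ := gaussWeight Real.pi with hkdef
  -- With the points called `a, b, c, d`, the terms with a fixed point are sorted so that `wd`,
  -- `wc`, `wb`, `wa` do not depend on `d`, `c`, `b`, `a` respectively.
  set wd : (ℂ × ℂ) × ℂ × ℂ → ℝ := fun p =>
    1 - k p.1.1 p.1.2 - k p.1.1 p.2.1 - k p.1.2 p.2.1 + 2 * cycle3 p.1.1 p.1.2 p.2.1 with hwd
  set wc : (ℂ × ℂ) × ℂ × ℂ → ℝ := fun p =>
    2 * cycle3 p.1.1 p.1.2 p.2.2 - k p.1.1 p.2.2 - k p.1.2 p.2.2 with hwc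
  set wb : (ℂ × ℂ) × ℂ × ℂ → ℝ := fun p =>
    2 * cycle3 p.1.1 p.2.1 p.2.2 - k p.2.1 p.2.2 with hwb
  set wa : (ℂ × ℂ) × ℂ × ℂ → ℝ := fun p => 2 * cycle3 p.1.2 p.2.1 p.2.2 with hwa
  set v1 : (ℂ × ℂ) × ℂ × ℂ → ℝ := fun p => k p.1.1 p.1.2 * k p.2.1 p.2.2 with hv1
  set v2 : (ℂ × ℂ) × ℂ × ℂ → ℝ := fun p => k p.1.1 p.2.1 * k p.1.2 p.2.2 with hv2
  set v3 : (ℂ × ℂ) × ℂ × ℂ → ℝ := fun p => k p.1.1 p.2.2 * k p.1.2 p.2.1 with hv3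
  set v4 : (ℂ × ℂ) × ℂ × ℂ → ℝ := fun p =>
    -2 * cycle4 p.1.1 p.1.2 p.2.1 p.2.2 - 2 * cycle4 p.1.1 p.1.2 p.2.2 p.2.1 -
      2 * cycle4 p.1.1 p.2.1 p.1.2 p.2.2 with hv4
  have bd : IsBddMeasurable wd := ((((isBddMeasurable_const 1).sub (hk m1 m2)).sub
    (hk m1 m3)).sub (hk m2 m3)).add (hc m1 m2 m3)
  have bc : IsBddMeasurable wc := ((hc m1 m2 m4).sub (hk m1 m4)).sub (hk m2 m4)
  have bb : IsBddMeasurable wb := (hc m1 m3 m4).sub (hk m3 m4)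
  have ba : IsBddMeasurable wa := hc m2 m3 m4
  have b1 : IsBddMeasurable v1 := (hk m1 m2).mul (hk m3 m4)
  have b2 : IsBddMeasurable v2 := (hk m1 m3).mul (hk m2 m4)
  have b3 : IsBddMeasurable v3 := (hk m1 m4).mul (hk m2 m3)
  have b4 : IsBddMeasurable v4 := isBddMeasurable_cycle4_sum
  have hsplit : (fun p : (ℂ × ℂ) × ℂ × ℂ => rho4 p.1.1 p.1.2 p.2.1 p.2.2) =
      fun p => ((((((wd p + wc p) + wb p) + wa p) + v1 p) + v2 p) + v3 p) + v4 p := by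
    funext p
    simp only [rho4, hwd, hwc, hwb, hwa, hv1, hv2, hv3, hv4, hkdef]
    ring
  have zd : pairIntegral (squareMeasure N) g wd = 0 := hg.integral_pair_mul_eq_zero_of_snd
    fun p => ⟨fun c => 1 - k p.1 p.2 - k p.1 c - k p.2 c + 2 * cycle3 p.1 p.2 c,
      Or.inl fun q => rfl⟩
  have zc : pairIntegral (squareMeasure N) g wc = 0 := hg.integral_pair_mul_eq_zero_of_snd
    fun p => ⟨fun d => 2 * cycle3 p.1 p.2 d - k p.1 d - k p.2 d, Or.inr fun q => rfl⟩
  have zb : pairIntegral (squareMeasure N) g wb = 0 := hg.integral_pair_mul_eq_zero_of_fst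
    fun q => ⟨fun a => 2 * cycle3 a q.1 q.2 - k q.1 q.2, Or.inl fun p => rfl⟩
  have za : pairIntegral (squareMeasure N) g wa = 0 := hg.integral_pair_mul_eq_zero_of_fst
    fun q => ⟨fun b => 2 * cycle3 b q.1 q.2, Or.inr fun p => rfl⟩
  have t1 : pairIntegral (squareMeasure N) g v1 = kernelEnergy (squareMeasure N) g ^ 2 := by
    rw [kernelEnergy, sq, ← integral_prod_mul, pairIntegral]
    refine integral_congr_ae (Eventually.of_forall fun p => ?_)
    simp only [hv1, hkdef]
    ring
  have hone : IsBddMeasurable fun _ : ℂ × ℂ => (1 : ℝ) := isBddMeasurable_const 1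
  have hself : ∫ p : ℂ × ℂ, g p.1 p.2 ^ 2 * 1 ∂((squareMeasure N).prod (squareMeasure N)) =
      selfEnergy (squareMeasure N) g := by simp only [mul_one, selfEnergy]
  have hpos : ∀ x y, 0 < k x y := gaussWeight_pos _
  have hdiv : Real.pi / Real.pi * (Real.pi / Real.pi) = 1 := by
    rw [div_self Real.pi_ne_zero, mul_one]
  have t2 : pairIntegral (squareMeasure N) g v2 ≤ selfEnergy (squareMeasure N) g := by
    rw [← hself]
    refine hg.pairIntegral_le b2 b2 (fun p => (abs_of_pos (mul_pos (hpos _ _) (hpos _ _))).le)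
      (fun p => ?_) hone fun p => ?_
    · simp only [hv2, Prod.fst_swap, Prod.snd_swap, hkdef]
      rw [gaussWeight_comm _ p.2.1, gaussWeight_comm _ p.2.2]
    · rw [← hdiv]
      exact integral_gaussWeight_mul_gaussWeight_le Real.pi_pos N p.1 p.2
  have t3 : pairIntegral (squareMeasure N) g v3 ≤ selfEnergy (squareMeasure N) g := by
    rw [← hself]
    refine hg.pairIntegral_le b3 b3 (fun p => (abs_of_pos (mul_pos (hpos _ _) (hpos _ _))).le)
      (fun p => ?_) hone fun p => ?_
    · simp only [hv3, Prod.fst_swap, Prod.snd_swap, hkdef]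
      rw [gaussWeight_comm _ p.2.1, gaussWeight_comm _ p.2.2, mul_comm]
    · rw [← hdiv]
      refine le_trans (le_of_eq ?_)
        (integral_gaussWeight_mul_gaussWeight_le Real.pi_pos N p.2 p.1)
      refine integral_congr_ae (Eventually.of_forall fun q => ?_)
      simp only [hv3, hkdef]
      ring
  have t4 : pairIntegral (squareMeasure N) g v4 ≤
      384 * shortEnergy (Real.pi / 8) (squareMeasure N) g := by
    have h := hg.pairIntegral_le (F := v4) b4 (w := fun p => 6 * cycleWeight p)
      ((isBddMeasurable_const 6).mul isBddMeasurable_cycleWeight)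
      (fun p => abs_cycle4_sum_le _ _ _ _)
      (fun p => by
        simp only [cycleWeight, Prod.fst_swap, Prod.snd_swap]
        rw [gaussWeight_comm _ p.2.1 p.1.1, gaussWeight_comm _ p.2.2 p.1.2]
        ring)
      -- `384 = 6 · 8 · 8`: six 4-cycles, and two Gaussian integrals equal to at most `π / (π/8)`;
      -- the factor in `c, d` is bounded by `1`.
      (u := fun q => 384 * gaussWeight (Real.pi / 8) q.1 q.2)
      ((isBddMeasurable_const 384).mul
        (isBddMeasurable_gaussWeight hp8 measurable_fst measurable_snd))
      (fun p => by
        have hi : Integrable (fun q : ℂ × ℂ => 6 * gaussWeight (Real.pi / 8) p.1 p.2 *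
            (gaussWeight (Real.pi / 8) p.1 q.1 * gaussWeight (Real.pi / 8) p.2 q.2))
            ((squareMeasure N).prod (squareMeasure N)) :=
          ((integrable_gaussWeight hp8 p.1).integrableOn.mul_prod
            (integrable_gaussWeight hp8 p.2).integrableOn).const_mul _
        calc _ ≤ ∫ q : ℂ × ℂ, 6 * gaussWeight (Real.pi / 8) p.1 p.2 *
              (gaussWeight (Real.pi / 8) p.1 q.1 * gaussWeight (Real.pi / 8) p.2 q.2)
              ∂((squareMeasure N).prod (squareMeasure N)) := by
              have hp : ∀ x y, 0 < gaussWeight (Real.pi / 8) x y := gaussWeight_pos _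
              refine integral_mono_of_nonneg (Eventually.of_forall fun q => ?_) hi
                (Eventually.of_forall fun q => ?_)
              · have h1 := hp p.1 p.2
                have h2 := hp q.1 q.2
                have h3 := hp p.1 q.1
                have h4 := hp p.2 q.2
                simp only [cycleWeight, Pi.zero_apply]
                positivity
              · have h1 := hp p.1 p.2
                have h2 := gaussWeight_le_one hp8 q.1 q.2
                have h3 := hp p.1 q.1
                have h4 := hp p.2 q.2
                simp only [cycleWeight]
                rw [mul_assoc 6]
                gcongr
                exact mul_le_of_le_one_right h1.le h2
          _ ≤ 6 * gaussWeight (Real.pi / 8) p.1 p.2 *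
              (Real.pi / (Real.pi / 8) * (Real.pi / (Real.pi / 8))) := by
              rw [integral_const_mul]
              have := gaussWeight_pos (Real.pi / 8) p.1 p.2
              gcongr
              exact integral_gaussWeight_mul_gaussWeight_le hp8 N p.1 p.2
          _ = _ := by
              field_simp
              ring)
    refine h.trans (le_of_eq ?_)
    rw [shortEnergy, ← integral_const_mul]
    refine integral_congr_ae (Eventually.of_forall fun p => ?_)
    simp only
    ring
  rw [hsplit, hg.pairIntegral_add ((((((bd.add bc).add bb).add ba).add b1).add b2).add b3) b4,
    hg.pairIntegral_add (((((bd.add bc).add bb).add ba).add b1).add b2) b3,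
    hg.pairIntegral_add ((((bd.add bc).add bb).add ba).add b1) b2,
    hg.pairIntegral_add (((bd.add bc).add bb).add ba) b1,
    hg.pairIntegral_add ((bd.add bc).add bb) ba,
    hg.pairIntegral_add (bd.add bc) bb, hg.pairIntegral_add bd bc, zd, zc, zb, za, t1]
  linarith

end

/-! ### The variance of the renormalized energy. -/

section

variable {Ω : Type*} [MeasurableSpace Ω] {P : Measure Ω} {X : Ω → Set ℂ} {N : ℝ}

/-- The points of a locally finite configuration in the square `[0, N]²`. -/
noncomputable def pointsIn (h : IsPointProcess X) (N : ℝ) (ω : Ω) : Finset ℂ :=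
  (h.locallyFinite ω (square N) (isCompact_square N)).toFinset

lemma coe_pointsIn (h : IsPointProcess X) (N : ℝ) (ω : Ω) :
    (pointsIn h N ω : Set ℂ) = X ω ∩ square N := Set.Finite.coe_toFinset _

lemma hasMeasurableCounts_pointsIn (h : IsPointProcess X) (N : ℝ) :
    HasMeasurableCounts (pointsIn h N) := by
  classical
  intro B hB
  have hm := h.measurable_count (square N ∩ B) ((measurableSet_square N).inter hB)
  have hcoe : Measurable fun n : ℕ∞ => (n : ℝ≥0∞) := measurable_from_top
  have hcomp : Measurable ((fun n : ℕ∞ => (n : ℝ≥0∞)) ∘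
      fun ω => (X ω ∩ (square N ∩ B)).encard) := hcoe.comp hm
  convert hcomp using 1
  funext ω
  have hset : X ω ∩ (square N ∩ B) = ((pointsIn h N ω).filter (· ∈ B) : Finset ℂ) := by
    rw [Finset.coe_filter, ← Set.inter_assoc, ← coe_pointsIn h N ω]
    rfl
  simp only [Function.comp_apply, hset, Set.encard_coe_eq_coe_finsetCard]
  simp [Set.indicator_apply]

/-- The interaction energy `∑_{a ≠ b} E_N(a - b)` of the points in the square. -/
noncomputable def energySum (h : IsPointProcess X) (N : ℝ) (ω : Ω) : ℝ :=
  tupleSum (pointsIn h N ω) fun x : Fin 2 → ℂ => pairEnergy N (x 0) (x 1)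

lemma renormalizedEnergy_eq (h : IsPointProcess X) (N : ℝ) (ω : Ω) :
    renormalizedEnergy N (X ω) = 1 / (2 * Real.pi * N ^ 2) * energySum h N ω +
      Real.log (N / (2 * Real.pi * (ModularForm.eta Complex.I).re ^ 2)) := by
  classical
  have h1 : (X ω ∩ (Set.Icc 0 N ×ℂ Set.Icc 0 N)).offDiag =
      ((pointsIn h N ω).offDiag : Finset (ℂ × ℂ)) := by
    rw [Finset.coe_offDiag, coe_pointsIn]
    rfl
  have h2 : (∑ᶠ p ∈ (X ω ∩ (Set.Icc 0 N ×ℂ Set.Icc 0 N)).offDiag,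
      eisensteinE N (p.1 - p.2)) = energySum h N ω := by
    have h3 : (pointsIn h N ω).offDiag =
        (pointsIn h N ω ×ˢ pointsIn h N ω).filter fun p => p.1 ≠ p.2 := by
      ext p
      simp [and_assoc]
    rw [h1, finsum_mem_coe_finset, energySum, tupleSum_two, ← Finset.sum_product', h3,
      Finset.sum_filter]
    rfl
  rw [renormalizedEnergy, h2]

lemma measurable_pairEnergy_comp {k : ℕ} (N : ℝ) (i j : Fin k) :
    Measurable fun x : Fin k → ℂ => pairEnergy N (x i) (x j) := by
  have h : Measurable ((fun p : ℂ × ℂ => pairEnergy N p.1 p.2) ∘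
      fun x : Fin k → ℂ => (x i, x j)) :=
    Measurable.comp (measurable_pairEnergy N)
      ((measurable_pi_apply i).prodMk (measurable_pi_apply j))
  exact h

lemma measurable_energySum (h : IsPointProcess X) (N : ℝ) : Measurable (energySum h N) :=
  (hasMeasurableCounts_pointsIn h N).measurable_tupleSum_real (measurable_pairEnergy_comp N 0 1)

lemma IsDeterminantal.hasCorrelation_two (hX : IsDeterminantal P X ginibreKernel) :
    HasCorrelation P X 2 fun x => rho2 (x 0) (x 1) := by
  obtain ⟨ρ, h, c⟩ := hX.correlation 2 (by norm_num)
  convert c using 1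
  funext x
  have hx : x = ![x 0, x 1] := by ext i; fin_cases i <;> rfl
  refine Complex.ofReal_injective ?_
  rw [h, hx]
  exact (det_two_eq _ _).symm

lemma IsDeterminantal.hasCorrelation_three (hX : IsDeterminantal P X ginibreKernel) :
    HasCorrelation P X 3 fun x => rho3 (x 0) (x 1) (x 2) := by
  obtain ⟨ρ, h, c⟩ := hX.correlation 3 (by norm_num)
  convert c using 1
  funext x
  have hx : x = ![x 0, x 1, x 2] := by ext i; fin_cases i <;> rfl
  refine Complex.ofReal_injective ?_
  rw [h, hx]
  exact (det_three_eq _ _ _).symm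

lemma IsDeterminantal.hasCorrelation_four (hX : IsDeterminantal P X ginibreKernel) :
    HasCorrelation P X 4 fun x => rho4 (x 0) (x 1) (x 2) (x 3) := by
  obtain ⟨ρ, h, c⟩ := hX.correlation 4 (by norm_num)
  convert c using 1
  funext x
  have hx : x = ![x 0, x 1, x 2, x 3] := by ext i; fin_cases i <;> rfl
  refine Complex.ofReal_injective ?_
  rw [h, hx]
  exact (det_four_eq _ _ _ _).symm

/-- The correlation formula transported along a measure preserving parametrization of tuples. -/
lemma integral_tupleSum_of_measurePreserving {α : Type*} [MeasurableSpace α] {ν : Measure α}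
    {k : ℕ} {ρ : (Fin k → ℂ) → ℝ} (hρ : HasCorrelation P X k ρ) (h : IsPointProcess X)
    {e : α → Fin k → ℂ} (he : MeasurePreserving e ν (Measure.pi fun _ => squareMeasure N))
    (hρm : Measurable ρ) {F : (Fin k → ℂ) → ℝ} (hF : Measurable F)
    (hint : Integrable (fun p => F (e p) * ρ (e p)) ν) :
    Integrable (fun ω => tupleSum (pointsIn h N ω) F) P ∧
      ∫ ω, tupleSum (pointsIn h N ω) F ∂P = ∫ p, F (e p) * ρ (e p) ∂ν := by
  have hm : AEStronglyMeasurable (fun x => F x * ρ x) (Measure.map e ν) :=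
    (hF.mul hρm).aestronglyMeasurable
  have hi : Integrable (fun x => F x * ρ x) (Measure.pi fun _ : Fin k => squareMeasure N) := by
    rw [← he.map_eq]
    exact (integrable_map_measure hm he.measurable.aemeasurable).2 hint
  have := integral_tupleSum hρ (measurableSet_square N) (coe_pointsIn h N)
    (hasMeasurableCounts_pointsIn h N) hF hi
  refine ⟨this.1, this.2.trans ?_⟩
  rw [← he.map_eq, integral_map he.measurable.aemeasurable hm]

lemma measurable_rho2_comp : Measurable fun x : Fin 2 → ℂ => rho2 (x 0) (x 1) :=
  measurable_const.sub
    (measurable_gaussWeight_comp _ (measurable_pi_apply 0) (measurable_pi_apply 1))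

lemma measurable_rho3_comp : Measurable fun x : Fin 3 → ℂ => rho3 (x 0) (x 1) (x 2) := by
  have h : Measurable ((fun p : ℂ × ℂ × ℂ => rho3 p.1 p.2.1 p.2.2) ∘
      fun x : Fin 3 → ℂ => (x 0, x 1, x 2)) :=
    Measurable.comp isBddMeasurable_rho3.1 (by fun_prop)
  exact h

lemma measurable_rho4_comp : Measurable fun x : Fin 4 → ℂ => rho4 (x 0) (x 1) (x 2) (x 3) := by
  have h : Measurable ((fun p : (ℂ × ℂ) × ℂ × ℂ => rho4 p.1.1 p.1.2 p.2.1 p.2.2) ∘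
      fun x : Fin 4 → ℂ => ((x 0, x 1), (x 2, x 3))) :=
    Measurable.comp isBddMeasurable_rho4.1 (by fun_prop)
  exact h

lemma integrable_energySum (hX : IsDeterminantal P X ginibreKernel) (hN : 0 < N) :
    Integrable (energySum hX.isPointProcess N) P ∧
      ∫ ω, energySum hX.isPointProcess N ω ∂P =
        -kernelEnergy (squareMeasure N) (pairEnergy N) := by
  have hg := isCentered_pairEnergy N hN
  have hi : Integrable (fun q : ℂ × ℂ => pairEnergy N q.1 q.2 * rho2 q.1 q.2)
      ((squareMeasure N).prod (squareMeasure N)) := by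
    obtain ⟨C, hC⟩ := ((isBddMeasurable_const 1).sub (isBddMeasurable_gaussWeight Real.pi_pos
      (measurable_fst (α := ℂ) (β := ℂ)) measurable_snd)).2
    exact hg.integrable.mul_bdd (measurable_const.sub
      (continuous_gaussWeight _).measurable).aestronglyMeasurable (Eventually.of_forall hC)
  have h := integral_tupleSum_of_measurePreserving hX.hasCorrelation_two hX.isPointProcess
    (measurePreserving_vec2 (squareMeasure N)) measurable_rho2_comp
    (measurable_pairEnergy_comp N 0 1) hi
  exact ⟨h.1, h.2.trans hg.integral_rho2⟩

/-- Weights `1`, `4`, `2` for quadruples, triples and pairs: the self energy appears `2 + 2` times,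
the cross energy `-4` times, and the short range energy `384 + 4 · 4 = 400` times. -/
lemma integrable_energySum_sq (hX : IsDeterminantal P X ginibreKernel) (hN : 0 < N) :
    Integrable (fun ω => energySum hX.isPointProcess N ω ^ 2) P ∧
      ∫ ω, energySum hX.isPointProcess N ω ^ 2 ∂P ≤
        kernelEnergy (squareMeasure N) (pairEnergy N) ^ 2 +
        4 * (selfEnergy (squareMeasure N) (pairEnergy N) -
          crossEnergy (squareMeasure N) (pairEnergy N)) +
        400 * shortEnergy (Real.pi / 8) (squareMeasure N) (pairEnergy N) := by
  have hg := isCentered_pairEnergy N hN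
  have m := fun {k : ℕ} (i j : Fin k) => measurable_pairEnergy_comp N i j
  have h2 := integral_tupleSum_of_measurePreserving hX.hasCorrelation_two hX.isPointProcess
    (measurePreserving_vec2 (squareMeasure N)) measurable_rho2_comp
    (F := fun x => pairEnergy N (x 0) (x 1) ^ 2) ((m 0 1).pow_const 2) hg.integrable_sq_mul_rho2
  have h3 := integral_tupleSum_of_measurePreserving hX.hasCorrelation_three hX.isPointProcess
    (measurePreserving_vec3 (squareMeasure N)) measurable_rho3_comp
    (F := fun x => pairEnergy N (x 0) (x 2) * pairEnergy N (x 1) (x 2)) ((m 0 2).mul (m 1 2))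
    (hg.integrable_star isBddMeasurable_rho3)
  have h4 := integral_tupleSum_of_measurePreserving hX.hasCorrelation_four hX.isPointProcess
    (measurePreserving_vec4 (squareMeasure N)) measurable_rho4_comp
    (F := fun x => pairEnergy N (x 0) (x 1) * pairEnergy N (x 2) (x 3)) ((m 0 1).mul (m 2 3))
    (hg.integrable_pair isBddMeasurable_rho4)
  have e2 := h2.2.trans_le hg.integral_sq_mul_rho2_le
  have e3 := h3.2.trans_le hg.starIntegral_rho3_le
  have e4 := h4.2.trans_le hg.pairIntegral_rho4_le
  simp only [energySum, sq_tupleSum_two _ (pairEnergy_comm N)]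
  have i3 := h3.1.const_mul 4
  have i2 := h2.1.const_mul 2
  have i43 : Integrable (fun ω => tupleSum (pointsIn hX.isPointProcess N ω)
      (fun x : Fin 4 → ℂ => pairEnergy N (x 0) (x 1) * pairEnergy N (x 2) (x 3)) +
      4 * tupleSum (pointsIn hX.isPointProcess N ω)
        (fun x : Fin 3 → ℂ => pairEnergy N (x 0) (x 2) * pairEnergy N (x 1) (x 2))) P :=
    h4.1.add i3
  refine ⟨i43.add i2, ?_⟩
  rw [integral_add i43 i2, integral_add h4.1 i3, integral_const_mul, integral_const_mul]
  linarith

lemma memLp_energySum (hX : IsDeterminantal P X ginibreKernel) (hN : 0 < N) :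
    MemLp (energySum hX.isPointProcess N) 2 P :=
  (memLp_two_iff_integrable_sq (measurable_energySum _ N).aestronglyMeasurable).2
    (integrable_energySum_sq hX hN).1

/-- The squared mean is `kernelEnergy ^ 2`, which cancels exactly the same term in the second
moment. -/
lemma variance_energySum_le [IsProbabilityMeasure P] (hX : IsDeterminantal P X ginibreKernel)
    (hN : 0 < N) : variance (energySum hX.isPointProcess N) P ≤
      4 * (selfEnergy (squareMeasure N) (pairEnergy N) -
        crossEnergy (squareMeasure N) (pairEnergy N)) +
      400 * shortEnergy (Real.pi / 8) (squareMeasure N) (pairEnergy N) := by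
  have h := (integrable_energySum_sq hX hN).2
  rw [variance_eq_sub (memLp_energySum hX hN), (integrable_energySum hX hN).2]
  simp only [Pi.pow_apply]
  linarith

lemma variance_renormalizedEnergy [IsProbabilityMeasure P]
    (hX : IsDeterminantal P X ginibreKernel) (N : ℝ) :
    variance (fun ω => renormalizedEnergy N (X ω)) P =
      (1 / (2 * Real.pi * N ^ 2)) ^ 2 * variance (energySum hX.isPointProcess N) P := by
  simp_rw [renormalizedEnergy_eq hX.isPointProcess N]
  rw [variance_add_const ((measurable_energySum _ N).const_mul _).aestronglyMeasurable,
    variance_const_mul]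

lemma tendsto_variance_renormalizedEnergy [IsProbabilityMeasure P]
    (hX : IsDeterminantal P X ginibreKernel) :
    Tendsto (fun N : ℝ => variance (fun ω => renormalizedEnergy N (X ω)) P) atTop (𝓝 0) := by
  have hp8 : 0 < Real.pi / 8 := by positivity
  rw [Metric.tendsto_nhds]
  intro ε hε
  filter_upwards [eventually_gt_atTop 0,
    -- The thresholds give `4 · ε/8 + 400 · ε/1600 = 3ε/4`.
    eventually_selfEnergy_sub_crossEnergy_le (ε / 8) (by positivity),
    eventually_shortEnergy_le hp8 (ε / 1600) (by positivity)] with N hN h1 h2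
  have hpos : (0 : ℝ) < N ^ 4 := by positivity
  rw [div_le_iff₀ hpos] at h1 h2
  rw [Real.dist_eq, sub_zero, abs_of_nonneg (variance_nonneg _ _),
    variance_renormalizedEnergy hX N]
  have hv := variance_energySum_le hX hN
  have hv0 := variance_nonneg (energySum hX.isPointProcess N) P
  have hc : (1 / (2 * Real.pi * N ^ 2)) ^ 2 = 1 / (4 * Real.pi ^ 2) * (1 / N ^ 4) := by
    field_simp
    norm_num
  have hc2 : 1 / (4 * Real.pi ^ 2) ≤ 1 := by
    rw [div_le_one (by positivity)]
    nlinarith [Real.pi_gt_three]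
  rw [hc]
  calc 1 / (4 * Real.pi ^ 2) * (1 / N ^ 4) * variance (energySum hX.isPointProcess N) P
      ≤ 1 * (1 / N ^ 4) * (3 / 4 * ε * N ^ 4) := by
        gcongr
        linarith
    _ = 3 / 4 * ε := by field_simp
    _ < ε := by linarith

end

end Ginibre

theorem mainTheorem6 {Ω : Type*} [MeasurableSpace Ω] (P : Measure Ω) [IsProbabilityMeasure P]
    (X : Ω → Set ℂ) (hX : Ginibre.IsDeterminantal P X Ginibre.ginibreKernel) :
    (∀ N : ℝ, 0 < N → MemLp (fun ω => Ginibre.renormalizedEnergy N (X ω)) 2 P) ∧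
      Tendsto (fun N : ℝ => variance (fun ω => Ginibre.renormalizedEnergy N (X ω)) P)
        atTop (𝓝 0) := by
  refine ⟨fun N hN => ?_, Ginibre.tendsto_variance_renormalizedEnergy hX⟩
  simp_rw [Ginibre.renormalizedEnergy_eq hX.isPointProcess N]
  exact ((Ginibre.memLp_energySum hX hN).const_mul _).add (memLp_const _)
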